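/- Let $n\ge 0$ and $k\in\mathbb Z$. For $N\ge 1$ let $M_N=T^*(\mathbb R/N\mathbb Z)^n$, with base coordinates $\gamma_i$, fibre coordinates $y_i$, symplectic form $(2\pi)^n\sum_i dy_i\wedge d\gamma_i$ and Liouville form $(2\pi)^n\sum_i y_i\,d\gamma_i$; put $M=M_1$, and let $\pi: M_N\to M$ be the covering $(y,\gamma \bmod N)\mapsto (y,\gamma\bmod 1)$. A point $(y,\gamma)$ of $M$ stands for the torus $\{(1:z_1:\dots:z_n) : |z_i|=e^{y_i}\}\subset\mathbb P^n$ together with the gauge class of the flat connection $d-i\sum_i\gamma_i\,d\theta_i$ on it, where $z_j=|z_j|e^{i\theta_j}$. Let $\mathcal L(\mathcal O(k),h_k)\subset M$ be the set of all these tori with the restrictions to them of the canonical connection $d-iA$, $A=i\,\partial h_k\cdot h_k^{-1}$, of the metric $h_k=(1+\sum_i|z_i|^2)^{-k}$ on $\mathcal O(k)$. An object of $Fuk(M)$ is understood here as a closed, embedded, exact Lagrangian submanifold whose closure in the fibrewise spherical compactification of $M$ belongs to the analytic-geometric category of $\mathbb R_{an,exp}$, with a brane structure, that is, a grading and a pin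 structure. A grading is a continuous real function $\alpha$ such that $e^{2\pi i\alpha}$ is the squared phase $(\det/|\det|)^2$ of the tangent spaces, computed in the complex coordinates $\gamma_j-i\,y_j$ (so that the zero section has squared phase $1$). A pin structure is a principal $\mathrm{Pin}^+(n)$-bundle with an equivariant covering map to the bundle of orthonormal tangent frames. Then $\mathcal L(\mathcal O(k),h_k)$ satisfies the conditions on the Lagrangian. It has a pin structure, any two of its pin structures are isomorphic, and it has exactly one canonical grading, which is defined as follows. Hence it has a canonical brane structure and is an object of $Fuk(M)$. In particular this holds for $k\in\{-n-1,\dots,-1\}$, where one may take $N=n+1$ below. (a) Let $k\ne0$ and $N\ge|k|$. For $a\in\mathbb Z^n$ let $$U^a=\Big\{\gamma\in\mathbb R^n : \tfrac{\gamma_i-a_i}{k}>0 \text{ for all } i,\ \sum_j\tfrac{\gamma_j-a_j}{k}<1\Big\},\qquad f^a(\gamma)=-k\,f\Big(\frac{\gamma-a}{-k}\Big),$$ $$f(u)=\tfrac12\sum_i u_i\log(-u_i)-\tfrac12\Big(1+\sum_j u_j\Big)\log\Big(1+\sum_j u_j\Big).$$ The open cell $U^a$ embeds in $(\mathbb R/N\mathbb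 Z)^n$, and the lifts of $\mathcal L(\mathcal O(k),h_k)$ to $M_N$ (the images of continuous sections of $\pi$ over it) are exactly the graphs $\mathcal L^a$ of $df^a$ over $U^a$, $a\in\mathbb Z^n$. On each $\mathcal L^a$ there is exactly one grading $\alpha_a$ with the following property: the Hamiltonian flow of $(2\pi)^n f^a\circ p$ inside $T^*U^a$ ($p$ being the projection to the base) moves $\mathcal L^a$ for $0\le t\le1$ through $(1-t)\mathcal L^a$ to the zero section over $U^a$, and carries $\alpha_a$ continuously to the grading $0$. The canonical grading $\alpha$ of $\mathcal L(\mathcal O(k),h_k)$ is the grading with $\alpha\circ\pi=\alpha_a$ on $\mathcal L^a$ for all $N\ge|k|$ and all $a$; thus it does not depend on the lift. (b) Let $k=0$. Then $\mathcal L(\mathcal O(0),h_0)$ is the cotangent fibre at $0$. Its canonical grading is the one that is carried continuously to the canonical grading of $\mathcal L(\mathcal O(-1),h_{-1})$ by the Hamiltonian flow of the function $-(2\pi)^n\tfrac12\log(1+\sum_i e^{2y_i})$, which moves $\mathcal L(\mathcal O(0),h_0)$ to $\mathcal L(\mathcal O(-1),h_{-1})$ at time $1$. -/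

import Mathlib

open scoped ContDiff

noncomputable section

namespace TDual

/-! ## The symplectic manifolds `T^*(ℝ/Nℤ)^n`

For `N = 1` this is the mirror `M`; for `N = n + 1` it is the cover of `M` that is used for the
bundles `𝒪(-n-1), …, 𝒪(-1)`. -/

/-- The universal cover `ℝ^n × ℝ^n` of the cotangent bundles of tori, and also the tangent space
at any point of them. The first component is the fibre coordinate `y`, the second the base
coordinate `γ`. -/
abbrev E (n : ℕ) : Type := (Fin n → ℝ) × (Fin n → ℝ)

/-- The cotangent bundle of `(ℝ/Nℤ)^n`, trivialised: points are `(y, γ)`. -/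
abbrev CotTorus (N n : ℕ) : Type := (Fin n → ℝ) × (Fin n → AddCircle (N : ℝ))

/-- The projection `ℝ^n → (ℝ/Nℤ)^n`. -/
def toTorus (N : ℕ) {n : ℕ} (g : Fin n → ℝ) : Fin n → AddCircle (N : ℝ) :=
  fun i => (g i : AddCircle (N : ℝ))

/-- The universal covering `ℝ^n × ℝ^n → T^*(ℝ/Nℤ)^n`. All differential geometry on the target
is expressed through this local diffeomorphism. -/
def q (N : ℕ) {n : ℕ} (x : E n) : CotTorus N n := (x.1, toTorus N x.2)

/-- The homomorphism `ℝ/Nℤ → ℝ/ℤ`, `γ mod N ↦ γ mod 1`. -/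
def circleCover (N : ℕ) : AddCircle (N : ℝ) →+ AddCircle ((1 : ℕ) : ℝ) :=
  QuotientAddGroup.map _ _ (AddMonoidHom.id ℝ) (by
    rw [AddSubgroup.zmultiples_le]
    exact ⟨(N : ℤ), by simp⟩)

/-- The covering map `T^*(ℝ/Nℤ)^n → T^*(ℝ/ℤ)^n`. -/
def coverMap (N : ℕ) {n : ℕ} (p : CotTorus N n) : CotTorus 1 n :=
  (p.1, fun i => circleCover N (p.2 i))

/-- The symplectic form `(2π)^n ∑ dy_i ∧ dγ_i`, as `v ↦ ω(v, ·)`. -/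
def omega {n : ℕ} (v : E n) : E n →L[ℝ] ℝ :=
  ((2 * Real.pi) ^ n) •
    ∑ i, (v.1 i • (ContinuousLinearMap.proj i).comp (ContinuousLinearMap.snd ℝ _ _)
      - v.2 i • (ContinuousLinearMap.proj i).comp (ContinuousLinearMap.fst ℝ _ _))

/-- The Liouville form `(2π)^n ∑ y_i dγ_i` at the point `x`; its differential is `omega`. -/
def liouville {n : ℕ} (x : E n) : E n →L[ℝ] ℝ :=
  ((2 * Real.pi) ^ n) •
    ∑ i, x.1 i • (ContinuousLinearMap.proj i).comp (ContinuousLinearMap.snd ℝ _ _)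

/-! ## Lagrangian submanifolds -/

/-- The tangent space of `S` at the point `q N x`. -/
def tangentSpace {N n : ℕ} (S : Set (CotTorus N n)) (x : E n) : Submodule ℝ (E n) :=
  Submodule.span ℝ (tangentConeAt ℝ (q N ⁻¹' S) x)

/-- `S` is a smooth embedded submanifold of dimension `n`. -/
def IsSubmanifold {N n : ℕ} (S : Set (CotTorus N n)) : Prop :=
  ∀ x : E n, q N x ∈ S → ∃ Φ : OpenPartialHomeomorph (E n) (E n), x ∈ Φ.source ∧
    ContDiffOn ℝ ∞ Φ Φ.source ∧ ContDiffOn ℝ ∞ Φ.symm Φ.target ∧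
    ∀ z ∈ Φ.source, q N z ∈ S ↔ (Φ z).2 = 0

/-- `S` is a smooth embedded Lagrangian submanifold. -/
def IsLagrangian {N n : ℕ} (S : Set (CotTorus N n)) : Prop :=
  IsSubmanifold S ∧
    ∀ x : E n, q N x ∈ S → ∀ v ∈ tangentSpace S x, ∀ w ∈ tangentSpace S x, omega v w = 0

/-- The restriction of the Liouville form to `S` is the differential of a function on `S`. -/
def IsExactOn {N n : ℕ} (S : Set (CotTorus N n)) : Prop :=
  ∃ F : CotTorus N n → ℝ, ∀ x : E n, q N x ∈ S →
    HasFDerivWithinAt (F ∘ q N) (liouville x) (q N ⁻¹' S) x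

/-! ### Behaviour at infinity -/

/-- Function symbols of the real field with restricted analytic functions and exponential. -/
inductive AnExpFunc : ℕ → Type
  | add : AnExpFunc 2
  | mul : AnExpFunc 2
  | exp : AnExpFunc 1
  | analytic {m : ℕ} (f : (Fin m → ℝ) → ℝ)
      (hf : AnalyticOnNhd ℝ f (Set.Icc (fun _ => -1) (fun _ => 1))) : AnExpFunc m

/-- The only relation symbol is the order. -/
inductive AnExpRel : ℕ → Type
  | le : AnExpRel 2

/-- The language of `ℝ_{an,exp}`. -/
def anExp : FirstOrder.Language := ⟨AnExpFunc, AnExpRel⟩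

open Classical in
/-- The structure `ℝ_{an,exp}`. A restricted analytic function is set to `0` off the cube. -/
instance anExpStructure : anExp.Structure ℝ where
  funMap {_} s v := match s, v with
    | .add, v => v 0 + v 1
    | .mul, v => v 0 * v 1
    | .exp, v => Real.exp (v 0)
    | .analytic f _, v => if v ∈ Set.Icc (fun _ => -1) (fun _ => 1) then f v else 0
  RelMap {_} r v := match r, v with
    | .le, v => v 0 ≤ v 1

/-- The embedding of `T^*(ℝ/Nℤ)^n` in its fibrewise spherical compactification: the half-spaces
`(1, y)` are projected to the closed upper hemispheres in `ℝ × ℝ^n`. -/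
def compactify {N n : ℕ} (p : CotTorus N n) :
    (Fin n → AddCircle (N : ℝ)) × ℝ × (Fin n → ℝ) :=
  (p.2, (Real.sqrt (1 + ∑ i, p.1 i ^ 2))⁻¹,
    fun i => p.1 i / Real.sqrt (1 + ∑ i, p.1 i ^ 2))

/-- The closure of `S` in the fibrewise compactification belongs to the analytic-geometric
category of `ℝ_{an,exp}`. As the compactification is compact, it is enough to look at the closure
over the fundamental domain `[0, N]^n`. -/
def IsDefinableAtInfinity {N n : ℕ} (S : Set (CotTorus N n)) : Prop :=
  (Set.univ : Set ℝ).Definable anExp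
    {v : Fin n ⊕ Option (Fin n) → ℝ | (∀ i, v (.inl i) ∈ Set.Icc (0 : ℝ) N) ∧
      ((toTorus N fun i => v (.inl i), v (.inr none), fun i => v (.inr (some i))) :
        (Fin n → AddCircle (N : ℝ)) × ℝ × (Fin n → ℝ)) ∈ closure (compactify '' S)}

/-- The Lagrangians that underlie objects of the Fukaya category of the cotangent bundle:
properly embedded exact Lagrangian submanifolds whose closure in the fibrewise compactification
is tame. -/
structure IsFukayaLagrangian {N n : ℕ} (S : Set (CotTorus N n)) : Prop where
  isClosed : IsClosed S
  isLagrangian : IsLagrangian S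
  isExact : IsExactOn S
  isDefinable : IsDefinableAtInfinity S

/-! ## Gradings -/

/-- The squared phase of the Lagrangian subspace `Λ` is `exp(2πia)`. The complex structure is the
one that the flat metric of the torus defines on its cotangent bundle and that is compatible with
`∑ dy_i ∧ dγ_i`; its complex coordinates are `γ_i - i y_i`, and the zero section has squared
phase `1`. Another basis multiplies the determinant by a real number. -/
def HasPhase {n : ℕ} (Λ : Submodule ℝ (E n)) (a : ℝ) : Prop :=
  ∃ b : Module.Basis (Fin n) ℝ Λ,
    let d : ℂ := Matrix.det (Matrix.of fun i j : Fin n =>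
      (((b j : E n).2 i : ℝ) : ℂ) - Complex.I * (((b j : E n).1 i : ℝ) : ℂ))
    (d / (‖d‖ : ℂ)) ^ 2 = Complex.exp (2 * Real.pi * Complex.I * a)

/-- A grading of `S`: a continuous real lift of the squared phase map of `S`. -/
def IsGrading {N n : ℕ} (S : Set (CotTorus N n)) (β : S → ℝ) : Prop :=
  Continuous β ∧ ∀ (x : E n) (hx : q N x ∈ S), HasPhase (tangentSpace S x) (β ⟨q N x, hx⟩)

/-- `φ` is the Hamiltonian flow of `H` on the set `W`, for all times. -/
def IsHamiltonianFlowOn {N n : ℕ} (W : Set (CotTorus N n)) (H : CotTorus N n → ℝ)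
    (φ : ℝ → CotTorus N n → CotTorus N n) : Prop :=
  IsOpen W ∧ ContDiffOn ℝ ∞ (H ∘ q N) (q N ⁻¹' W) ∧
  ∃ Φ : ℝ → E n → E n, ∀ x, q N x ∈ W → Φ 0 x = x ∧
    ∀ t, q N (Φ t x) = φ t (q N x) ∧ φ t (q N x) ∈ W ∧
      ∃ X : E n, HasDerivAt (fun s => Φ s x) X t ∧
        HasFDerivAt (H ∘ q N) (-omega X) (Φ t x)

/-- Along the isotopy `φ_t(S)`, `0 ≤ t ≤ 1`, the grading `β₀` of `S` is carried continuously to the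
grading of `φ_1(S)` whose value at `φ_1(x)` is `β₁ x`. -/
def IsGradingTransport {N n : ℕ} (φ : ℝ → CotTorus N n → CotTorus N n)
    (S : Set (CotTorus N n)) (β₀ β₁ : S → ℝ) : Prop :=
  ∃ α : ℝ × S → ℝ, ContinuousOn α (Set.Icc 0 1 ×ˢ Set.univ) ∧
    (∀ t ∈ Set.Icc (0 : ℝ) 1, ∀ (x : S) (z : E n), q N z = φ t x →
      HasPhase (tangentSpace (φ t '' S) z) (α (t, x))) ∧
    (∀ x, α (0, x) = β₀ x) ∧ ∀ x, α (1, x) = β₁ x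

/-! ## Pin structures -/

/-- The standard positive definite quadratic form on `ℝ^n`. -/
def stdForm (n : ℕ) : QuadraticForm ℝ (Fin n → ℝ) :=
  QuadraticMap.weightedSumSquares ℝ (fun _ : Fin n => (1 : ℝ))

/-- The Clifford algebra with `v² = |v|²`. -/
abbrev Cl (n : ℕ) : Type := CliffordAlgebra (stdForm n)

/-- The group `Pin⁺(n)`: it is generated by the unit vectors (and by `-1`, which matters only for
`n = 0`). -/
def PinPlus (n : ℕ) : Subgroup (Cl n)ˣ :=
  Subgroup.closure
    ({u | ∃ v : Fin n → ℝ, stdForm n v = 1 ∧ (u : Cl n) = CliffordAlgebra.ι (stdForm n) v} ∪ {-1})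

/-- The topology of `Pin⁺(n)` as a subset of the finite-dimensional space `Cl n`. -/
instance pinTopology (n : ℕ) : TopologicalSpace (PinPlus n) :=
  TopologicalSpace.induced (fun g => (((g : (Cl n)ˣ)) : Cl n)) (moduleTopology ℝ (Cl n))

/-- `A` is the image of `g` under the double covering `Pin⁺(n) → O(n)` (twisted conjugation; unit
vectors go to reflections). -/
def Covers {n : ℕ} (g : PinPlus n) (A : Matrix (Fin n) (Fin n) ℝ) : Prop :=
  A ∈ Matrix.orthogonalGroup (Fin n) ℝ ∧
    ∀ v : Fin n → ℝ, CliffordAlgebra.involute ((g : (Cl n)ˣ) : Cl n) *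
        CliffordAlgebra.ι (stdForm n) v =
      CliffordAlgebra.ι (stdForm n) (A.mulVec v) * ((g : (Cl n)ˣ) : Cl n)

/-- The bundle of orthonormal frames of `S`, for the metric `∑ dy_i² + dγ_i²`. -/
def FrameBundle {N n : ℕ} (S : Set (CotTorus N n)) : Type :=
  {f : S × (Fin n → E n) //
    (∀ x : E n, q N x = f.1 → ∀ i, f.2 i ∈ tangentSpace S x) ∧
    ∀ i j, (f.2 i).1 ⬝ᵥ (f.2 j).1 + (f.2 i).2 ⬝ᵥ (f.2 j).2 = if i = j then 1 else 0}

instance frameTopology {N n : ℕ} (S : Set (CotTorus N n)) : TopologicalSpace (FrameBundle S) :=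
  inferInstanceAs (TopologicalSpace (Subtype _))

/-- A pin structure on `S`: a principal `Pin⁺(n)`-bundle on `S` with an equivariant covering map to
the bundle of orthonormal frames. -/
structure PinStructure {N n : ℕ} (S : Set (CotTorus N n)) where
  /-- the total space -/
  P : Type
  /-- its topology -/
  top : TopologicalSpace P
  /-- the map to the frame bundle -/
  proj : P → FrameBundle S
  isCoveringMap : IsCoveringMap proj
  surjective : Function.Surjective proj
  /-- the right action of `Pin⁺(n)` -/
  act : P → PinPlus n → P
  act_one : ∀ p, act p 1 = p
  act_mul : ∀ p g h, act p (g * h) = act (act p g) h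
  continuous_act : Continuous fun x : P × PinPlus n => act x.1 x.2
  equivariant : ∀ p g A, Covers g A → (proj (act p g)).1.1 = (proj p).1.1 ∧
    ∀ j, (proj (act p g)).1.2 j = ∑ i, A i j • (proj p).1.2 i
  torsor : ∀ p p', (proj p).1.1 = (proj p').1.1 → ∃! g, act p g = p'

/-- Isomorphism of pin structures on `S`. -/
def PinStructure.Iso {N n : ℕ} {S : Set (CotTorus N n)} (A B : PinStructure S) : Prop :=
  letI := A.top
  letI := B.top
  ∃ f : A.P ≃ₜ B.P, (∀ p, B.proj (f p) = A.proj p) ∧ ∀ p g, f (A.act p g) = B.act (f p) g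

/-- A brane structure on a Lagrangian: a grading and a pin structure. -/
structure BraneStructure {N n : ℕ} (S : Set (CotTorus N n)) where
  /-- the grading -/
  grading : S → ℝ
  isGrading : IsGrading S grading
  /-- the pin structure -/
  pin : PinStructure S

/-! ## The Lagrangians that are T-dual to the line bundles `𝒪(k)` -/

/-- The connection form `A = i ∂h · h⁻¹` on `ℂ^n = {(1 : z_1 : ⋯ : z_n)}` of the canonical
connection `d - iA` of a hermitian metric `h`, at `z`, on the tangent vector `v`. -/
def connectionForm {n : ℕ} (h : (Fin n → ℂ) → ℝ) (z v : Fin n → ℂ) : ℂ :=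
  Complex.I * (((fderiv ℝ h z v : ℝ) : ℂ) - Complex.I * ((fderiv ℝ h z (Complex.I • v) : ℝ) : ℂ))
    / 2 / (h z : ℂ)

/-- The metric `h_k = (h_1)^k` on `𝒪(k)`, `h_1 = 1 / (1 + ∑ |z_i|²)`, in the standard
trivialisation over `ℂ^n`. -/
def metric (n : ℕ) (k : ℤ) (z : Fin n → ℂ) : ℝ := ((1 + ∑ i, ‖z i‖ ^ 2)⁻¹) ^ k

/-- The Lagrangian `𝓛(𝒪(k), h_k)` in `M`. A point `(y, γ)` of `M` stands for the torus
`|z_i| = exp(y_i)` with the flat connection `d - i ∑ γ_i dθ_i`, up to gauge equivalence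
(so `γ_i ∈ ℝ/ℤ`); it lies on the Lagrangian when this connection is the restriction of the
canonical connection of `h_k`. The vector field `∂/∂θ_i` is `i z_i` in the `i`-th direction. -/
def lagr (n : ℕ) (k : ℤ) : Set (CotTorus 1 n) :=
  {p | ∀ z : Fin n → ℂ, (∀ i, ‖z i‖ = Real.exp (p.1 i)) → ∀ i, ∃ c : ℝ,
    (c : ℂ) = connectionForm (metric n k) z (Pi.single i (Complex.I * z i)) ∧
      p.2 i = (c : AddCircle ((1 : ℕ) : ℝ))}

/-! ### Lifts and open cells -/

/-- `L'` is a lift of `S` to `T^*(ℝ/Nℤ)^n`: the image of a continuous section over `S` of the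
covering map. -/
def IsLift (N : ℕ) {n : ℕ} (L' : Set (CotTorus N n)) (S : Set (CotTorus 1 n)) : Prop :=
  ∃ σ : S → CotTorus N n, Continuous σ ∧ (∀ x, coverMap N (σ x) = x) ∧ Set.range σ = L'

/-- The open simplex `a + k Δ°`, with `Δ°` the interior of the standard simplex. For `k < 0` it is
`{γ | γ_i < a_i, ∑ γ_j > k + ∑ a_j}`. -/
def cell {n : ℕ} (k : ℤ) (a : Fin n → ℤ) : Set (Fin n → ℝ) :=
  {g | (∀ i, 0 < (g i - a i) / k) ∧ ∑ i, (g i - a i) / (k : ℝ) < 1}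

/-- The function `½ ∑ u_i log(-u_i) - ½ (1 + ∑ u_j) log(1 + ∑ u_j)`. -/
def basePrimitive {n : ℕ} (u : Fin n → ℝ) : ℝ :=
  (1 / 2) * ∑ i, u i * Real.log (-u i) - (1 / 2) * (1 + ∑ i, u i) * Real.log (1 + ∑ i, u i)

/-- The function `f_k^a` on the cell, `-k · f((γ - a) / (-k))`. -/
def primitive {n : ℕ} (k : ℤ) (a : Fin n → ℤ) (g : Fin n → ℝ) : ℝ :=
  -(k : ℝ) * basePrimitive fun i => (g i - a i) / (-(k : ℝ))

/-- The part of `T^*(ℝ/Nℤ)^n` over the image of the cell in the torus. -/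
def overCell (N : ℕ) {n : ℕ} (k : ℤ) (a : Fin n → ℤ) : Set (CotTorus N n) :=
  q N '' {x | x.2 ∈ cell k a}

/-- The zero section over the image of the cell in the torus. -/
def zeroSection (N : ℕ) {n : ℕ} (k : ℤ) (a : Fin n → ℤ) : Set (CotTorus N n) :=
  q N '' {x | x.2 ∈ cell k a ∧ x.1 = 0}

/-- The graph of `d f_k^a` over the cell, in `T^*(ℝ/Nℤ)^n`. -/
def cellGraph (N : ℕ) {n : ℕ} (k : ℤ) (a : Fin n → ℤ) : Set (CotTorus N n) :=
  q N '' {x | x.2 ∈ cell k a ∧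
    HasFDerivAt (primitive k a)
      (∑ i, x.1 i • (ContinuousLinearMap.proj i : (Fin n → ℝ) →L[ℝ] ℝ)) x.2}

/-- `β` is the grading of the graph of `d f_k^a` that comes from the grading `0` of the cell: the
Hamiltonian flow of `(2π)^n f_k^a ∘ p` inside the cotangent bundle of the cell moves the graph
through its multiples by `1 - t` to the cell at `t = 1`, and carries `β` to `0`. -/
def IsCellGrading (N : ℕ) {n : ℕ} (k : ℤ) (a : Fin n → ℤ) (β : cellGraph N k a → ℝ) : Prop :=
  IsGrading (cellGraph N k a) β ∧
  ∃ (H : CotTorus N n → ℝ) (φ : ℝ → CotTorus N n → CotTorus N n),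
    (∀ x : E n, x.2 ∈ cell k a → H (q N x) = (2 * Real.pi) ^ n * primitive k a x.2) ∧
    IsHamiltonianFlowOn (overCell N k a) H φ ∧
    (∀ t ∈ Set.Icc (0 : ℝ) 1, φ t '' cellGraph N k a =
      (fun p : CotTorus N n => ((1 - t) • p.1, p.2)) '' cellGraph N k a) ∧
    φ 1 '' cellGraph N k a = zeroSection N k a ∧
    IsGradingTransport φ (cellGraph N k a) β 0

/-- `β` is a grading of `𝓛(𝒪(k), h_k)`, `k ≠ 0`, whose pull-back to every lift, in every cover
`T^*(ℝ/Nℤ)^n` with `N ≥ |k|`, is the grading that comes from the cell. -/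
def IsInducedByCells {n : ℕ} (k : ℤ) (β : lagr n k → ℝ) : Prop :=
  IsGrading (lagr n k) β ∧
  ∀ N : ℕ, |k| ≤ N → ∀ a : Fin n → ℤ, ∃ β' : cellGraph N k a → ℝ,
    IsCellGrading N k a β' ∧
      ∀ (x : cellGraph N k a) (z : lagr n k), coverMap N x.1 = z.1 → β z = β' x

/-- `β` is the canonical grading of `𝓛(𝒪(k), h_k)`. For `k ≠ 0` it comes from the cells. The
Lagrangian for `k = 0` is the cotangent fibre at `0` and lies over no cell; it is first moved to
the Lagrangian for `k = -1` by the Hamiltonian flow of the torus-invariant function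
`-(2π)^n ½ log(1 + ∑ exp(2 y_i))`. -/
def IsCanonicalGrading {n : ℕ} (k : ℤ) (β : lagr n k → ℝ) : Prop :=
  IsGrading (lagr n k) β ∧
  (k ≠ 0 → IsInducedByCells k β) ∧
  (k = 0 → ∃ (γ : lagr n (-1) → ℝ) (φ : ℝ → CotTorus 1 n → CotTorus 1 n) (β₁ : lagr n k → ℝ),
    IsInducedByCells (-1) γ ∧
    IsHamiltonianFlowOn Set.univ (fun p : CotTorus 1 n =>
      -((2 * Real.pi) ^ n * (1 / 2) * Real.log (1 + ∑ i, Real.exp (2 * p.1 i)))) φ ∧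
    φ 1 '' lagr n k = lagr n (-1) ∧
    IsGradingTransport φ (lagr n k) β β₁ ∧
    ∀ (x : lagr n k) (z : lagr n (-1)), φ 1 x.1 = z.1 → β₁ x = γ z)

end TDual

end

/-!
Everything follows from one description of the Lagrangian. On the torus `|z_i| = exp(y_i)` the
canonical connection of `h_k` has the constant coefficients `k s_i(y)`, where
`s_i(y) = exp(2 y_i) / (1 + ∑ exp(2 y_j))` is the moment map (`connectionForm_metric`). So
`𝓛(𝒪(k), h_k)` is the graph `γ = k s(y) mod 1` over the fibre `ℝ^n` (`lagr_eq_torusGraph`). It is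
closed and embedded. As the Jacobian `J(y)` of `s` is symmetric it is Lagrangian, and
`(2π)^n k (∑ y_i s_i - ½ log(1 + ∑ exp(2 y_j)))` is a primitive of the Liouville form on it. It is
definable in `ℝ_exp`: only finitely many integers occur in the reduction modulo `1`, because `s` is
bounded (`isDefinableAtInfinity_lagr`).

The moment map is a diffeomorphism of `ℝ^n` onto the open simplex, inverse to the derivative of
the primitive for `k = 1` (`hasFDerivAt_negEntropy`). Hence the graphs of `df_k^a` over the cells
are the sets `γ = k s(y) + a` (`mem_cellGraph_iff`), and these are the lifts because `ℝ^n` is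
connected and the integers are discrete in `ℝ/Nℤ` (`isLift_iff`).

The flow of `(2π)^n f_k^a ∘ p` translates the fibre over `γ` with velocity `-df_k^a(γ)`. The
tangent planes of the moved graphs are `{((1 - t) v, k J(y) v)}`, independently of the cell and of
the cover (`tangentSpace_scaledGraph`), with determinant `det(k J(y) - i (1 - t))`. It does not
vanish, since `J(y)` is symmetric and invertible. The parameter space `ℝ × ℝ^n` is simply
connected, so the squared phase has a continuous real lift, and it can be normalised to vanish at
`t = 1` (`exists_phase_to_zeroSection`). Two lifts along the isotopy differ by an integer that is
constant in `t`; this gives existence and uniqueness of the grading from the cell as a function of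
`y` alone (`exists_cellGrading`), and therefore the canonical grading for `k ≠ 0`. For `k = 0` the
same argument is applied to the flow of `-(2π)^n ½ log(1 + ∑ exp(2 y_i))`, which moves the fibre
through the graphs of `-t s` (`exists_canonicalGrading`).

For the pin structures, a continuous orthonormal framing of the tangent planes identifies the
frame bundle with `ℝ^n × O(n)` (`frameHomeo`), and `ℝ^n × Pin⁺(n)` covers it
(`trivialPinStructure`). This rests on the double covering `Pin⁺(n) → O(n)`: it is surjective by
the Cartan–Dieudonné theorem, its kernel is `{±1}` by a computation in the Clifford algebra
(`eq_or_eq_of_pinMatrix_eq_one`), and it has continuous local sections (`exists_section`). In any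
other pin structure the framing lifts to a section, since `ℝ^n` is simply connected, and the
section defines an isomorphism with the trivial one (`PinStructure.iso`).
-/

noncomputable section

namespace TDual

/-! ### The Clifford algebra of Euclidean space -/

open CliffordAlgebra

section Clifford

variable {n : ℕ}

theorem stdForm_apply (v : Fin n → ℝ) : stdForm n v = v ⬝ᵥ v := by
  simp [stdForm, QuadraticMap.weightedSumSquares_apply, dotProduct]

theorem polar_stdForm (v w : Fin n → ℝ) : QuadraticMap.polar (stdForm n) v w = 2 * (v ⬝ᵥ w) := by
  simp only [QuadraticMap.polar, stdForm_apply, add_dotProduct, dotProduct_add,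
    dotProduct_comm w v]
  ring

theorem ι_mul_ι_swap (v w : Fin n → ℝ) :
    ι (stdForm n) v * ι (stdForm n) w =
      algebraMap ℝ (Cl n) (2 * (v ⬝ᵥ w)) - ι (stdForm n) w * ι (stdForm n) v := by
  rw [eq_sub_iff_add_eq, ι_mul_ι_add_swap, polar_stdForm]

theorem ι_mul_self_of_unit {v : Fin n → ℝ} (h : v ⬝ᵥ v = 1) :
    ι (stdForm n) v * ι (stdForm n) v = 1 := by
  rw [ι_sq_scalar, stdForm_apply, h, map_one]

theorem ι_anticomm {v w : Fin n → ℝ} (h : v ⬝ᵥ w = 0) :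
    ι (stdForm n) v * ι (stdForm n) w = -(ι (stdForm n) w * ι (stdForm n) v) := by
  rw [ι_mul_ι_swap, h]; simp

instance clifford_finite : Module.Finite ℝ (Cl n) :=
  let _ : Invertible (2 : ℝ) := invertibleOfNonzero two_ne_zero
  have : Module.Finite ℝ (ExteriorAlgebra ℝ (Fin n → ℝ)) :=
    Module.Finite.of_basis (Pi.basisFun ℝ (Fin n)).ExteriorAlgebra
  Module.Finite.equiv (equivExterior (stdForm n)).symm

theorem exists_linear_leftInverse_ι :
    ∃ ℓ : Cl n →ₗ[ℝ] (Fin n → ℝ), ∀ v, ℓ (ι (stdForm n) v) = v := by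
  let _ : Invertible (2 : ℝ) := invertibleOfNonzero two_ne_zero
  refine ⟨ExteriorAlgebra.ιInv ∘ₗ (equivExterior (stdForm n)).toLinearMap, fun v => ?_⟩
  simp only [LinearMap.comp_apply, LinearEquiv.coe_coe, equivExterior, changeFormEquiv_apply,
    changeForm_ι]
  exact ExteriorAlgebra.ι_leftInverse v

/-- The projection of the Clifford algebra to the scalars; it comes from the exterior algebra. -/
theorem exists_linear_scalarPart :
    ∃ ℓ : Cl n →ₗ[ℝ] ℝ, ∀ c, ℓ (algebraMap ℝ (Cl n) c) = c := by
  let _ : Invertible (2 : ℝ) := invertibleOfNonzero two_ne_zero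
  refine ⟨(ExteriorAlgebra.algebraMapInv (R := ℝ) (M := Fin n → ℝ)).toLinearMap ∘ₗ
    (equivExterior (stdForm n)).toLinearMap, fun c => ?_⟩
  simp only [LinearMap.comp_apply, LinearEquiv.coe_coe, equivExterior, changeFormEquiv_apply,
    changeForm_algebraMap]
  exact ExteriorAlgebra.algebraMap_leftInverse (Fin n → ℝ) c

theorem ι_injective : Function.Injective (ι (stdForm n)) := by
  obtain ⟨ℓ, hℓ⟩ := exists_linear_leftInverse_ι (n := n)
  exact fun v w h => by rw [← hℓ v, h, hℓ]

instance clifford_nontrivial : Nontrivial (Cl n) := by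
  obtain ⟨ℓ, hℓ⟩ := exists_linear_scalarPart (n := n)
  refine ⟨0, 1, fun h => ?_⟩
  have := hℓ 1
  rw [map_one, ← h, map_zero] at this
  exact zero_ne_one this

/-- The Clifford generator of the `i`-th basis vector. -/
def gen (i : Fin n) : Cl n := ι (stdForm n) (Pi.single i 1)

theorem gen_mul_self (i : Fin n) : gen i * gen i = (1 : Cl n) :=
  ι_mul_self_of_unit (by simp)

theorem gen_anticomm {i j : Fin n} (h : i ≠ j) : gen i * gen j = -(gen j * gen i : Cl n) :=
  ι_anticomm (by simp [h])

/-- The product of the generators named by a list. -/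
def word (w : List (Fin n)) : Cl n := (w.map gen).prod

theorem gen_mul_word (i : Fin n) (w : List (Fin n)) :
    gen i * word w = ((-1 : ℝ) ^ (w.length + w.count i)) • (word w * gen i) := by
  induction w with
  | nil => simp [word]
  | cons j w ih =>
    have hw : word (j :: w) = gen j * word w := by simp [word]
    rw [hw]
    by_cases h : j = i
    · subst h
      rw [mul_assoc (gen j) (word w), ← mul_smul_comm]
      congr 1
      simp only [List.length_cons, List.count_cons_self]
      rw [ih]
      congr 1
      ring
    · rw [← mul_assoc, gen_anticomm (Ne.symm h), neg_mul, mul_assoc, ih, List.count_cons_of_ne h,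
        List.length_cons, mul_smul_comm, mul_assoc, ← neg_smul]
      congr 1
      ring

theorem involute_word (w : List (Fin n)) : involute (word w) = ((-1 : ℝ) ^ w.length) • word w := by
  induction w with
  | nil => simp [word]
  | cons j w ih =>
    have hw : word (j :: w) = gen j * word w := by simp [word]
    rw [hw, map_mul, ih, gen, involute_ι, List.length_cons, pow_succ, mul_smul_comm, neg_mul,
      smul_neg, mul_neg_one, neg_smul]

theorem gen_twist_word (i : Fin n) (w : List (Fin n)) :
    gen i * involute (word w) * gen i = ((-1 : ℝ) ^ w.count i) • word w := by
  rw [involute_word, mul_smul_comm, gen_mul_word, smul_mul_assoc, smul_mul_assoc, mul_assoc,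
    gen_mul_self, mul_one, smul_smul, ← pow_add]
  congr 1
  rw [← add_assoc, pow_add, ← two_mul, pow_mul]
  simp

theorem word_append (u v : List (Fin n)) : word (u ++ v) = (word u * word v : Cl n) := by
  simp [word]

theorem span_range_word : Submodule.span ℝ (Set.range (word (n := n))) = ⊤ := by
  have hmul : ∀ a b : Cl n, a ∈ Submodule.span ℝ (Set.range (word (n := n))) →
      b ∈ Submodule.span ℝ (Set.range (word (n := n))) →
      a * b ∈ Submodule.span ℝ (Set.range (word (n := n))) := by
    intro a b ha hb
    have := Submodule.mul_mem_mul ha hb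
    rw [Submodule.span_mul_span] at this
    refine Submodule.span_mono ?_ this
    rintro _ ⟨_, ⟨u, rfl⟩, _, ⟨v, rfl⟩, rfl⟩
    exact ⟨u ++ v, word_append u v⟩
  rw [eq_top_iff]
  rintro x -
  induction x using CliffordAlgebra.induction with
  | algebraMap r =>
    rw [Algebra.algebraMap_eq_smul_one]
    exact Submodule.smul_mem _ _ (Submodule.subset_span ⟨[], by simp [word]⟩)
  | ι v =>
    have hv : v = ∑ i, v i • Pi.single i (1 : ℝ) := by
      ext j
      simp [Finset.sum_apply, Pi.single_apply]
    rw [hv, map_sum]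
    refine Submodule.sum_mem _ fun i _ => ?_
    rw [map_smul]
    exact Submodule.smul_mem _ _ (Submodule.subset_span ⟨[i], by simp [word, gen]⟩)
  | mul a b ha hb => exact hmul a b ha hb
  | add a b ha hb => exact Submodule.add_mem _ ha hb

/-- Two equal letters can be brought together at the cost of a sign, and then cancel. -/
theorem word_scalar_of_even (w : List (Fin n)) (h : ∀ i, Even (w.count i)) :
    ∃ c : ℝ, word w = algebraMap ℝ (Cl n) c := by
  induction hl : w.length using Nat.strong_induction_on generalizing w with
  | _ m ih =>
    cases w with
    | nil => exact ⟨1, by simp [word]⟩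
    | cons i w =>
      have hi : i ∈ w := by
        have := h i
        rw [List.count_cons_self] at this
        by_contra hcon
        rw [List.count_eq_zero_of_not_mem hcon] at this
        simp at this
      obtain ⟨u, v, rfl⟩ := List.append_of_mem hi
      obtain ⟨c, hc⟩ := ih (u ++ v).length (by simp at hl ⊢; omega) (u ++ v) (fun j => by
        have := h j
        simp only [List.count_cons, List.count_append] at this ⊢
        split_ifs at this
        · rw [show u.count j + (v.count j + 1) + 1 = u.count j + v.count j + 2 by ring] at this
          exact (Nat.even_add.1 this).2 even_two
        · simpa using this) rfl
      refine ⟨(-1) ^ (u.length + u.count i) * c, ?_⟩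
      have : word (i :: (u ++ i :: v)) = gen i * word u * (gen i * word v) := by
        simp [word, mul_assoc]
      rw [this, gen_mul_word, smul_mul_assoc, mul_assoc, ← mul_assoc (gen i) (gen i), gen_mul_self,
        one_mul, ← word_append, hc, map_mul, Algebra.smul_def]

/-- The operator `x ↦ a · x̂ · b`, where `x̂` is the grade involution of `x`. -/
def twist (a b : Cl n) : Module.End ℝ (Cl n) :=
  LinearMap.mulLeft ℝ a ∘ₗ LinearMap.mulRight ℝ b ∘ₗ (involute (Q := stdForm n)).toLinearMap

theorem twist_apply (a b x : Cl n) : twist a b x = a * involute x * b := by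
  simp [twist, mul_assoc]

/-- The average of the identity and of `twist a b`. When the latter is an involution, this is the
projection to its fixed space. -/
def avg (a b : Cl n) : Module.End ℝ (Cl n) := (1 / 2 : ℝ) • (1 + twist a b)

theorem avg_apply (a b x : Cl n) : avg a b x = (1 / 2 : ℝ) • (x + a * involute x * b) := by
  simp [avg, twist_apply]

/-- `twist v w` is an involution, so its average with the identity is fixed by it. -/
theorem twist_mul_avg {v w : Fin n → ℝ} (hv : v ⬝ᵥ v = 1) (hw : w ⬝ᵥ w = 1) :
    twist (ι _ v) (ι _ w) * avg (ι (stdForm n) v) (ι _ w) = avg (ι _ v) (ι _ w) := by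
  ext1 x
  simp only [Module.End.mul_apply, avg_apply, twist_apply, map_smul, map_add, map_mul,
    involute_involute, involute_ι]
  rw [add_comm x]
  congr 2
  calc ι (stdForm n) v * (-ι _ v * x * -ι _ w) * ι _ w
      = (ι _ v * ι _ v) * x * (ι _ w * ι _ w) := by noncomm_ring
    _ = x := by rw [ι_mul_self_of_unit hv, ι_mul_self_of_unit hw]; simp

theorem twist_commute_avg {v w v' w' : Fin n → ℝ} (hv : v ⬝ᵥ v' = 0) (hw : w ⬝ᵥ w' = 0) :
    Commute (twist (ι (stdForm n) v) (ι _ w)) (avg (ι _ v') (ι _ w')) := by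
  have h : Commute (twist (ι (stdForm n) v) (ι _ w)) (twist (ι _ v') (ι _ w')) := by
    have hw' : w' ⬝ᵥ w = 0 := by rw [dotProduct_comm, hw]
    ext1 x
    simp only [Module.End.mul_apply, twist_apply, map_mul, involute_involute, involute_ι]
    calc ι (stdForm n) v * (-ι _ v' * x * -ι _ w') * ι _ w
        = (ι (stdForm n) v * ι _ v') * x * (ι _ w' * ι _ w) := by noncomm_ring
      _ = (ι (stdForm n) v' * ι _ v) * x * (ι _ w * ι _ w') := by
          rw [ι_anticomm hv, ι_anticomm hw', neg_mul, neg_mul_neg]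
      _ = _ := by noncomm_ring
  exact ((Commute.one_right _).add_right h).smul_right _

/-- The product of commuting projections over a family of pairs of vectors. -/
def avgProd (f g : Fin n → Fin n → ℝ) (L : List (Fin n)) : Module.End ℝ (Cl n) :=
  (L.map fun i => avg (ι (stdForm n) (f i)) (ι (stdForm n) (g i))).prod

theorem twist_mul_avgProd {f g : Fin n → Fin n → ℝ}
    (hf : ∀ i j, f i ⬝ᵥ f j = if i = j then 1 else 0)
    (hg : ∀ i j, g i ⬝ᵥ g j = if i = j then 1 else 0) (L : List (Fin n)) (i : Fin n) (hi : i ∈ L) :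
    twist (ι _ (f i)) (ι _ (g i)) * avgProd f g L = avgProd f g L := by
  induction L with
  | nil => simp at hi
  | cons j L ih =>
    have hL : avgProd f g (j :: L) = avg (ι _ (f j)) (ι _ (g j)) * avgProd f g L := by
      simp [avgProd]
    rw [hL, ← mul_assoc]
    by_cases h : i = j
    · subst h
      rw [twist_mul_avg (by simp [hf]) (by simp [hg])]
    · rw [(twist_commute_avg (by simp [hf, h]) (by simp [hg, h])).eq, mul_assoc,
        ih ((List.mem_cons.1 hi).resolve_left h)]

theorem avgProd_fixed {f g : Fin n → Fin n → ℝ} {x : Cl n}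
    (h : ∀ i, ι _ (f i) * involute x * ι _ (g i) = x) (L : List (Fin n)) :
    avgProd f g L x = x := by
  induction L with
  | nil => simp [avgProd]
  | cons j L ih =>
    have hL : avgProd f g (j :: L) = avg (ι _ (f j)) (ι _ (g j)) * avgProd f g L := by
      simp [avgProd]
    rw [hL, Module.End.mul_apply, ih, avg_apply, h, ← two_smul ℝ, smul_smul]
    norm_num

/-- The elements of the Clifford algebra that commute with all vectors in the graded sense are the
scalars: the product of the projections `avg (gen i) (gen i)` fixes them, and it maps every word in
the generators to a scalar. -/
theorem scalar_of_gradedCentral {x : Cl n}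
    (h : ∀ v, involute x * ι (stdForm n) v = ι (stdForm n) v * x) :
    ∃ c : ℝ, x = algebraMap ℝ (Cl n) c := by
  let e : Fin n → Fin n → ℝ := fun i => Pi.single i 1
  have hfix : avgProd e e (List.finRange n) x = x := by
    refine avgProd_fixed (fun i => ?_) _
    rw [mul_assoc, h, ← mul_assoc, ι_mul_self_of_unit (by simp [e]), one_mul]
  have hword : ∀ (L w : List (Fin n)), avgProd e e L (word w) =
      (L.map fun i => (1 + (-1 : ℝ) ^ w.count i) / 2).prod • word w := by
    intro L w
    induction L with
    | nil => simp [avgProd]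
    | cons j L ih =>
      have hL : avgProd e e (j :: L) = avg (gen j) (gen j) * avgProd e e L := by
        simp [avgProd, gen, e]
      rw [hL, Module.End.mul_apply, ih, map_smul, avg_apply, gen_twist_word, List.map_cons,
        List.prod_cons]
      module
  have hrange : ∀ y : Cl n,
      avgProd e e (List.finRange n) y ∈ (⊥ : Subalgebra ℝ (Cl n)).toSubmodule := by
    intro y
    have hy : y ∈ Submodule.span ℝ (Set.range (word (n := n))) := by rw [span_range_word]; trivial
    induction hy using Submodule.span_induction with
    | mem y hy =>
      obtain ⟨w, rfl⟩ := hy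
      rw [hword]
      by_cases hw : ∀ i, Even (w.count i)
      · obtain ⟨c, hc⟩ := word_scalar_of_even w hw
        rw [hc]
        exact Submodule.smul_mem _ _ (Subalgebra.algebraMap_mem _ c)
      · push Not at hw
        obtain ⟨i, hi⟩ := hw
        have : (0 : ℝ) ∈ (List.finRange n).map fun i => (1 + (-1 : ℝ) ^ w.count i) / 2 :=
          List.mem_map.2 ⟨i, List.mem_finRange i, by
            rw [Odd.neg_one_pow (Nat.not_even_iff_odd.1 hi)]; norm_num⟩
        rw [List.prod_eq_zero this, zero_smul]
        exact Submodule.zero_mem _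
    | zero => rw [map_zero]; exact Submodule.zero_mem _
    | add a b _ _ ha hb => rw [map_add]; exact Submodule.add_mem _ ha hb
    | smul c a _ ha => rw [map_smul]; exact Submodule.smul_mem _ _ ha
  have := hrange x
  rw [hfix] at this
  obtain ⟨c, hc⟩ := Algebra.mem_bot.1 this
  exact ⟨c, hc.symm⟩

end Clifford

/-! ### The double covering of the orthogonal group -/

section Pin

variable {n : ℕ}

/-- The underlying element of the Clifford algebra. -/
def pinCoe (g : PinPlus n) : Cl n := ((g : (Cl n)ˣ) : Cl n)

theorem pinCoe_injective : Function.Injective (pinCoe (n := n)) :=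
  fun _ _ h => Subtype.ext (Units.ext h)

theorem pinCoe_one : pinCoe (1 : PinPlus n) = 1 := rfl

theorem pinCoe_mul (g h : PinPlus n) : pinCoe (g * h) = pinCoe g * pinCoe h := rfl

theorem pinCoe_mul_inv (g : PinPlus n) : pinCoe g * pinCoe g⁻¹ = 1 := by
  rw [← pinCoe_mul, mul_inv_cancel, pinCoe_one]

theorem pinCoe_inv_mul (g : PinPlus n) : pinCoe g⁻¹ * pinCoe g = 1 := by
  rw [← pinCoe_mul, inv_mul_cancel, pinCoe_one]

theorem covers_iff {g : PinPlus n} {A : Matrix (Fin n) (Fin n) ℝ} :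
    Covers g A ↔ A ∈ Matrix.orthogonalGroup (Fin n) ℝ ∧
      ∀ v, involute (pinCoe g) * ι (stdForm n) v = ι (stdForm n) (A.mulVec v) * pinCoe g := Iff.rfl

/-- The element `-1` of the pin group. -/
def pinNegOne (n : ℕ) : PinPlus n := ⟨-1, Subgroup.subset_closure (Or.inr rfl)⟩

theorem pinCoe_negOne : pinCoe (pinNegOne n) = -1 := by
  simp [pinCoe, pinNegOne]

/-- A unit vector as an element of the pin group. -/
def pinVec (v : Fin n → ℝ) (hv : v ⬝ᵥ v = 1) : PinPlus n :=
  ⟨⟨ι _ v, ι _ v, ι_mul_self_of_unit hv, ι_mul_self_of_unit hv⟩,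
    Subgroup.subset_closure (Or.inl ⟨v, by rw [stdForm_apply, hv], rfl⟩)⟩

theorem pinCoe_vec (v : Fin n → ℝ) (hv : v ⬝ᵥ v = 1) : pinCoe (pinVec v hv) = ι _ v := rfl

theorem pin_induction {p : PinPlus n → Prop} (hvec : ∀ v hv, p (pinVec v hv))
    (hneg : p (pinNegOne n)) (hone : p 1) (hmul : ∀ g h, p g → p h → p (g * h))
    (hinv : ∀ g, p g → p g⁻¹) (g : PinPlus n) : p g := by
  obtain ⟨g, hg⟩ := g
  induction hg using Subgroup.closure_induction with
  | mem x hx =>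
    rcases hx with ⟨v, hv, hx⟩ | hx
    · have : (⟨x, Subgroup.subset_closure (Or.inl ⟨v, hv, hx⟩)⟩ : PinPlus n) =
          pinVec v (by rw [← stdForm_apply, hv]) := pinCoe_injective hx
      rw [this]
      exact hvec _ _
    · have : (⟨x, Subgroup.subset_closure (Or.inr hx)⟩ : PinPlus n) = pinNegOne n :=
        Subtype.ext hx
      rw [this]
      exact hneg
  | one => exact hone
  | mul x y hx hy h1 h2 => exact hmul _ _ h1 h2
  | inv x hx h1 => exact hinv _ h1

/-- The inverse in the pin group is the reversal, hence continuous. -/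
theorem reverse_mul_pinCoe (g : PinPlus n) : reverse (pinCoe g) * pinCoe g = 1 := by
  induction g using pin_induction with
  | hvec v hv => rw [pinCoe_vec, reverse_ι, ι_mul_self_of_unit hv]
  | hneg => simp [pinCoe_negOne]
  | hone => simp [pinCoe_one]
  | hmul g h hg hh =>
    rw [pinCoe_mul, reverse.map_mul, mul_assoc, ← mul_assoc (reverse (pinCoe g)), hg, one_mul, hh]
  | hinv g hg =>
    have h : reverse (pinCoe g) = pinCoe g⁻¹ := by
      rw [← mul_one (reverse (pinCoe g)), ← pinCoe_mul_inv g, ← mul_assoc, hg, one_mul]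
    rw [← h, reverse_reverse, h, pinCoe_mul_inv]

theorem pinCoe_inv (g : PinPlus n) : pinCoe g⁻¹ = reverse (pinCoe g) := by
  rw [← mul_one (reverse (pinCoe g)), ← pinCoe_mul_inv g, ← mul_assoc, reverse_mul_pinCoe, one_mul]

theorem Covers.mul {g h : PinPlus n} {A B : Matrix (Fin n) (Fin n) ℝ} (hg : Covers g A)
    (hh : Covers h B) : Covers (g * h) (A * B) := by
  rw [covers_iff] at *
  refine ⟨mul_mem hg.1 hh.1, fun v => ?_⟩
  rw [pinCoe_mul, map_mul, mul_assoc, hh.2, ← mul_assoc, hg.2, Matrix.mulVec_mulVec, mul_assoc]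

theorem covers_one : Covers (1 : PinPlus n) 1 := by
  rw [covers_iff]
  exact ⟨one_mem _, fun v => by simp [pinCoe_one]⟩

theorem covers_negOne : Covers (pinNegOne n) 1 := by
  rw [covers_iff]
  exact ⟨one_mem _, fun v => by simp [pinCoe_negOne]⟩

theorem Covers.inv {g : PinPlus n} {A : Matrix (Fin n) (Fin n) ℝ} (hg : Covers g A) :
    Covers g⁻¹ A.transpose := by
  rw [covers_iff] at *
  have h1 := (Matrix.mem_orthogonalGroup_iff _ _).1 hg.1
  have h2 := (Matrix.mem_orthogonalGroup_iff' _ _).1 hg.1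
  refine ⟨(Matrix.mem_orthogonalGroup_iff _ _).2 (by rw [Matrix.transpose_transpose]; exact h2),
    fun v => ?_⟩
  have h := hg.2 (A.transpose.mulVec v)
  rw [Matrix.mulVec_mulVec, h1, Matrix.one_mulVec] at h
  have hi : involute (pinCoe g⁻¹) * involute (pinCoe g) = 1 := by
    rw [← map_mul, pinCoe_inv_mul, map_one]
  calc involute (pinCoe g⁻¹) * ι (stdForm n) v
      = involute (pinCoe g⁻¹) * (ι (stdForm n) v * pinCoe g) * pinCoe g⁻¹ := by
        rw [mul_assoc, mul_assoc, pinCoe_mul_inv, mul_one]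
    _ = _ := by rw [← h, ← mul_assoc, hi, one_mul]

theorem Covers.unique {g : PinPlus n} {A B : Matrix (Fin n) (Fin n) ℝ} (hA : Covers g A)
    (hB : Covers g B) : A = B := by
  rw [covers_iff] at *
  refine Matrix.ext_of_mulVec_single fun i => ι_injective ?_
  have h := (hA.2 (Pi.single i 1)).symm.trans (hB.2 (Pi.single i 1))
  have := congrArg (· * pinCoe g⁻¹) h
  simpa [mul_assoc, pinCoe_mul_inv] using this

/-- A unit vector covers the reflection in its orthogonal hyperplane: this is the Clifford relation
`v w = 2 ⟨v, w⟩ - w v`. -/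
theorem covers_pinVec (v : Fin n → ℝ) (hv : v ⬝ᵥ v = 1) :
    Covers (pinVec v hv) (1 - (2 : ℝ) • Matrix.vecMulVec v v) := by
  rw [covers_iff, pinCoe_vec, Matrix.mem_orthogonalGroup_iff]
  constructor
  · simp only [Matrix.transpose_sub, Matrix.transpose_one, Matrix.transpose_smul,
      Matrix.transpose_vecMulVec, mul_sub, sub_mul, mul_one, one_mul, Matrix.smul_mul,
      Matrix.mul_smul, Matrix.vecMulVec_mul_vecMulVec, hv, one_smul]
    module
  · intro w
    rw [involute_ι, Matrix.sub_mulVec, Matrix.one_mulVec, Matrix.smul_mulVec,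
      Matrix.vecMulVec_mulVec, map_sub, sub_mul, ι_mul_ι_swap w v]
    simp only [op_smul_eq_smul, map_smul, smul_mul_assoc, ι_mul_self_of_unit hv,
      Algebra.algebraMap_eq_smul_one, smul_smul, dotProduct_comm w v]
    simp

theorem exists_covers (g : PinPlus n) : ∃ A, Covers g A := by
  induction g using pin_induction with
  | hvec v hv => exact ⟨_, covers_pinVec v hv⟩
  | hneg => exact ⟨_, covers_negOne⟩
  | hone => exact ⟨_, covers_one⟩
  | hmul g h hg hh =>
    obtain ⟨A, hA⟩ := hg
    obtain ⟨B, hB⟩ := hh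
    exact ⟨_, hA.mul hB⟩
  | hinv g hg =>
    obtain ⟨A, hA⟩ := hg
    exact ⟨_, hA.inv⟩

/-- The orthogonal matrix under an element of the pin group. -/
def pinMatrix (g : PinPlus n) : Matrix (Fin n) (Fin n) ℝ := (exists_covers g).choose

theorem covers_pinMatrix (g : PinPlus n) : Covers g (pinMatrix g) := (exists_covers g).choose_spec

theorem pinMatrix_mul (g h : PinPlus n) : pinMatrix (g * h) = pinMatrix g * pinMatrix h :=
  (covers_pinMatrix _).unique ((covers_pinMatrix g).mul (covers_pinMatrix h))

theorem pinMatrix_one : pinMatrix (1 : PinPlus n) = 1 := (covers_pinMatrix _).unique covers_one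

theorem pinMatrix_inv (g : PinPlus n) : pinMatrix g⁻¹ = (pinMatrix g).transpose :=
  (covers_pinMatrix _).unique (covers_pinMatrix g).inv

theorem pinMatrix_mem (g : PinPlus n) : pinMatrix g ∈ Matrix.orthogonalGroup (Fin n) ℝ :=
  (covers_pinMatrix g).1

theorem pinMatrix_negOne : pinMatrix (pinNegOne n) = 1 :=
  (covers_pinMatrix _).unique covers_negOne

/-- By the Cartan–Dieudonné theorem, every orthogonal matrix is covered. -/
theorem exists_pinMatrix_eq {A : Matrix (Fin n) (Fin n) ℝ}
    (hA : A ∈ Matrix.orthogonalGroup (Fin n) ℝ) : ∃ g : PinPlus n, pinMatrix g = A := by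
  have key : ∀ φ : EuclideanSpace ℝ (Fin n) ≃ₗᵢ[ℝ] EuclideanSpace ℝ (Fin n),
      ∃ g : PinPlus n, ∀ v : Fin n → ℝ,
        (pinMatrix g).mulVec v = (φ (WithLp.toLp 2 v)).ofLp := by
    intro φ
    have hφ : φ ∈ Subgroup.closure (Set.range fun v : EuclideanSpace ℝ (Fin n) =>
        (ℝ ∙ v)ᗮ.reflection) := by
      rw [LinearIsometryEquiv.reflections_generate]; trivial
    induction hφ using Subgroup.closure_induction with
    | mem φ hφ =>
      obtain ⟨v, rfl⟩ := hφ
      -- for `v = 0` the reflection is the identity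
      by_cases hv : v = 0
      · refine ⟨1, fun w => ?_⟩
        subst hv
        rw [pinMatrix_one, Matrix.one_mulVec, Submodule.reflection_orthogonal_apply,
          Submodule.reflection_singleton_apply]
        simp
      · have hn : ‖v‖ ≠ 0 := norm_ne_zero_iff.2 hv
        have hvv : v.ofLp ⬝ᵥ v.ofLp = ‖v‖ ^ 2 := by
          rw [EuclideanSpace.norm_sq_eq]
          simp [dotProduct, sq]
        have hu : ((‖v‖⁻¹ : ℝ) • v.ofLp) ⬝ᵥ ((‖v‖⁻¹ : ℝ) • v.ofLp) = 1 := by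
          rw [smul_dotProduct, dotProduct_smul, hvv]
          simp only [smul_eq_mul]
          field_simp
        refine ⟨pinVec _ hu, fun w => ?_⟩
        rw [(covers_pinMatrix _).unique (covers_pinVec _ hu)]
        simp only [Submodule.reflection_orthogonal_apply, Submodule.reflection_singleton_apply]
        have hin : inner ℝ v (WithLp.toLp 2 w) = v.ofLp ⬝ᵥ w := by
          simp [PiLp.inner_apply, dotProduct, mul_comm]
        rw [hin, Matrix.sub_mulVec, Matrix.one_mulVec, Matrix.smul_mulVec, Matrix.vecMulVec_mulVec]
        ext i
        simp [smul_dotProduct]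
        field_simp
    | one => exact ⟨1, fun v => by simp [pinMatrix_one]⟩
    | mul φ ψ _ _ h1 h2 =>
      obtain ⟨g, hg⟩ := h1
      obtain ⟨h, hh⟩ := h2
      refine ⟨g * h, fun v => ?_⟩
      rw [pinMatrix_mul, ← Matrix.mulVec_mulVec, hh, hg]
      simp
    | inv φ _ h1 =>
      obtain ⟨g, hg⟩ := h1
      refine ⟨g⁻¹, fun v => ?_⟩
      have h2 := (Matrix.mem_orthogonalGroup_iff' _ _).1 (pinMatrix_mem g)
      have h3 := hg (φ⁻¹ (WithLp.toLp 2 v)).ofLp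
      have h4 : φ (φ⁻¹ (WithLp.toLp 2 v)) = WithLp.toLp 2 v := φ.apply_symm_apply _
      rw [WithLp.toLp_ofLp, h4] at h3
      rw [pinMatrix_inv]
      conv_lhs => rw [show v = (pinMatrix g).mulVec (φ⁻¹ (WithLp.toLp 2 v)).ofLp from h3.symm]
      rw [Matrix.mulVec_mulVec, h2, Matrix.one_mulVec]
  let φ : EuclideanSpace ℝ (Fin n) →ₗ[ℝ] EuclideanSpace ℝ (Fin n) := Matrix.toEuclideanLin A
  have hnorm : ∀ v, ‖φ v‖ = ‖v‖ := by
    intro v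
    have h1 : ‖φ v‖ ^ 2 = ‖v‖ ^ 2 := by
      have hsq : ∀ u : EuclideanSpace ℝ (Fin n), ‖u‖ ^ 2 = u.ofLp ⬝ᵥ u.ofLp := fun u => by
        rw [EuclideanSpace.norm_sq_eq]
        simp [dotProduct, sq]
      rw [hsq, hsq]
      have : (φ v).ofLp = A.mulVec v.ofLp := by simp [φ, Matrix.toLpLin_apply]
      rw [this, Matrix.dotProduct_mulVec, Matrix.vecMul_mulVec,
        (Matrix.mem_orthogonalGroup_iff' _ _).1 hA, Matrix.vecMul_one]
    exact (sq_eq_sq₀ (norm_nonneg _) (norm_nonneg _)).1 h1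
  obtain ⟨g, hg⟩ := key ((⟨φ, hnorm⟩ : EuclideanSpace ℝ (Fin n) →ₗᵢ[ℝ] _).toLinearIsometryEquiv rfl)
  refine ⟨g, Matrix.ext_of_mulVec_single fun i => ?_⟩
  rw [hg]
  simp [φ, Matrix.toLpLin_apply]

/-- The kernel of the covering is `{1, -1}`: an element of it commutes with all vectors in the
graded sense, so it is a scalar `c`, and `c² = 1` as the reversal is the inverse. -/
theorem eq_or_eq_of_pinMatrix_eq_one {g : PinPlus n} (hg : pinMatrix g = 1) :
    g = 1 ∨ g = pinNegOne n := by
  have h := covers_pinMatrix g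
  rw [hg, covers_iff] at h
  obtain ⟨c, hc⟩ := scalar_of_gradedCentral (x := pinCoe g) (fun v => by
    rw [h.2, Matrix.one_mulVec])
  have h1 := reverse_mul_pinCoe g
  rw [hc, reverse.commutes, ← map_mul] at h1
  obtain ⟨ℓ, hℓ⟩ := exists_linear_scalarPart (n := n)
  have h2 : c * c = 1 := by
    rw [← hℓ (c * c), h1, ← map_one (algebraMap ℝ (Cl n)), hℓ]
  rcases mul_self_eq_one_iff.1 h2 with rfl | rfl
  · exact Or.inl (pinCoe_injective (by rw [hc, pinCoe_one, map_one]))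
  · exact Or.inr (pinCoe_injective (by rw [hc, pinCoe_negOne, map_neg, map_one]))

/-! ### The topology of the pin group -/

/-- The topology of the finite-dimensional algebra `Cl n`. -/
instance cliffordTopology (n : ℕ) : TopologicalSpace (Cl n) := moduleTopology ℝ (Cl n)

instance : IsModuleTopology ℝ (Cl n) := ⟨rfl⟩

instance : IsTopologicalRing (Cl n) := IsModuleTopology.isTopologicalRing ℝ (Cl n)

instance : ContinuousSMul ℝ (Cl n) := IsModuleTopology.toContinuousSMul ℝ (Cl n)

theorem isInducing_pinCoe : Topology.IsInducing (pinCoe (n := n)) := ⟨rfl⟩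

theorem continuous_pinCoe : Continuous (pinCoe (n := n)) := isInducing_pinCoe.continuous

instance pin_topologicalGroup : IsTopologicalGroup (PinPlus n) where
  continuous_mul := isInducing_pinCoe.continuous_iff.2 <|
    (continuous_pinCoe.comp continuous_fst).mul (continuous_pinCoe.comp continuous_snd)
  continuous_inv := isInducing_pinCoe.continuous_iff.2 <| by
    have : pinCoe ∘ (fun g : PinPlus n => g⁻¹) = fun g => reverse (pinCoe g) :=
      funext pinCoe_inv
    rw [this]
    exact (IsModuleTopology.continuous_of_linearMap reverse).comp continuous_pinCoe

/-- The columns of the matrix are the vectors `ĝ e_j g⁻¹`, where `ĝ` is the grade involution of `g`.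
-/
theorem continuous_pinMatrix : Continuous (pinMatrix (n := n)) := by
  obtain ⟨ℓ, hℓ⟩ := exists_linear_leftInverse_ι (n := n)
  refine continuous_matrix fun i j => ?_
  have h : (fun g : PinPlus n => pinMatrix g i j) = fun g =>
      ℓ (involute (pinCoe g) * ι (stdForm n) (Pi.single j 1) * reverse (pinCoe g)) i := by
    ext g
    rw [(covers_iff.1 (covers_pinMatrix g)).2, mul_assoc, ← pinCoe_inv, pinCoe_mul_inv, mul_one, hℓ]
    simp
  rw [h]
  have hi : Continuous (involute (Q := stdForm n)) :=
    IsModuleTopology.continuous_of_linearMap (involute (Q := stdForm n)).toLinearMap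
  have hr : Continuous (reverse (Q := stdForm n)) := IsModuleTopology.continuous_of_linearMap _
  have hl : Continuous ℓ := IsModuleTopology.continuous_of_linearMap _
  exact (continuous_apply i).comp (hl.comp
    (((hi.comp continuous_pinCoe).mul continuous_const).mul (hr.comp continuous_pinCoe)))

/-- An element of the Clifford algebra that intertwines the standard basis with the columns of the
orthogonal matrix `A`. It depends polynomially on `A` and is `1` for `A = 1`; for `A` near `1` it is
a multiple of an element of the pin group over `A`. -/
def intertwiner (A : Matrix (Fin n) (Fin n) ℝ) : Cl n :=
  avgProd (fun i => A.mulVec (Pi.single i 1)) (fun i => Pi.single i 1) (List.finRange n) 1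

theorem continuous_intertwiner : Continuous (intertwiner (n := n)) := by
  have hι : Continuous (ι (stdForm n)) := IsModuleTopology.continuous_of_linearMap _
  have hi : Continuous (involute (Q := stdForm n)) :=
    IsModuleTopology.continuous_of_linearMap (involute (Q := stdForm n)).toLinearMap
  have : ∀ L : List (Fin n), Continuous fun A : Matrix (Fin n) (Fin n) ℝ =>
      avgProd (fun i => A.mulVec (Pi.single i 1)) (fun i => Pi.single i 1) L (1 : Cl n) := by
    intro L
    induction L with
    | nil => simpa [avgProd] using! continuous_const
    | cons j L ih =>
      have hL : ∀ A : Matrix (Fin n) (Fin n) ℝ,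
          avgProd (fun i => A.mulVec (Pi.single i 1)) (fun i => Pi.single i 1) (j :: L) (1 : Cl n) =
          avg (ι _ (A.mulVec (Pi.single j 1))) (ι _ (Pi.single j 1))
            (avgProd (fun i => A.mulVec (Pi.single i 1)) (fun i => Pi.single i 1) L
              (1 : Cl n)) := by
        intro A
        simp [avgProd]
      simp only [hL, avg_apply]
      have hA : Continuous fun A : Matrix (Fin n) (Fin n) ℝ => A.mulVec (Pi.single j (1 : ℝ)) := by
        fun_prop
      exact (ih.add (((hι.comp hA).mul (hi.comp ih)).mul continuous_const)).const_smul (1 / 2 : ℝ)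
  exact this _

theorem intertwiner_one : intertwiner (1 : Matrix (Fin n) (Fin n) ℝ) = 1 :=
  avgProd_fixed (fun i => by rw [map_one, mul_one, Matrix.one_mulVec]; exact gen_mul_self i) _

theorem intertwiner_spec {A : Matrix (Fin n) (Fin n) ℝ}
    (hA : A ∈ Matrix.orthogonalGroup (Fin n) ℝ) (v : Fin n → ℝ) :
    involute (intertwiner A) * ι (stdForm n) v =
      ι (stdForm n) (A.mulVec v) * intertwiner A := by
  have hcol : ∀ i j, A.mulVec (Pi.single i 1) ⬝ᵥ A.mulVec (Pi.single j 1) =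
      if i = j then (1 : ℝ) else 0 := by
    intro i j
    rw [Matrix.dotProduct_mulVec, Matrix.vecMul_mulVec,
      (Matrix.mem_orthogonalGroup_iff' _ _).1 hA, Matrix.vecMul_one]
    simp [Pi.single_apply, eq_comm]
  have hbasis : ∀ i, involute (intertwiner A) * ι (stdForm n) (Pi.single i 1) =
      ι (stdForm n) (A.mulVec (Pi.single i 1)) * intertwiner A := by
    intro i
    have h := LinearMap.congr_fun (twist_mul_avgProd hcol
      (g := fun i => Pi.single i (1 : ℝ)) (fun i j => by simp [Pi.single_apply, eq_comm])
      (List.finRange n) i (List.mem_finRange i)) 1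
    rw [Module.End.mul_apply, twist_apply] at h
    change _ * involute (intertwiner A) * _ = intertwiner A at h
    conv_rhs => rw [← h]
    rw [← mul_assoc, ← mul_assoc, ι_mul_self_of_unit (by simpa using hcol i i), one_mul]
  have hv : v = ∑ i, v i • Pi.single i (1 : ℝ) := by
    ext j
    simp [Finset.sum_apply, Pi.single_apply]
  rw [hv, map_sum, Finset.mul_sum, Matrix.mulVec_sum, map_sum, Finset.sum_mul]
  refine Finset.sum_congr rfl fun i _ => ?_
  rw [map_smul, mul_smul_comm, hbasis, Matrix.mulVec_smul, map_smul, smul_mul_assoc]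

/-- Near `1`, the covering of the orthogonal group has a continuous section. -/
theorem exists_section_one : ∃ σ : Matrix.orthogonalGroup (Fin n) ℝ → PinPlus n,
    ContinuousAt σ 1 ∧ σ 1 = 1 ∧ ∀ A, pinMatrix (σ A) = A := by
  classical
  obtain ⟨ℓ, hℓ⟩ := exists_linear_scalarPart (n := n)
  have hl : Continuous ℓ := IsModuleTopology.continuous_of_linearMap _
  have hr : Continuous (reverse (Q := stdForm n)) := IsModuleTopology.continuous_of_linearMap _
  let ν : Matrix.orthogonalGroup (Fin n) ℝ → ℝ := fun A =>
    ℓ (reverse (intertwiner A.1) * intertwiner A.1)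
  have hI : Continuous fun A : Matrix.orthogonalGroup (Fin n) ℝ => intertwiner A.1 :=
    continuous_intertwiner.comp continuous_subtype_val
  have hν : Continuous ν := hl.comp ((hr.comp hI).mul hI)
  have hν1 : ν 1 = 1 := by
    simp only [ν, OneMemClass.coe_one, intertwiner_one, reverse.map_one, mul_one]
    rw [← map_one (algebraMap ℝ (Cl n)), hℓ]
  -- Over `A` the intertwiner is a scalar multiple of any element of the pin group over `A`. Where
  -- its norm `ν A` is positive, division by `√(ν A)` singles out one of the two elements `±g`.
  have hex : ∀ A, ∃ g : PinPlus n, pinMatrix g = A.1 ∧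
      (0 < ν A → pinCoe g = (Real.sqrt (ν A))⁻¹ • intertwiner A.1) := by
    intro A
    obtain ⟨g, hg⟩ := exists_pinMatrix_eq A.2
    by_cases hA : 0 < ν A
    swap
    · exact ⟨g, hg, fun h => absurd h hA⟩
    have hgi := covers_iff.1 (covers_pinMatrix g⁻¹)
    obtain ⟨c, hc⟩ := scalar_of_gradedCentral (x := pinCoe g⁻¹ * intertwiner A.1) (fun v => by
      rw [map_mul, mul_assoc, intertwiner_spec A.2, ← mul_assoc, hgi.2, mul_assoc, pinMatrix_inv,
        Matrix.mulVec_mulVec, hg, (Matrix.mem_orthogonalGroup_iff' _ _).1 A.2, Matrix.one_mulVec])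
    have hc' : intertwiner A.1 = c • pinCoe g := by
      calc intertwiner A.1 = pinCoe g * (pinCoe g⁻¹ * intertwiner A.1) := by
            rw [← mul_assoc, pinCoe_mul_inv, one_mul]
        _ = c • pinCoe g := by
            rw [hc, Algebra.algebraMap_eq_smul_one, mul_smul_comm, mul_one]
    have hνc : ν A = c ^ 2 := by
      simp only [ν]
      rw [hc', map_smul, smul_mul_assoc, mul_smul_comm, reverse_mul_pinCoe, smul_smul,
        ← Algebra.algebraMap_eq_smul_one, hℓ, sq]
    have hc0 : c ≠ 0 := by
      rintro rfl
      rw [hνc] at hA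
      norm_num at hA
    rcases lt_or_gt_of_ne hc0 with h | h
    · refine ⟨pinNegOne n * g, by rw [pinMatrix_mul, pinMatrix_negOne, one_mul, hg], fun _ => ?_⟩
      rw [hνc, Real.sqrt_sq_eq_abs, abs_of_neg h, hc', smul_smul, pinCoe_mul, pinCoe_negOne,
        inv_neg, neg_mul, neg_mul, inv_mul_cancel₀ hc0]
      simp
    · refine ⟨g, hg, fun _ => ?_⟩
      rw [hνc, Real.sqrt_sq h.le, hc', smul_smul, inv_mul_cancel₀ hc0, one_smul]
  choose σ hσ1 hσ2 using hex
  have hnear : ∀ᶠ A in nhds (1 : Matrix.orthogonalGroup (Fin n) ℝ), 0 < ν A :=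
    hν.continuousAt.eventually_const_lt (by rw [hν1]; exact one_pos)
  refine ⟨σ, ?_, ?_, hσ1⟩
  · rw [isInducing_pinCoe.continuousAt_iff]
    have : ContinuousAt (fun A => (Real.sqrt (ν A))⁻¹ • intertwiner A.1)
        (1 : Matrix.orthogonalGroup (Fin n) ℝ) := by
      refine ContinuousAt.smul (ContinuousAt.inv₀ hν.sqrt.continuousAt ?_) hI.continuousAt
      rw [hν1]; simp
    exact this.congr (hnear.mono fun A hA => (hσ2 A hA).symm)
  · refine pinCoe_injective ?_
    rw [hσ2 1 (by rw [hν1]; exact one_pos), hν1]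
    simp [intertwiner_one, pinCoe_one]

/-- The covering of the orthogonal group has a continuous local section through every point. -/
theorem exists_section (g : PinPlus n) : ∃ σ : Matrix.orthogonalGroup (Fin n) ℝ → PinPlus n,
    ContinuousAt σ ⟨pinMatrix g, pinMatrix_mem g⟩ ∧ σ ⟨pinMatrix g, pinMatrix_mem g⟩ = g ∧
      ∀ A, pinMatrix (σ A) = A := by
  obtain ⟨σ, h1, h2, h3⟩ := exists_section_one (n := n)
  let B : Matrix.orthogonalGroup (Fin n) ℝ := ⟨pinMatrix g, pinMatrix_mem g⟩
  have hB : B⁻¹ * B = 1 := inv_mul_cancel B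
  refine ⟨fun A => g * σ (B⁻¹ * A), ?_, ?_, fun A => ?_⟩
  · refine ContinuousAt.mul continuousAt_const ?_
    have : ContinuousAt (fun A : Matrix.orthogonalGroup (Fin n) ℝ => B⁻¹ * A) B := by fun_prop
    exact ContinuousAt.comp (g := σ) (by rw [hB]; exact h1) this
  · change g * σ (B⁻¹ * B) = g
    rw [hB, h2, mul_one]
  · rw [pinMatrix_mul, h3]
    exact congrArg Subtype.val (mul_inv_cancel_left B A)

end Pin

/-! ### Tangent spaces -/

open Filter Topology

section Tangent

variable {N n : ℕ}

theorem toTorus_eq_iff {g g' : Fin n → ℝ} :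
    toTorus N g = toTorus N g' ↔ ∃ m : Fin n → ℤ, ∀ i, g i = g' i + m i * N := by
  have h : ∀ i, ((g i : AddCircle (N : ℝ)) = (g' i : AddCircle (N : ℝ))) ↔
      ∃ m : ℤ, g i = g' i + m * N := fun i => by
    rw [← sub_eq_zero, ← AddCircle.coe_sub, AddCircle.coe_eq_zero_iff]
    refine exists_congr fun m => ?_
    rw [zsmul_eq_mul]
    constructor <;> intro h <;> linarith
  simp only [toTorus, funext_iff, h]
  exact Classical.skolem

theorem continuous_toTorus : Continuous (toTorus N (n := n)) :=
  continuous_pi fun i => (AddCircle.continuous_mk' _).comp (continuous_apply i)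

theorem continuous_q : Continuous (q N (n := n)) :=
  continuous_fst.prodMk (continuous_toTorus.comp continuous_snd)

theorem toTorus_surjective : Function.Surjective (toTorus N (n := n)) := fun p => by
  choose g hg using fun i => QuotientAddGroup.mk_surjective (p i)
  exact ⟨g, funext hg⟩

theorem q_surjective : Function.Surjective (q N (n := n)) := fun p => by
  obtain ⟨g, hg⟩ := toTorus_surjective p.2
  exact ⟨(p.1, g), Prod.ext rfl hg⟩

/-- The tangent space of a set that is parametrised by an immersion `ψ` and cut out by an equation
`G = 0` whose linearisation is solved by the derivative of `ψ`. -/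
theorem tangentSpace_eq_range {S : Set (CotTorus N n)} {x : E n} {ψ : (Fin n → ℝ) → E n}
    {y : Fin n → ℝ} {L : (Fin n → ℝ) →L[ℝ] E n} {G : E n → (Fin n → ℝ)}
    {G' : E n →L[ℝ] (Fin n → ℝ)} (hψ : HasFDerivAt ψ L y) (hx : ψ y = x)
    (hS : ∀ z, q N (ψ z) ∈ S) (hG : HasFDerivAt G G' x)
    (hGS : ∀ᶠ z in 𝓝 x, q N z ∈ S → G z = 0) (hker : ∀ v, G' v = 0 → ∃ w, L w = v) :
    tangentSpace S x = L.range := by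
  refine le_antisymm (Submodule.span_le.2 fun v hv => ?_) ?_
  · obtain ⟨w, hw⟩ := hker v (by
      have hx0 : G x = 0 := hGS.self_of_nhds (hx ▸ hS y)
      rw [← tangentConeAt_inter_nhds hGS] at hv
      have h1 := hG.hasFDerivWithinAt.mapsTo_tangent_cone hv
      have h2 : G '' (q N ⁻¹' S ∩ {z | q N z ∈ S → G z = 0}) ⊆ {0} := by
        rintro _ ⟨z, ⟨hz1, hz2⟩, rfl⟩
        exact hz2 hz1
      have h3 := tangentConeAt_mono h2 h1
      rw [hx0] at h3
      exact tangentConeAt_subset_zero (by rw [accPt_iff_nhds]; simp; exact ⟨_, Filter.univ_mem⟩) h3)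
    exact ⟨w, hw⟩
  · rintro _ ⟨v, rfl⟩
    refine Submodule.subset_span ?_
    have h1 := (hψ.hasFDerivWithinAt (s := Set.univ)).mapsTo_tangent_cone
      (show v ∈ tangentConeAt ℝ Set.univ y by rw [tangentConeAt_univ]; trivial)
    rw [hx] at h1
    exact tangentConeAt_mono (by rintro _ ⟨z, -, rfl⟩; exact hS z) h1

/-- The graph of a map from the fibre `ℝ^n` to the torus `(ℝ/Nℤ)^n`. -/
def torusGraph (N : ℕ) {n : ℕ} (F : (Fin n → ℝ) → (Fin n → ℝ)) : Set (CotTorus N n) :=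
  {p | p.2 = toTorus N (F p.1)}

theorem mem_torusGraph {F : (Fin n → ℝ) → (Fin n → ℝ)} {p : CotTorus N n} :
    p ∈ torusGraph N F ↔ p.2 = toTorus N (F p.1) := Iff.rfl

/-- Over the universal cover the graph becomes the union of its translates by `Nℤ^n`. -/
theorem q_mem_torusGraph {F : (Fin n → ℝ) → (Fin n → ℝ)} {x : E n} :
    q N x ∈ torusGraph N F ↔ ∃ m : Fin n → ℤ, ∀ i, x.2 i = F x.1 i + m i * N :=
  toTorus_eq_iff

/-- Near a point `x` over the graph only the sheet through `x` matters: the translates are at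
distance at least `N ≥ 1` from each other. -/
theorem q_mem_torusGraph_iff (hN : 1 ≤ N) {F : (Fin n → ℝ) → (Fin n → ℝ)} {x : E n}
    (hx : q N x ∈ torusGraph N F) {z : E n}
    (hz : ∀ i, |(z.2 i - F z.1 i) - (x.2 i - F x.1 i)| < 1) :
    q N z ∈ torusGraph N F ↔ z.2 - F z.1 = x.2 - F x.1 := by
  have hN' : (1 : ℝ) ≤ N := by exact_mod_cast hN
  obtain ⟨m, hm⟩ := q_mem_torusGraph.1 hx
  rw [q_mem_torusGraph]
  constructor
  · rintro ⟨m', hm'⟩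
    ext i
    have h1 := hz i
    have h2 : (z.2 i - F z.1 i) - (x.2 i - F x.1 i) = ((m' i - m i : ℤ) : ℝ) * N := by
      rw [hm, hm']; push_cast; ring
    rw [h2, abs_mul, Nat.abs_cast, ← Int.cast_abs] at h1
    have h3 : m' i - m i = 0 := by
      by_contra hne
      have : (1 : ℝ) ≤ (|m' i - m i| : ℤ) := by exact_mod_cast Int.one_le_abs hne
      nlinarith
    rw [h3] at h2
    simp only [Pi.sub_apply]
    linarith [show ((0 : ℤ) : ℝ) * N = 0 by simp]
  · intro h
    refine ⟨m, fun i => ?_⟩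
    have := congrFun h i
    simp only [Pi.sub_apply] at this
    linarith [hm i]

theorem eventually_mem_torusGraph_iff (hN : 1 ≤ N) {F : (Fin n → ℝ) → (Fin n → ℝ)}
    (hF : Continuous F) {x : E n} (hx : q N x ∈ torusGraph N F) :
    ∀ᶠ z in 𝓝 x, q N z ∈ torusGraph N F ↔ z.2 - F z.1 = x.2 - F x.1 := by
  have : ∀ᶠ z : E n in 𝓝 x, ∀ i, |(z.2 i - F z.1 i) - (x.2 i - F x.1 i)| < 1 := by
    rw [Filter.eventually_all]
    intro i
    have hc : Continuous fun z : E n => |(z.2 i - F z.1 i) - (x.2 i - F x.1 i)| := by fun_prop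
    exact hc.continuousAt.eventually_lt_const (by simp)
  exact this.mono fun z hz => q_mem_torusGraph_iff hN hx hz

theorem tangentSpace_torusGraph (hN : 1 ≤ N) {F : (Fin n → ℝ) → (Fin n → ℝ)}
    (hF : Continuous F) {x : E n} (hx : q N x ∈ torusGraph N F)
    {F' : (Fin n → ℝ) →L[ℝ] (Fin n → ℝ)} (hF' : HasFDerivAt F F' x.1) :
    tangentSpace (torusGraph N F) x = ((ContinuousLinearMap.id ℝ (Fin n → ℝ)).prod F').range := by
  obtain ⟨m, hm⟩ := q_mem_torusGraph.1 hx
  refine tangentSpace_eq_range (ψ := fun y => (y, F y + (x.2 - F x.1)))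
    (G := fun z => z.2 - F z.1 - (x.2 - F x.1)) (y := x.1)
    (G' := ContinuousLinearMap.snd ℝ _ _ - F'.comp (ContinuousLinearMap.fst ℝ _ _))
    ?_ ?_ ?_ ?_ ?_ ?_
  · exact (hasFDerivAt_id _).prodMk (hF'.add_const _)
  · ext <;> simp
  · intro z
    refine q_mem_torusGraph.2 ⟨m, fun i => ?_⟩
    simp only [Pi.add_apply, Pi.sub_apply]
    linarith [hm i]
  · exact (hasFDerivAt_snd.sub (HasFDerivAt.comp (f := Prod.fst) x hF' hasFDerivAt_fst)).sub_const _
  · exact (eventually_mem_torusGraph_iff hN hF hx).mono fun z hz h => sub_eq_zero.2 (hz.1 h)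
  · intro v hv
    refine ⟨v.1, Prod.ext rfl ?_⟩
    simp only [sub_apply, ContinuousLinearMap.coe_snd',
      ContinuousLinearMap.comp_apply, ContinuousLinearMap.coe_fst', sub_eq_zero] at hv
    simp [hv]

theorem isClosed_torusGraph (hN : 1 ≤ N) {F : (Fin n → ℝ) → (Fin n → ℝ)} (hF : Continuous F) :
    IsClosed (torusGraph N F) := by
  have : Fact ((0 : ℝ) < N) := ⟨by exact_mod_cast hN⟩
  exact isClosed_eq continuous_snd (continuous_toTorus.comp (hF.comp continuous_fst))

/-- The chart straightens the sheet of the graph through the given point by a shear. -/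
theorem isSubmanifold_torusGraph (hN : 1 ≤ N) {F : (Fin n → ℝ) → (Fin n → ℝ)}
    (hF : ContDiff ℝ ∞ F) : IsSubmanifold (torusGraph N F) := by
  intro x hx
  let c := x.2 - F x.1
  let e : E n ≃ₜ E n :=
    { toFun := fun z => (z.1, z.2 - F z.1 - c)
      invFun := fun z => (z.1, z.2 + F z.1 + c)
      left_inv := fun z => Prod.ext rfl (by simp [sub_add])
      right_inv := fun z => Prod.ext rfl (by simp [add_sub_right_comm])
      continuous_toFun := by have := hF.continuous; fun_prop
      continuous_invFun := by have := hF.continuous; fun_prop }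
  let V : Set (E n) := {z | ∀ i, |(z.2 i - F z.1 i) - (x.2 i - F x.1 i)| < 1}
  have hV : IsOpen V := by
    have : V = ⋂ i, {z : E n | |(z.2 i - F z.1 i) - (x.2 i - F x.1 i)| < 1} := by
      ext; simp [V]
    rw [this]
    have := hF.continuous
    exact isOpen_iInter_of_finite fun i => isOpen_lt (by fun_prop) continuous_const
  refine ⟨e.toOpenPartialHomeomorphOfImageEq V hV _ rfl, ?_, ?_, ?_, ?_⟩
  · simp [V]
  · have : ContDiff ℝ ∞ fun z : E n => (z.1, z.2 - F z.1 - c) := by fun_prop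
    exact this.contDiffOn
  · have : ContDiff ℝ ∞ fun z : E n => (z.1, z.2 + F z.1 + c) := by fun_prop
    exact this.contDiffOn
  · intro z hz
    rw [q_mem_torusGraph_iff hN hx hz, ← sub_eq_zero]
    rfl

end Tangent

/-! ### The moment map of projective space -/

section Moment

variable {n : ℕ}

/-- The denominator `1 + ∑ |z_j|²` on the torus `|z_j| = exp(y_j)`. -/
def momentDenom (y : Fin n → ℝ) : ℝ := 1 + ∑ j, Real.exp (2 * y j)

/-- The moment map `y ↦ |z_i|² / (1 + ∑ |z_j|²)` of projective space; it is a diffeomorphism of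
`ℝ^n` onto the open standard simplex. -/
def moment (y : Fin n → ℝ) : Fin n → ℝ := fun i => Real.exp (2 * y i) / momentDenom y

/-- The Jacobian matrix of the moment map. -/
def momentMatrix (y : Fin n → ℝ) : Matrix (Fin n) (Fin n) ℝ :=
  (2 : ℝ) • (Matrix.diagonal (moment y) - Matrix.vecMulVec (moment y) (moment y))

/-- The derivative of the moment map. -/
def momentDeriv (y : Fin n → ℝ) : (Fin n → ℝ) →L[ℝ] (Fin n → ℝ) :=
  LinearMap.toContinuousLinearMap (momentMatrix y).mulVecLin

theorem momentDenom_pos (y : Fin n → ℝ) : 0 < momentDenom y := by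
  unfold momentDenom
  positivity

theorem moment_pos (y : Fin n → ℝ) (i : Fin n) : 0 < moment y i :=
  div_pos (Real.exp_pos _) (momentDenom_pos y)

theorem one_sub_sum_moment (y : Fin n → ℝ) : 1 - ∑ i, moment y i = (momentDenom y)⁻¹ := by
  have := (momentDenom_pos y).ne'
  simp only [moment]
  rw [← Finset.sum_div]
  field_simp
  simp [momentDenom]

theorem moment_lt_one (y : Fin n → ℝ) (i : Fin n) : moment y i < 1 := by
  have h1 := one_sub_sum_moment y
  have h2 := inv_pos.2 (momentDenom_pos y)
  have h3 : moment y i ≤ ∑ j, moment y j :=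
    Finset.single_le_sum (fun j _ => (moment_pos y j).le) (Finset.mem_univ i)
  linarith

theorem momentDeriv_apply (y v : Fin n → ℝ) (i : Fin n) :
    momentDeriv y v i = 2 * moment y i * v i - 2 * moment y i * ∑ j, moment y j * v j := by
  simp only [momentDeriv, LinearMap.coe_toContinuousLinearMap', Matrix.mulVecLin_apply,
    momentMatrix, Matrix.smul_mulVec, Matrix.sub_mulVec, Matrix.vecMulVec_mulVec]
  simp [dotProduct, Matrix.mulVec_diagonal]
  ring

theorem hasFDerivAt_momentDenom (y : Fin n → ℝ) :
    HasFDerivAt momentDenom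
      (∑ j, (2 * Real.exp (2 * y j)) • (ContinuousLinearMap.proj j : (Fin n → ℝ) →L[ℝ] ℝ)) y := by
  unfold momentDenom
  refine HasFDerivAt.const_add _ (HasFDerivAt.fun_sum fun j _ => ?_)
  have h1 : HasDerivAt (fun t : ℝ => Real.exp (2 * t)) (2 * Real.exp (2 * y j)) (y j) := by
    have := ((hasDerivAt_id (y j)).const_mul 2).exp
    simpa [mul_comm] using this
  exact h1.comp_hasFDerivAt y (ContinuousLinearMap.proj j : (Fin n → ℝ) →L[ℝ] ℝ).hasFDerivAt

theorem hasFDerivAt_momentDenom_inv (y : Fin n → ℝ) :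
    HasFDerivAt (fun y => (momentDenom y)⁻¹)
      (-(momentDenom y ^ 2)⁻¹ • (∑ j, (2 * Real.exp (2 * y j)) •
        (ContinuousLinearMap.proj j : (Fin n → ℝ) →L[ℝ] ℝ))) y :=
  (hasDerivAt_inv (momentDenom_pos y).ne').comp_hasFDerivAt y (hasFDerivAt_momentDenom y)

theorem hasFDerivAt_moment (y : Fin n → ℝ) : HasFDerivAt moment (momentDeriv y) y := by
  rw [hasFDerivAt_pi']
  intro i
  have h1 : HasDerivAt (fun t : ℝ => Real.exp (2 * t)) (2 * Real.exp (2 * y i)) (y i) := by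
    have := ((hasDerivAt_id (y i)).const_mul 2).exp
    simpa [mul_comm] using this
  have h2 := h1.comp_hasFDerivAt y (ContinuousLinearMap.proj i : (Fin n → ℝ) →L[ℝ] ℝ).hasFDerivAt
  have h3 := h2.fun_mul (hasFDerivAt_momentDenom_inv y)
  refine h3.congr_fderiv ?_
  ext v
  have := (momentDenom_pos y).ne'
  simp only [ContinuousLinearMap.comp_apply, ContinuousLinearMap.proj_apply, momentDeriv_apply]
  simp [moment, sum_apply, Finset.mul_sum]
  field_simp
  simp [Finset.mul_sum, mul_comm]
  ring

theorem contDiff_momentDenom : ContDiff ℝ ∞ (momentDenom (n := n)) := by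
  unfold momentDenom
  fun_prop

theorem contDiff_moment : ContDiff ℝ ∞ (moment (n := n)) :=
  contDiff_pi.2 fun i => ContDiff.div (by fun_prop) contDiff_momentDenom
    fun y => (momentDenom_pos y).ne'

theorem continuous_moment : Continuous (moment (n := n)) := contDiff_moment.continuous

/-- The inverse of the moment map on the open simplex. -/
def logit (u : Fin n → ℝ) : Fin n → ℝ := fun i => 1 / 2 * Real.log (u i / (1 - ∑ j, u j))

/-- The open standard simplex. -/
def openSimplex (n : ℕ) : Set (Fin n → ℝ) := {u | (∀ i, 0 < u i) ∧ ∑ i, u i < 1}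

theorem moment_mem_openSimplex (y : Fin n → ℝ) : moment y ∈ openSimplex n :=
  ⟨moment_pos y, by
    have h1 := one_sub_sum_moment y
    have h2 := inv_pos.2 (momentDenom_pos y)
    linarith⟩

theorem isOpen_openSimplex : IsOpen (openSimplex n) := by
  have : openSimplex n = (⋂ i, {u | 0 < u i}) ∩ {u | ∑ i, u i < 1} := by
    ext; simp [openSimplex]
  rw [this]
  exact (isOpen_iInter_of_finite fun i => isOpen_lt continuous_const (continuous_apply i)).inter
    (isOpen_lt (by fun_prop) continuous_const)

theorem logit_moment (y : Fin n → ℝ) : logit (moment y) = y := by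
  ext i
  simp only [logit, one_sub_sum_moment]
  have := (momentDenom_pos y).ne'
  rw [moment, div_inv_eq_mul, div_mul_cancel₀ _ this, Real.log_exp]
  ring

theorem moment_logit {u : Fin n → ℝ} (hu : u ∈ openSimplex n) : moment (logit u) = u := by
  have h1 : 0 < 1 - ∑ j, u j := by linarith [hu.2]
  have he : ∀ i, Real.exp (2 * logit u i) = u i / (1 - ∑ j, u j) := fun i => by
    simp only [logit]
    rw [← mul_assoc, mul_one_div_cancel two_ne_zero, one_mul,
      Real.exp_log (div_pos (hu.1 i) h1)]
  ext i
  simp only [moment, momentDenom, he]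
  rw [← Finset.sum_div]
  field_simp
  rw [sub_add_cancel, mul_one]

theorem contDiffAt_logit {u : Fin n → ℝ} (hu : u ∈ openSimplex n) : ContDiffAt ℝ ∞ logit u := by
  have h1 : 1 - ∑ j, u j ≠ 0 := by linarith [hu.2]
  refine contDiffAt_pi.2 fun i => ?_
  refine contDiffAt_const.mul (ContDiffAt.log (ContDiffAt.div ?_ ?_ h1)
    (div_ne_zero (hu.1 i).ne' h1)) <;> fun_prop

/-- The derivatives of the moment map and of its inverse are inverse to each other. -/
theorem exists_hasFDerivAt_logit (y : Fin n → ℝ) :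
    ∃ D : (Fin n → ℝ) →L[ℝ] (Fin n → ℝ), HasFDerivAt logit D (moment y) ∧
      (∀ v, D (momentDeriv y v) = v) ∧ ∀ v, momentDeriv y (D v) = v := by
  have hd : DifferentiableAt ℝ logit (moment y) :=
    (contDiffAt_logit (moment_mem_openSimplex y)).differentiableAt (by simp)
  refine ⟨_, hd.hasFDerivAt, fun v => ?_, fun v => ?_⟩
  · have h1 := hd.hasFDerivAt.comp y (hasFDerivAt_moment y)
    have h2 : logit ∘ moment = (id : (Fin n → ℝ) → _) := funext logit_moment
    rw [h2] at h1
    exact congrArg (fun f : (Fin n → ℝ) →L[ℝ] (Fin n → ℝ) => f v) (h1.unique (hasFDerivAt_id y))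
  · have hm : HasFDerivAt moment (momentDeriv y) (logit (moment y)) := by
      rw [logit_moment]; exact hasFDerivAt_moment y
    have h1 := hm.comp (moment y) hd.hasFDerivAt
    have h2 : moment ∘ logit =ᶠ[𝓝 (moment y)] id := by
      filter_upwards [isOpen_openSimplex.mem_nhds (moment_mem_openSimplex y)] with u hu
      exact moment_logit hu
    exact congrArg (fun f : (Fin n → ℝ) →L[ℝ] (Fin n → ℝ) => f v)
      ((h1.congr_of_eventuallyEq h2.symm).unique (hasFDerivAt_id _))

theorem momentMatrix_transpose (y : Fin n → ℝ) : (momentMatrix y).transpose = momentMatrix y := by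
  simp [momentMatrix, Matrix.transpose_vecMulVec]

theorem momentMatrix_mulVec (y v : Fin n → ℝ) : (momentMatrix y).mulVec v = momentDeriv y v := rfl

theorem continuous_momentMatrix : Continuous (momentMatrix (n := n)) := by
  have := continuous_moment (n := n)
  unfold momentMatrix
  exact ((continuous_moment.matrix_diagonal).sub
    (continuous_moment.matrix_vecMulVec continuous_moment)).const_smul (2 : ℝ)

/-- The Jacobian of the moment map is symmetric; this makes the graph Lagrangian. -/
theorem dotProduct_momentDeriv (y v w : Fin n → ℝ) :
    v ⬝ᵥ momentDeriv y w = momentDeriv y v ⬝ᵥ w := by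
  rw [← momentMatrix_mulVec, ← momentMatrix_mulVec, Matrix.dotProduct_mulVec,
    ← Matrix.mulVec_transpose, momentMatrix_transpose]

/-! ### The Lagrangian as a graph -/

theorem hasFDerivAt_metric (k : ℤ) (z : Fin n → ℂ) :
    HasFDerivAt (metric n k)
      ((-(k : ℝ) * (1 + ∑ i, ‖z i‖ ^ 2) ^ (-k - 1)) •
        ∑ i, (2 • (innerSL ℝ (z i)).comp
          (ContinuousLinearMap.proj i : (Fin n → ℂ) →L[ℝ] ℂ))) z := by
  have hR : HasFDerivAt (fun z : Fin n → ℂ => 1 + ∑ i, ‖z i‖ ^ 2)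
      (∑ i, (2 • (innerSL ℝ (z i)).comp (ContinuousLinearMap.proj i : (Fin n → ℂ) →L[ℝ] ℂ))) z :=
    HasFDerivAt.const_add _ (HasFDerivAt.fun_sum fun i _ =>
      ((ContinuousLinearMap.proj i : (Fin n → ℂ) →L[ℝ] ℂ).hasFDerivAt).norm_sq)
  have hpos : (1 + ∑ i, ‖z i‖ ^ 2 : ℝ) ≠ 0 := by positivity
  have h := (hasDerivAt_zpow (-k) (1 + ∑ i, ‖z i‖ ^ 2 : ℝ) (Or.inl hpos)).comp_hasFDerivAt z hR
  have hm : metric n k = (fun x : ℝ => x ^ (-k)) ∘ fun z : Fin n → ℂ => 1 + ∑ i, ‖z i‖ ^ 2 := by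
    ext z
    simp [metric, zpow_neg]
  rw [hm]
  refine h.congr_fderiv ?_
  push_cast
  rfl

/-- The canonical connection of `h_k`, restricted to a torus, has the constant coefficients `k s_i`,
where `s` is the moment map. -/
theorem connectionForm_metric (k : ℤ) {y : Fin n → ℝ} {z : Fin n → ℂ}
    (hz : ∀ i, ‖z i‖ = Real.exp (y i)) (i : Fin n) :
    connectionForm (metric n k) z (Pi.single i (Complex.I * z i)) =
      ((k * moment y i : ℝ) : ℂ) := by
  have hR : (1 + ∑ i, ‖z i‖ ^ 2 : ℝ) = momentDenom y := by
    simp only [momentDenom, hz, ← Real.exp_nat_mul]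
    norm_num
  have hD := momentDenom_pos y
  have hv : ∀ w : ℂ, fderiv ℝ (metric n k) z (Pi.single i w) =
      (-(k : ℝ) * momentDenom y ^ (-k - 1)) * (2 * inner ℝ (z i) w) := by
    intro w
    rw [(hasFDerivAt_metric k z).fderiv, hR]
    simp only [smul_apply, sum_apply,
      ContinuousLinearMap.comp_apply, ContinuousLinearMap.proj_apply, smul_eq_mul]
    congr 1
    rw [Finset.sum_eq_single i]
    · simp
      ring
    · intro j _ hj
      simp [Pi.single_eq_of_ne hj]
    · simp
  have h1 : inner ℝ (z i) (Complex.I * z i) = 0 := by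
    simp [Complex.inner]
    ring
  have h2 : inner ℝ (z i) (Complex.I • (Complex.I * z i)) = -(Real.exp (2 * y i)) := by
    have : Complex.I • (Complex.I * z i) = -z i := by
      rw [smul_eq_mul, ← mul_assoc, Complex.I_mul_I]; ring
    rw [this, inner_neg_right, real_inner_self_eq_norm_sq, hz, ← Real.exp_nat_mul]
    norm_num
  have h3 : metric n k z = momentDenom y ^ (-k) := by
    rw [metric, hR, inv_zpow, zpow_neg]
  have h4 : Complex.I • (Pi.single i (Complex.I * z i) : Fin n → ℂ) =
      Pi.single i (Complex.I • (Complex.I * z i)) := by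
    rw [Pi.single_smul]
  rw [connectionForm, h4, hv, hv, h1, h2, h3]
  have h5 : momentDenom y ^ (-k - 1) = momentDenom y ^ (-k) / momentDenom y := by
    rw [zpow_sub_one₀ hD.ne', div_eq_mul_inv]
  have h6 : momentDenom y ^ (-k) ≠ 0 := zpow_ne_zero _ hD.ne'
  rw [h5]
  set a := momentDenom y ^ (-k) with ha
  have h6' : (a : ℂ) ≠ 0 := by exact_mod_cast h6
  have hD' : (momentDenom y : ℂ) ≠ 0 := by exact_mod_cast hD.ne'
  simp only [moment]
  push_cast
  field_simp
  ring_nf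
  simp

theorem lagr_eq_torusGraph (n : ℕ) (k : ℤ) :
    lagr n k = torusGraph 1 fun y => (k : ℝ) • moment y := by
  ext p
  simp only [lagr, Set.mem_ofPred_eq, mem_torusGraph]
  constructor
  · intro h
    ext i
    obtain ⟨c, hc, hp⟩ := h (fun i => (Real.exp (p.1 i) : ℂ))
      (fun i => by rw [Complex.norm_real, Real.norm_of_nonneg (Real.exp_pos _).le]) i
    rw [connectionForm_metric k (y := p.1)
      (fun i => by rw [Complex.norm_real, Real.norm_of_nonneg (Real.exp_pos _).le])] at hc
    rw [hp, Complex.ofReal_injective hc]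
    rfl
  · intro h z hz i
    exact ⟨k * moment p.1 i, (connectionForm_metric k hz i).symm, by rw [h]; rfl⟩

theorem contDiff_smul_moment (c : ℝ) : ContDiff ℝ ∞ fun y : Fin n → ℝ => c • moment y :=
  contDiff_moment.const_smul c

theorem isLagrangian_lagr (n : ℕ) (k : ℤ) : IsLagrangian (lagr n k) := by
  rw [lagr_eq_torusGraph]
  refine ⟨isSubmanifold_torusGraph le_rfl (contDiff_smul_moment _), fun x hx v hv w hw => ?_⟩
  rw [tangentSpace_torusGraph le_rfl (contDiff_smul_moment _).continuous hx
    ((hasFDerivAt_moment x.1).const_smul (k : ℝ))] at hv hw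
  obtain ⟨a, rfl⟩ := hv
  obtain ⟨b, rfl⟩ := hw
  have h := dotProduct_momentDeriv x.1 a b
  simp only [dotProduct] at h
  simp [omega]
  simp only [mul_left_comm (a _) (k : ℝ), mul_assoc (k : ℝ)]
  rw [← Finset.mul_sum, ← Finset.mul_sum, h, sub_self]

/-- A primitive of the Liouville form on the Lagrangian is
`(2π)^n k (∑ y_i s_i - ½ log(1 + ∑ exp(2 y_j)))`, where `s` is the moment map. -/
theorem isExactOn_lagr (n : ℕ) (k : ℤ) : IsExactOn (lagr n k) := by
  rw [lagr_eq_torusGraph]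
  refine ⟨fun p => (2 * Real.pi) ^ n * (∑ i, p.1 i * (k * moment p.1 i) -
    k * (1 / 2) * Real.log (momentDenom p.1)), fun x hx => ?_⟩
  have hF := (contDiff_smul_moment (n := n) (k : ℝ)).continuous
  have hev := eventually_mem_torusGraph_iff le_rfl hF hx
  -- On the Lagrangian, `k s` may be replaced by `γ - m` with a constant `m`; the resulting function
  -- has the Liouville form as its full derivative.
  let m : Fin n → ℝ := x.2 - (k : ℝ) • moment x.1
  have hG : HasFDerivAt (fun z : E n => (2 * Real.pi) ^ n * (∑ i, z.1 i * (z.2 i - m i) -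
      k * (1 / 2) * Real.log (momentDenom z.1))) (liouville x) x := by
    have h1 : ∀ i, HasFDerivAt (fun z : E n => z.1 i * (z.2 i - m i))
        (x.1 i • ((ContinuousLinearMap.proj i).comp (ContinuousLinearMap.snd ℝ _ _)) +
          (x.2 i - m i) • ((ContinuousLinearMap.proj i).comp (ContinuousLinearMap.fst ℝ _ _))) x :=
      fun i => ((ContinuousLinearMap.proj i).comp
          (ContinuousLinearMap.fst ℝ (Fin n → ℝ) (Fin n → ℝ))).hasFDerivAt.mul
        (((ContinuousLinearMap.proj i).comp
          (ContinuousLinearMap.snd ℝ (Fin n → ℝ) (Fin n → ℝ))).hasFDerivAt.sub_const (m i))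
    have h2 := (((hasFDerivAt_momentDenom x.1).comp x
      (hasFDerivAt_fst (𝕜 := ℝ) (p := x))).log (momentDenom_pos x.1).ne').const_mul
        ((k : ℝ) * (1 / 2))
    refine (((HasFDerivAt.fun_sum fun i (_ : i ∈ Finset.univ) => h1 i).sub h2).const_mul
      ((2 * Real.pi) ^ n)).congr_fderiv ?_
    ext v
    · have := (momentDenom_pos x.1).ne'
      simp [liouville, m, moment, Finset.mul_sum]
      rw [sub_eq_zero]
      refine Finset.sum_congr rfl fun i _ => ?_
      field_simp
    · simp [liouville]
  refine hG.hasFDerivWithinAt.congr_of_eventuallyEq ?_ ?_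
  · filter_upwards [mem_nhdsWithin_of_mem_nhds hev, self_mem_nhdsWithin] with z hz hz'
    have h := hz.1 hz'
    have h' : ∀ i, z.2 i - m i = k * moment z.1 i := fun i => by
      have := congrFun h i
      simp only [Pi.sub_apply, Pi.smul_apply, smul_eq_mul] at this
      simp only [m, Pi.sub_apply, Pi.smul_apply, smul_eq_mul]
      linarith
    simp [q, h']
  · simp [q, m]

end Moment

/-! ### Definability at infinity -/

open FirstOrder Set

section Definable

variable {α β : Type} {f g : (α → ℝ) → ℝ}

/-- Functions definable in `ℝ_{an,exp}` with real parameters. -/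
abbrev IsDef {α : Type} (f : (α → ℝ) → ℝ) : Prop := (univ : Set ℝ).DefinableFun anExp f

/-- Sets definable in `ℝ_{an,exp}` with real parameters. -/
abbrev IsDefSet {α : Type} (s : Set (α → ℝ)) : Prop := (univ : Set ℝ).Definable anExp s

theorem IsDef.add (hf : IsDef f) (hg : IsDef g) : IsDef fun v => f v + g v :=
  DefinableFun.comp (L := anExp) (g := fun v => ![f v, g v])
    (fun i => by fin_cases i <;> assumption)
    (DefinableFun.of_empty (DefinableFun.fun_symbol (L := anExp) (M := ℝ) (n := 2) AnExpFunc.add))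

theorem IsDef.mul (hf : IsDef f) (hg : IsDef g) : IsDef fun v => f v * g v :=
  DefinableFun.comp (L := anExp) (g := fun v => ![f v, g v])
    (fun i => by fin_cases i <;> assumption)
    (DefinableFun.of_empty (DefinableFun.fun_symbol (L := anExp) (M := ℝ) (n := 2) AnExpFunc.mul))

theorem IsDef.exp (hf : IsDef f) : IsDef fun v => Real.exp (f v) :=
  DefinableFun.comp (L := anExp) (g := fun v => ![f v]) (fun i => by fin_cases i; assumption)
    (DefinableFun.of_empty (DefinableFun.fun_symbol (L := anExp) (M := ℝ) (n := 1) AnExpFunc.exp))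

theorem isDef_const (c : ℝ) : IsDef fun _ : α → ℝ => c :=
  Language.definableFun_const _ _ (mem_univ c)

theorem isDef_coord (i : α) : IsDef fun v : α → ℝ => v i := DefinableFun.proj _

theorem IsDef.sub (hf : IsDef f) (hg : IsDef g) : IsDef fun v => f v - g v := by
  have := hf.add ((isDef_const (-1)).mul hg)
  simpa only [neg_one_mul, ← sub_eq_add_neg] using this

theorem IsDef.sum {ι : Type} (s : Finset ι) {f : ι → (α → ℝ) → ℝ} (hf : ∀ i, IsDef (f i)) :
    IsDef fun v => ∑ i ∈ s, f i v := by
  classical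
  induction s using Finset.induction_on with
  | empty => simpa using isDef_const 0
  | insert i s hi ih => simpa only [Finset.sum_insert hi] using (hf i).add ih

theorem IsDef.setOf_le (hf : IsDef f) (hg : IsDef g) : IsDefSet {v | f v ≤ g v} := by
  have h : IsDefSet {v : Fin 2 → ℝ | v 0 ≤ v 1} := by
    refine Definable.mono (A := ∅) ?_ (empty_subset _)
    rw [empty_definable_iff]
    exact ⟨Language.Relations.formula (L := anExp) (n := 2) AnExpRel.le ![.var 0, .var 1], by
      ext v
      rfl⟩
  exact Definable.preimage_map (L := anExp) (F := fun v => ![f v, g v])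
    (fun i => by fin_cases i <;> assumption) h

theorem IsDef.setOf_lt (hf : IsDef f) (hg : IsDef g) : IsDefSet {v | f v < g v} := by
  have := (hg.setOf_le hf).compl
  convert this using 1
  ext v
  simp

theorem IsDef.setOf_eq (hf : IsDef f) (hg : IsDef g) : IsDefSet {v | f v = g v} :=
  DefinableFun.ofPred_eq hf hg

theorem isDefSet_forall {ι : Type} [Finite ι] {p : ι → (α → ℝ) → Prop}
    (h : ∀ i, IsDefSet {v | p i v}) : IsDefSet {v | ∀ i, p i v} := by
  have : {v : α → ℝ | ∀ i, p i v} = ⋂ i, {v | p i v} := by ext; simp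
  rw [this]
  exact definable_iInter_of_finite h

theorem IsDef.comp_unary {u : ℝ → ℝ} (hu : IsDef fun v : Fin 1 → ℝ => u (v 0)) (hf : IsDef f) :
    IsDef fun v => u (f v) :=
  DefinableFun.comp (L := anExp) (g := fun v => ![f v]) (fun i => by fin_cases i; assumption) hu

/-- The junk value `0⁻¹ = 0` needs a clause of its own. -/
theorem IsDef.inv (hf : IsDef f) : IsDef fun v => (f v)⁻¹ := by
  refine IsDef.comp_unary (u := fun x => x⁻¹) ?_ hf
  have h1 : IsDefSet {w : Option (Fin 1) → ℝ | w (some 0) * w none = 1} :=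
    ((isDef_coord _).mul (isDef_coord _)).setOf_eq (isDef_const 1)
  have h2 : IsDefSet {w : Option (Fin 1) → ℝ | w (some 0) = 0} :=
    (isDef_coord _).setOf_eq (isDef_const 0)
  have h3 : IsDefSet {w : Option (Fin 1) → ℝ | w none = 0} :=
    (isDef_coord _).setOf_eq (isDef_const 0)
  have := h1.union (h2.inter h3)
  unfold IsDef DefinableFun
  convert this using 1
  ext w
  simp only [Function.tupleGraph, mem_ofPred_eq, mem_union, mem_inter_iff, Function.comp_apply]
  by_cases h : w (some 0) = 0
  · simp [h, eq_comm]
  · simp only [h, false_and, or_false]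
    exact inv_eq_iff_eq_inv.trans ⟨fun h' => by
      rw [h'] at h ⊢
      exact inv_mul_cancel₀ (by simpa using h), fun h' => eq_inv_of_mul_eq_one_left h'⟩

theorem IsDef.div (hf : IsDef f) (hg : IsDef g) : IsDef fun v => f v / g v := by
  simpa only [div_eq_mul_inv] using hf.mul hg.inv

/-- The junk value `√x = 0` for `x < 0` needs a clause of its own. -/
theorem IsDef.sqrt (hf : IsDef f) : IsDef fun v => Real.sqrt (f v) := by
  refine IsDef.comp_unary (u := Real.sqrt) ?_ hf
  have h1 : IsDefSet {w : Option (Fin 1) → ℝ | w none * w none = w (some 0)} :=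
    ((isDef_coord _).mul (isDef_coord _)).setOf_eq (isDef_coord _)
  have h2 : IsDefSet {w : Option (Fin 1) → ℝ | 0 ≤ w none} :=
    (isDef_const 0).setOf_le (isDef_coord _)
  have h3 : IsDefSet {w : Option (Fin 1) → ℝ | w (some 0) ≤ 0} :=
    (isDef_coord _).setOf_le (isDef_const 0)
  have h4 : IsDefSet {w : Option (Fin 1) → ℝ | w none = 0} :=
    (isDef_coord _).setOf_eq (isDef_const 0)
  have := (h1.inter h2).union (h3.inter h4)
  unfold IsDef DefinableFun
  convert this using 1
  ext w
  simp only [Function.tupleGraph, mem_ofPred_eq, mem_union, mem_inter_iff, Function.comp_apply]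
  constructor
  · intro h
    rcases le_total 0 (w (some 0)) with h0 | h0
    · left
      rw [← h]
      exact ⟨Real.mul_self_sqrt h0, Real.sqrt_nonneg _⟩
    · right
      exact ⟨h0, by rw [← h, Real.sqrt_eq_zero_of_nonpos h0]⟩
  · rintro (⟨h, h0⟩ | ⟨h, h0⟩)
    · rw [← h, Real.sqrt_mul_self h0]
    · rw [h0, Real.sqrt_eq_zero_of_nonpos h]

theorem IsDef.abs (hf : IsDef f) : IsDef fun v => |f v| := by
  simpa only [Real.sqrt_mul_self_eq_abs] using (hf.mul hf).sqrt

end Definable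

section Infinity

variable {n : ℕ}

theorem dist_coe_lt_iff (a b ε : ℝ) :
    dist (a : AddCircle ((1 : ℕ) : ℝ)) (b : AddCircle ((1 : ℕ) : ℝ)) < ε ↔
      |a - b - round (a - b)| < ε := by
  rw [dist_eq_norm, ← AddCircle.coe_sub, AddCircle.norm_eq]
  simp

/-- Only finitely many integers can be nearest to a difference of bounded numbers. Hence the
distance in the circle of bounded real numbers is definable, although the integers are not. -/
theorem dist_coe_lt_iff_exists {a b ε K : ℝ} (ha : a ∈ Set.Icc (0 : ℝ) 1) (hb : |b| ≤ K) :
    dist (a : AddCircle ((1 : ℕ) : ℝ)) (b : AddCircle ((1 : ℕ) : ℝ)) < ε ↔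
      ∃ m ∈ Finset.Icc (-⌈K + 2⌉) ⌈K + 2⌉, |a - b - (m : ℝ)| < ε := by
  rw [dist_coe_lt_iff]
  constructor
  · intro h
    refine ⟨round (a - b), ?_, h⟩
    have h1 := abs_le.1 (abs_sub_round (a - b))
    have h2 := abs_le.1 hb
    have h3 := Int.le_ceil (K + 2)
    rw [Finset.mem_Icc]
    constructor
    · have : ((-⌈K + 2⌉ : ℤ) : ℝ) ≤ (round (a - b) : ℤ) := by
        push_cast
        linarith [ha.1, h1.2]
      exact_mod_cast this
    · have : ((round (a - b) : ℤ) : ℝ) ≤ (⌈K + 2⌉ : ℤ) := by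
        linarith [ha.2, h1.1]
      exact_mod_cast this
  · rintro ⟨m, -, h⟩
    exact (round_le (a - b) m).trans_lt h

/-- The closure is described by `∀ ε > 0, ∃ y, …`, where the distance of the given point to the
point of the Lagrangian over `y` is a definable function of both. -/
theorem isDefinableAtInfinity_lagr (n : ℕ) (k : ℤ) : IsDefinableAtInfinity (lagr n k) := by
  -- the variables are the point `v` of the compactification, `ε`, and the fibre coordinate `y`
  let V : Type := (Fin n ⊕ Option (Fin n)) ⊕ Unit
  let W : Type := V ⊕ Fin n
  let Y : (W → ℝ) → Fin n → ℝ := fun w i => w (.inr i)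
  let R : (W → ℝ) → ℝ := fun w => Real.sqrt (1 + ∑ i, Y w i ^ 2)
  have hY : ∀ i, IsDef fun w => Y w i := fun i => isDef_coord _
  have hR : IsDef R := by
    refine IsDef.sqrt ((isDef_const 1).add (IsDef.sum _ fun i => ?_))
    simpa only [sq] using (hY i).mul (hY i)
  have hden : IsDef fun w => momentDenom (Y w) :=
    (isDef_const 1).add (IsDef.sum _ fun i => ((isDef_const 2).mul (hY i)).exp)
  have hmom : ∀ i, IsDef fun w => (k : ℝ) * moment (Y w) i := fun i =>
    (isDef_const _).mul ((((isDef_const 2).mul (hY i)).exp).div hden)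
  have hε : IsDef fun w : W → ℝ => w (.inl (.inr ())) := isDef_coord _
  have hm : ∀ (m : ℤ) (i : Fin n), IsDefSet {w : W → ℝ |
      |w (.inl (.inl (.inl i))) - k * moment (Y w) i - (m : ℝ)| < w (.inl (.inr ()))} :=
    fun m i => ((((isDef_coord _).sub (hmom i)).sub (isDef_const _)).abs).setOf_lt hε
  have hB : IsDefSet {w : W → ℝ |
      (∀ i, ∃ m ∈ Finset.Icc (-⌈|(k : ℝ)| + 2⌉) ⌈|(k : ℝ)| + 2⌉,
        |w (.inl (.inl (.inl i))) - k * moment (Y w) i - (m : ℝ)| < w (.inl (.inr ()))) ∧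
      |w (.inl (.inl (.inr none))) - (R w)⁻¹| < w (.inl (.inr ())) ∧
      ∀ i, |w (.inl (.inl (.inr (some i)))) - Y w i / R w| < w (.inl (.inr ()))} := by
    refine Definable.inter (isDefSet_forall fun i => ?_) (Definable.inter ?_ (isDefSet_forall
      fun i => ?_))
    · have := definable_biUnion_finset (hm · i) (Finset.Icc (-⌈|(k : ℝ)| + 2⌉) ⌈|(k : ℝ)| + 2⌉)
      convert this using 1
      ext w
      simp
    · exact (((isDef_coord _).sub hR.inv).abs).setOf_lt hε
    · exact (((isDef_coord _).sub ((hY i).div hR)).abs).setOf_lt hε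
  have hex := Definable.exists_of_finite (α := V) (β := Fin n) hB
  have hpos : IsDefSet {v : V → ℝ | v (.inr ()) ≤ 0} :=
    (isDef_coord _).setOf_le (isDef_const 0)
  have hall := Definable.forall_of_finite (α := Fin n ⊕ Option (Fin n)) (β := Unit)
    (hpos.union hex)
  have hbox : IsDefSet
      {v : Fin n ⊕ Option (Fin n) → ℝ | ∀ i, v (.inl i) ∈ Set.Icc (0 : ℝ) (1 : ℕ)} :=
    isDefSet_forall fun i => ((isDef_const 0).setOf_le (isDef_coord _)).inter
      ((isDef_coord _).setOf_le (isDef_const _))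
  have := hbox.inter hall
  unfold IsDefinableAtInfinity
  convert this using 1
  ext v
  simp only [mem_ofPred_eq, mem_inter_iff]
  refine and_congr_right fun hv => ?_
  rw [Metric.mem_closure_iff]
  have hdist : ∀ (ε : ℝ) (y : Fin n → ℝ), 0 < ε → (dist ((toTorus 1 fun i => v (.inl i),
      v (.inr none), fun i => v (.inr (some i))) :
        (Fin n → AddCircle ((1 : ℕ) : ℝ)) × ℝ × (Fin n → ℝ))
      (compactify (y, toTorus 1 ((k : ℝ) • moment y))) < ε ↔
      Sum.elim (Sum.elim v fun _ : Unit => ε) y ∈ {w : W → ℝ |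
      (∀ i, ∃ m ∈ Finset.Icc (-⌈|(k : ℝ)| + 2⌉) ⌈|(k : ℝ)| + 2⌉,
        |w (.inl (.inl (.inl i))) - k * moment (Y w) i - (m : ℝ)| < w (.inl (.inr ()))) ∧
      |w (.inl (.inl (.inr none))) - (R w)⁻¹| < w (.inl (.inr ())) ∧
      ∀ i, |w (.inl (.inl (.inr (some i)))) - Y w i / R w| < w (.inl (.inr ()))}) := by
    intro ε y hε
    simp only [compactify, Prod.dist_eq, max_lt_iff, dist_pi_lt_iff hε, Real.dist_eq, R, Y]
    refine and_congr_left fun _ => forall_congr' fun i => ?_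
    refine dist_coe_lt_iff_exists (by simpa using hv i) ?_
    rw [Pi.smul_apply, smul_eq_mul, abs_mul, abs_of_pos (moment_pos y i)]
    exact mul_le_of_le_one_right (abs_nonneg _) (moment_lt_one y i).le
  constructor
  · intro h u
    by_cases hu : u () ≤ 0
    · exact Or.inl hu
    · right
      obtain ⟨_, ⟨p, hp, rfl⟩, hd⟩ := h (u ()) (not_le.1 hu)
      rw [lagr_eq_torusGraph, mem_torusGraph] at hp
      rw [show p = (p.1, toTorus 1 ((k : ℝ) • moment p.1)) from Prod.ext rfl hp] at hd
      exact ⟨p.1, (hdist _ _ (not_le.1 hu)).1 hd⟩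
  · intro h ε hε
    rcases h fun _ => ε with h | ⟨y, hy⟩
    · exact absurd h (not_le.2 hε)
    · refine ⟨_, ⟨(y, toTorus 1 ((k : ℝ) • moment y)), ?_, rfl⟩, (hdist ε y hε).2 hy⟩
      rw [lagr_eq_torusGraph, mem_torusGraph]

end Infinity

theorem isFukayaLagrangian_lagr (n : ℕ) (k : ℤ) : IsFukayaLagrangian (lagr n k) where
  isClosed := by
    rw [lagr_eq_torusGraph]
    exact isClosed_torusGraph le_rfl (contDiff_smul_moment _).continuous
  isLagrangian := isLagrangian_lagr n k
  isExact := isExactOn_lagr n k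
  isDefinable := isDefinableAtInfinity_lagr n k

/-! ### Phases of Lagrangian planes -/

section Phase

variable {n : ℕ}

/-- The complex number `d` has squared phase `exp(2πia)`. -/
def SqPhaseEq (d : ℂ) (a : ℝ) : Prop :=
  (d / (‖d‖ : ℂ)) ^ 2 = Complex.exp (2 * Real.pi * Complex.I * a)

theorem SqPhaseEq.ne_zero {d : ℂ} {a : ℝ} (h : SqPhaseEq d a) : d ≠ 0 := by
  rintro rfl
  exact Complex.exp_ne_zero _ (by rw [← h]; simp)

theorem sqPhaseEq_mul_real (d : ℂ) {r : ℝ} (hr : r ≠ 0) (a : ℝ) :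
    SqPhaseEq (d * r) a ↔ SqPhaseEq d a := by
  have hr' : (r : ℂ) ≠ 0 := by exact_mod_cast hr
  have h2 : ((|r| : ℝ) : ℂ) ^ 2 = (r : ℂ) ^ 2 := by
    rw [← Complex.ofReal_pow, sq_abs, Complex.ofReal_pow]
  have h : (d * r / (‖d * r‖ : ℂ)) ^ 2 = (d / (‖d‖ : ℂ)) ^ 2 := by
    rw [norm_mul, Complex.norm_real, Real.norm_eq_abs, Complex.ofReal_mul, div_pow, div_pow,
      mul_pow, mul_pow, h2, mul_div_mul_right _ _ (pow_ne_zero 2 hr')]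
  rw [SqPhaseEq, SqPhaseEq, h]

theorem sqPhaseEq_real {r : ℝ} (hr : r ≠ 0) : SqPhaseEq r 0 := by
  have := (sqPhaseEq_mul_real 1 hr 0).2 (by simp [SqPhaseEq])
  rwa [one_mul] at this

theorem SqPhaseEq.exists_int {d : ℂ} {a b : ℝ} (ha : SqPhaseEq d a) (hb : SqPhaseEq d b) :
    ∃ m : ℤ, a - b = m := by
  obtain ⟨m, hm⟩ := Complex.exp_eq_exp_iff_exists_int.1 (ha.symm.trans hb)
  refine ⟨m, ?_⟩
  have h : (2 * Real.pi * Complex.I : ℂ) ≠ 0 := Complex.two_pi_I_ne_zero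
  have h2 : (2 * Real.pi * Complex.I : ℂ) * a = (2 * Real.pi * Complex.I) * (b + m) := by
    rw [hm]; ring
  have h3 := mul_left_cancel₀ h h2
  have h4 : a = b + m := by exact_mod_cast h3
  linarith

theorem SqPhaseEq.add_int {d : ℂ} {a : ℝ} (ha : SqPhaseEq d a) (m : ℤ) : SqPhaseEq d (a + m) := by
  rw [SqPhaseEq, ha]
  refine Complex.exp_eq_exp_iff_exists_int.2 ⟨-m, ?_⟩
  push_cast
  ring

/-- The determinant, in the complex coordinates `γ - iy`, of the images of the standard basis. -/
def complexDet (L : (Fin n → ℝ) →L[ℝ] E n) : ℂ :=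
  Matrix.det (Matrix.of fun i j : Fin n =>
    (((L (Pi.single j 1)).2 i : ℝ) : ℂ) - Complex.I * (((L (Pi.single j 1)).1 i : ℝ) : ℂ))

/-- The squared phase can be computed in any basis: a change of basis multiplies the determinant by
a nonzero real number. -/
theorem hasPhase_range_iff {L : (Fin n → ℝ) →L[ℝ] E n} (hL : Function.Injective L) (a : ℝ) :
    HasPhase L.range a ↔ SqPhaseEq (complexDet L) a := by
  let b₀ : Module.Basis (Fin n) ℝ L.range :=
    (Pi.basisFun ℝ (Fin n)).map (LinearEquiv.ofInjective (L : (Fin n → ℝ) →ₗ[ℝ] E n) hL)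
  have hb₀ : ∀ j, (b₀ j : E n) = L (Pi.single j 1) := fun j => by simp [b₀]
  have key : ∀ b : Module.Basis (Fin n) ℝ L.range, ∃ r : ℝ, r ≠ 0 ∧
      Matrix.det (Matrix.of fun i j : Fin n =>
        (((b j : E n).2 i : ℝ) : ℂ) - Complex.I * (((b j : E n).1 i : ℝ) : ℂ)) =
      complexDet L * r := by
    intro b
    refine ⟨(b₀.toMatrix b).det, ?_, ?_⟩
    · have := b₀.invertibleToMatrix b
      exact (Matrix.isUnit_det_of_invertible (b₀.toMatrix b)).ne_zero
    · have hdet : (((b₀.toMatrix b).det : ℝ) : ℂ) =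
          ((b₀.toMatrix b).map (Complex.ofRealHom : ℝ →+* ℂ)).det := by
        rw [← RingHom.mapMatrix_apply, ← RingHom.map_det]; rfl
      rw [hdet, complexDet, ← Matrix.det_mul]
      congr 1
      ext i j
      have hj : (b j : E n) = ∑ l, b₀.toMatrix b l j • L (Pi.single l 1) := by
        have h1 := congrArg (Subtype.val) (b₀.sum_toMatrix_smul_self b j)
        rw [AddSubmonoidClass.coe_finsetSum] at h1
        rw [← h1]
        exact Finset.sum_congr rfl fun l _ => by rw [← hb₀]; rfl
      rw [Matrix.mul_apply]
      simp only [Matrix.of_apply, Matrix.map_apply, hj, Prod.fst_sum, Prod.snd_sum,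
        Finset.sum_apply, Prod.smul_fst, Prod.smul_snd, Pi.smul_apply, smul_eq_mul,
        Complex.ofReal_sum, Complex.ofReal_mul, Complex.ofRealHom_eq_coe, Finset.mul_sum,
        ← Finset.sum_sub_distrib]
      exact Finset.sum_congr rfl fun l _ => by ring
  constructor
  · rintro ⟨b, hb⟩
    obtain ⟨r, hr, hbr⟩ := key b
    exact (sqPhaseEq_mul_real _ hr a).1 (by rw [← hbr]; exact hb)
  · intro h
    obtain ⟨r, hr, hbr⟩ := key b₀
    have := (sqPhaseEq_mul_real _ hr a).2 h
    rw [← hbr] at this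
    exact ⟨b₀, this⟩

/-- The parametrisation `v ↦ (c v, κ J(y) v)` of a Lagrangian plane by the derivative `J(y)` of the
moment map. The tangent planes of all Lagrangians in the isotopies have this form. -/
def planeMap (c κ : ℝ) (y : Fin n → ℝ) : (Fin n → ℝ) →L[ℝ] E n :=
  (c • ContinuousLinearMap.id ℝ (Fin n → ℝ)).prod (κ • momentDeriv y)

theorem planeMap_apply (c κ : ℝ) (y v : Fin n → ℝ) :
    planeMap c κ y v = (c • v, κ • momentDeriv y v) := rfl

theorem momentDeriv_injective (y : Fin n → ℝ) : Function.Injective (momentDeriv y) := by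
  obtain ⟨D, -, hD, -⟩ := exists_hasFDerivAt_logit y
  exact Function.LeftInverse.injective hD

theorem planeMap_injective {c κ : ℝ} (h : c ≠ 0 ∨ κ ≠ 0) (y : Fin n → ℝ) :
    Function.Injective (planeMap c κ y) := by
  intro v w hvw
  rw [planeMap_apply, planeMap_apply, Prod.mk.injEq] at hvw
  rcases h with h | h
  · exact smul_right_injective _ h hvw.1
  · exact momentDeriv_injective y (smul_right_injective _ h hvw.2)

theorem complexDet_planeMap (c κ : ℝ) (y : Fin n → ℝ) : complexDet (planeMap c κ y) =
    Matrix.det (Matrix.of fun i j : Fin n => ((κ * momentMatrix y i j : ℝ) : ℂ) -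
      Complex.I * ((c * (1 : Matrix (Fin n) (Fin n) ℝ) i j : ℝ) : ℂ)) := by
  unfold complexDet
  congr 1
  ext i j
  simp [planeMap_apply, ← momentMatrix_mulVec, Matrix.one_apply, Pi.single_apply]

/-- The determinant is that of `κ J - i c` with a symmetric real matrix `J`, which has no imaginary
eigenvalues other than `0`. -/
theorem complexDet_planeMap_ne_zero {c κ : ℝ} (h : c ≠ 0 ∨ κ ≠ 0) (y : Fin n → ℝ) :
    complexDet (planeMap c κ y) ≠ 0 := by
  rw [complexDet_planeMap]
  intro h0
  obtain ⟨v, hv, hv0⟩ := Matrix.exists_mulVec_eq_zero_iff.2 h0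
  let a : Fin n → ℝ := fun i => (v i).re
  let b : Fin n → ℝ := fun i => (v i).im
  have hi : ∀ i, (κ • momentDeriv y a + c • b) i = 0 ∧ (κ • momentDeriv y b - c • a) i = 0 := by
    intro i
    have := congrFun hv0 i
    simp only [Matrix.mulVec, dotProduct, Matrix.of_apply, Pi.zero_apply] at this
    have hre := congrArg Complex.re this
    have him := congrArg Complex.im this
    simp only [Complex.re_sum, Complex.im_sum, Complex.mul_re, Complex.mul_im, Complex.sub_re,
      Complex.sub_im, Complex.ofReal_re, Complex.ofReal_im, Complex.I_re, Complex.I_im,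
      Complex.zero_re, Complex.zero_im] at hre him
    simp only [← momentMatrix_mulVec, Pi.add_apply, Pi.sub_apply, Pi.smul_apply, Matrix.mulVec,
      dotProduct, smul_eq_mul, Finset.mul_sum]
    have hb : c * b i = ∑ j, c * (1 : Matrix (Fin n) (Fin n) ℝ) i j * b j := by
      simp [Matrix.one_apply]
    have ha : c * a i = ∑ j, c * (1 : Matrix (Fin n) (Fin n) ℝ) i j * a j := by
      simp [Matrix.one_apply]
    rw [ha, hb, ← Finset.sum_add_distrib, ← Finset.sum_sub_distrib]
    constructor
    · rw [← hre]; exact Finset.sum_congr rfl fun j _ => by ring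
    · rw [← him]; exact Finset.sum_congr rfl fun j _ => by ring
  have h1 : κ • momentDeriv y a = -(c • b) := eq_neg_of_add_eq_zero_left (funext fun i => (hi i).1)
  have h2 : κ • momentDeriv y b = c • a := sub_eq_zero.1 (funext fun i => (hi i).2)
  have h3 : c * (a ⬝ᵥ a + b ⬝ᵥ b) = 0 := by
    have := dotProduct_momentDeriv y a b
    have h4 : a ⬝ᵥ (κ • momentDeriv y b) = (κ • momentDeriv y a) ⬝ᵥ b := by
      rw [dotProduct_smul, smul_dotProduct, this]
    rw [h1, h2, dotProduct_smul, neg_dotProduct, smul_dotProduct, smul_eq_mul, smul_eq_mul] at h4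
    linarith
  have hab : a = 0 ∧ b = 0 := by
    rcases eq_or_ne c 0 with rfl | hc
    · have hκ := h.resolve_left (by simp)
      simp only [zero_smul, neg_zero, smul_eq_zero, hκ, false_or] at h1 h2
      exact ⟨momentDeriv_injective y (by rw [h1, map_zero]),
        momentDeriv_injective y (by rw [h2, map_zero])⟩
    · have h5 := (mul_eq_zero.1 h3).resolve_left hc
      have h6 : 0 ≤ a ⬝ᵥ a := Finset.sum_nonneg fun i _ => mul_self_nonneg _
      have h7 : 0 ≤ b ⬝ᵥ b := Finset.sum_nonneg fun i _ => mul_self_nonneg _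
      exact ⟨dotProduct_self_eq_zero.1 (by linarith), dotProduct_self_eq_zero.1 (by linarith)⟩
  exact hv (funext fun i => Complex.ext (congrFun hab.1 i) (congrFun hab.2 i))

theorem hasPhase_planeMap_iff {c κ : ℝ} (h : c ≠ 0 ∨ κ ≠ 0) (y : Fin n → ℝ) (a : ℝ) :
    HasPhase (planeMap c κ y).range a ↔ SqPhaseEq (complexDet (planeMap c κ y)) a :=
  hasPhase_range_iff (planeMap_injective h y) a

theorem continuous_complexDet_planeMap {c κ : ℝ → ℝ} (hc : Continuous c) (hκ : Continuous κ) :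
    Continuous fun x : ℝ × (Fin n → ℝ) => complexDet (planeMap (c x.1) (κ x.1) x.2) := by
  simp only [complexDet_planeMap]
  refine Continuous.matrix_det (continuous_matrix fun i j => ?_)
  have h := (continuous_momentMatrix (n := n)).matrix_elem i j
  simp only [Matrix.of_apply]
  fun_prop

/-- The zero section has phase `0`. -/
theorem SqPhaseEq.complexDet_zero {κ : ℝ} (hκ : κ ≠ 0) (y : Fin n → ℝ) :
    SqPhaseEq (complexDet (planeMap 0 κ y)) 0 := by
  have h : complexDet (planeMap 0 κ y) = ((κ • momentMatrix y).det : ℝ) := by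
    rw [complexDet_planeMap]
    have : (((κ • momentMatrix y).det : ℝ) : ℂ) =
        ((κ • momentMatrix y).map (Complex.ofRealHom : ℝ →+* ℂ)).det := by
      rw [← RingHom.mapMatrix_apply, ← RingHom.map_det]; rfl
    rw [this]
    congr 1
    ext i j
    simp
  have hd := complexDet_planeMap_ne_zero (n := n) (c := 0) (Or.inr hκ) y
  rw [h] at hd ⊢
  exact sqPhaseEq_real (by exact_mod_cast hd)

/-- A nowhere vanishing function on a simply connected space has a continuous squared phase. -/
theorem exists_continuous_sqPhase {X : Type*} [TopologicalSpace X] [SimplyConnectedSpace X]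
    [LocallyPathConnectedSpace X] {d : X → ℂ} (hd : Continuous d) (h0 : ∀ x, d x ≠ 0) :
    ∃ θ : X → ℝ, Continuous θ ∧ ∀ x, SqPhaseEq (d x) (θ x) := by
  have hcirc : ∀ x, (d x / (‖d x‖ : ℂ)) ^ 2 ∈ Submonoid.unitSphere ℂ := by
    intro x
    rw [Submonoid.unitSphere, ← Submonoid.mem_carrier, mem_sphere_zero_iff_norm, norm_pow,
      norm_div, Complex.norm_real, norm_norm, div_self (norm_ne_zero_iff.2 (h0 x)), one_pow]
  have hcont : Continuous fun x => (d x / (‖d x‖ : ℂ)) ^ 2 :=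
    (hd.div (Complex.continuous_ofReal.comp hd.norm)
      (fun x => by simpa using h0 x)).pow 2
  let f : C(X, Circle) := ⟨fun x => ⟨_, hcirc x⟩, hcont.subtype_mk _⟩
  obtain ⟨x₀⟩ : Nonempty X := inferInstance
  obtain ⟨e₀, he₀⟩ := Circle.exp_surjective (f x₀)
  obtain ⟨F, ⟨-, hF⟩, -⟩ := Circle.isCoveringMap_exp.existsUnique_continuousMap_lifts f x₀ e₀ he₀
  refine ⟨fun x => F x / (2 * Real.pi), F.continuous.div_const _, fun x => ?_⟩
  have h1 := congrArg (fun c : Circle => (c : ℂ)) (congrFun hF x)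
  have h2 : Complex.exp (F x * Complex.I) = (d x / (‖d x‖ : ℂ)) ^ 2 := by
    rw [← Circle.coe_exp]; exact h1
  rw [SqPhaseEq, ← h2]
  congr 1
  have : (Real.pi : ℂ) ≠ 0 := by exact_mod_cast Real.pi_ne_zero
  push_cast
  field_simp

/-- A continuous function with integral values is constant on a connected set. It is applied to the
difference of two lifts of a phase. -/
theorem eq_of_continuousOn_int {X : Type*} [TopologicalSpace X] {s : Set X} (hs : IsPreconnected s)
    {f : X → ℝ} (hf : ContinuousOn f s) (hint : ∀ x ∈ s, ∃ m : ℤ, f x = m) {x y : X} (hx : x ∈ s)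
    (hy : y ∈ s) : f x = f y := by
  have : DiscreteTopology (Set.range ((↑) : ℤ → ℝ)) :=
    Int.isClosedEmbedding_coe_real.isEmbedding.toHomeomorph.symm.isEmbedding.discreteTopology
  exact hs.constant_of_mapsTo (T := Set.range ((↑) : ℤ → ℝ)) ⟨this⟩ hf
    (fun z hz => (hint z hz).imp fun _ h => h.symm) hx hy

/-- The phases of the planes `{((1 - t) v, κ J(y) v)}` have a continuous lift that vanishes at `t
= 1`, where the plane is horizontal. -/
theorem exists_phase_to_zeroSection (n : ℕ) {κ : ℝ} (hκ : κ ≠ 0) :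
    ∃ θ : ℝ × (Fin n → ℝ) → ℝ, Continuous θ ∧
      (∀ t y, SqPhaseEq (complexDet (planeMap (1 - t) κ y)) (θ (t, y))) ∧ ∀ y, θ (1, y) = 0 := by
  obtain ⟨θ, hθ, hph⟩ := exists_continuous_sqPhase
    (continuous_complexDet_planeMap (n := n) (c := fun t => 1 - t) (κ := fun _ => κ)
      (by fun_prop) (by fun_prop))
    (fun x => complexDet_planeMap_ne_zero (Or.inr hκ) x.2)
  have hph' : ∀ t y, SqPhaseEq (complexDet (planeMap (1 - t) κ y)) (θ (t, y)) :=
    fun t y => hph (t, y)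
  have hint : ∀ y : Fin n → ℝ, ∃ m : ℤ, θ (1, y) = m := fun y => by
    have h1 := hph' 1 y
    rw [sub_self] at h1
    simpa using h1.exists_int (SqPhaseEq.complexDet_zero hκ y)
  obtain ⟨m, hm⟩ := hint 0
  refine ⟨fun x => θ x - m, by fun_prop, fun t y => ?_, fun y => ?_⟩
  · have := (hph' t y).add_int (-m)
    push_cast at this
    rwa [← sub_eq_add_neg] at this
  · rw [sub_eq_zero, ← hm]
    exact eq_of_continuousOn_int isPreconnected_univ (f := fun y => θ (1, y))
      (by fun_prop) (fun y _ => hint y) trivial trivial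

/-- The phases of the planes `{(v, -t J(y) v)}` have a continuous lift with prescribed values at `t
= 1`. -/
theorem exists_phase_from_fibre {β : (Fin n → ℝ) → ℝ} (hβ : Continuous β)
    (hβ' : ∀ y, SqPhaseEq (complexDet (planeMap 1 (-1) y)) (β y)) :
    ∃ θ : ℝ × (Fin n → ℝ) → ℝ, Continuous θ ∧
      (∀ t y, SqPhaseEq (complexDet (planeMap 1 (-t) y)) (θ (t, y))) ∧ ∀ y, θ (1, y) = β y := by
  obtain ⟨θ, hθ, hph⟩ := exists_continuous_sqPhase
    (continuous_complexDet_planeMap (n := n) (c := fun _ => 1) (κ := fun t => -t)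
      (by fun_prop) (by fun_prop))
    (fun x => complexDet_planeMap_ne_zero (Or.inl one_ne_zero) x.2)
  have hph' : ∀ t y, SqPhaseEq (complexDet (planeMap 1 (-t) y)) (θ (t, y)) :=
    fun t y => hph (t, y)
  have hint : ∀ y : Fin n → ℝ, ∃ m : ℤ, θ (1, y) - β y = m := fun y =>
    (hph' 1 y).exists_int (hβ' y)
  obtain ⟨m, hm⟩ := hint 0
  refine ⟨fun x => θ x - m, by fun_prop, fun t y => ?_, fun y => ?_⟩
  · have := (hph' t y).add_int (-m)
    push_cast at this
    rwa [← sub_eq_add_neg] at this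
  · have := eq_of_continuousOn_int isPreconnected_univ (f := fun y => θ (1, y) - β y)
      (by fun_prop) (fun y _ => hint y) (x := y) (y := 0) trivial trivial
    dsimp only at this ⊢
    linarith

end Phase

/-! ### Cells and their primitives -/

section Cell

variable {N n : ℕ} {k : ℤ} {a : Fin n → ℤ}

/-- The point of the cell that lies over the fibre coordinate `y`. -/
def cellPoint (k : ℤ) (a : Fin n → ℤ) (y : Fin n → ℝ) : Fin n → ℝ := fun i => k * moment y i + a i

/-- The gradient of the primitive on the cell. -/
def cellGrad (k : ℤ) (a : Fin n → ℤ) (g : Fin n → ℝ) : Fin n → ℝ :=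
  logit fun i => (g i - a i) / k

theorem mem_cell_iff {g : Fin n → ℝ} :
    g ∈ cell k a ↔ (fun i => (g i - a i) / (k : ℝ)) ∈ openSimplex n := Iff.rfl

theorem cellPoint_rescale (hk : k ≠ 0) (y : Fin n → ℝ) :
    (fun i => (cellPoint k a y i - a i) / (k : ℝ)) = moment y := by
  have : (k : ℝ) ≠ 0 := by exact_mod_cast hk
  ext i
  simp only [cellPoint]
  field_simp
  ring

theorem cellPoint_mem (hk : k ≠ 0) (y : Fin n → ℝ) : cellPoint k a y ∈ cell k a := by
  rw [mem_cell_iff, cellPoint_rescale hk]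
  exact moment_mem_openSimplex y

theorem cellGrad_cellPoint (hk : k ≠ 0) (y : Fin n → ℝ) : cellGrad k a (cellPoint k a y) = y := by
  rw [cellGrad, cellPoint_rescale hk, logit_moment]

theorem cellPoint_cellGrad (hk : k ≠ 0) {g : Fin n → ℝ} (hg : g ∈ cell k a) :
    cellPoint k a (cellGrad k a g) = g := by
  have : (k : ℝ) ≠ 0 := by exact_mod_cast hk
  ext i
  rw [cellPoint, cellGrad, moment_logit (mem_cell_iff.1 hg)]
  field_simp
  ring

theorem contDiff_cellPoint : ContDiff ℝ ∞ (cellPoint k a) :=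
  contDiff_pi.2 fun i => (contDiff_const.mul (contDiff_pi.1 contDiff_moment i)).add contDiff_const

theorem hasFDerivAt_cellPoint (y : Fin n → ℝ) :
    HasFDerivAt (cellPoint k a) ((k : ℝ) • momentDeriv y) y :=
  ((hasFDerivAt_moment y).const_smul (k : ℝ)).add_const (fun i => (a i : ℝ))

theorem isOpen_cell : IsOpen (cell k a) :=
  isOpen_openSimplex.preimage (f := fun (g : Fin n → ℝ) i => (g i - a i) / (k : ℝ)) (by fun_prop)

theorem abs_rescale_sub_lt {u v : Fin n → ℝ} (hu : u ∈ openSimplex n) (hv : v ∈ openSimplex n)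
    (i : Fin n) : |u i - v i| < 1 := by
  have h : ∀ w ∈ openSimplex n, w i < 1 := fun w hw =>
    (Finset.single_le_sum (fun j _ => (hw.1 j).le) (Finset.mem_univ i)).trans_lt hw.2
  rw [abs_lt]
  constructor <;> linarith [h u hu, h v hv, hu.1 i, hv.1 i]

/-- The translates of the cell by the lattice are disjoint as soon as `N ≥ |k|`. -/
theorem eq_zero_of_mem_cell (hk : k ≠ 0) (hN : |k| ≤ N) {g g' : Fin n → ℝ} (hg : g ∈ cell k a)
    (hg' : g' ∈ cell k a) {m : Fin n → ℤ} (h : ∀ i, g i = g' i + m i * N) : m = 0 := by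
  ext i
  by_contra hm
  have hk' : (0 : ℝ) < |(k : ℝ)| := abs_pos.2 (by exact_mod_cast hk)
  have h1 := abs_rescale_sub_lt (mem_cell_iff.1 hg) (mem_cell_iff.1 hg') i
  have h2 : (g i - a i) / (k : ℝ) - (g' i - a i) / k = m i * N / k := by
    rw [h]; ring
  rw [h2, abs_div, div_lt_one hk', abs_mul, Nat.abs_cast] at h1
  have h3 : |(k : ℝ)| ≤ N := by exact_mod_cast hN
  have h4 : (1 : ℝ) ≤ |(m i : ℝ)| := by exact_mod_cast Int.one_le_abs hm
  nlinarith

theorem one_le_of_abs_le (hk : k ≠ 0) (hN : |k| ≤ N) : 1 ≤ N := by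
  have := Int.one_le_abs hk
  omega

theorem injOn_toTorus_cell (hk : k ≠ 0) (hN : |k| ≤ N) :
    Set.InjOn (toTorus N) (cell k a) := by
  intro g hg g' hg' h
  obtain ⟨m, hm⟩ := toTorus_eq_iff.1 h
  have := eq_zero_of_mem_cell hk hN hg hg' hm
  ext i
  rw [hm, this]
  simp

/-- The negative entropy of a point of the simplex. -/
def negEntropy (u : Fin n → ℝ) : ℝ :=
  ∑ i, u i * Real.log (u i) + (1 - ∑ i, u i) * Real.log (1 - ∑ i, u i)

/-- The function `f_k^a` is `k/2` times the negative entropy of the simplex, in rescaled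
coordinates. -/
theorem primitive_eq_negEntropy (g : Fin n → ℝ) :
    primitive k a g = k / 2 * negEntropy fun i => (g i - a i) / (k : ℝ) := by
  simp only [primitive, basePrimitive, negEntropy, div_neg, neg_neg, Finset.sum_neg_distrib,
    neg_mul, ← sub_eq_add_neg]
  ring

/-- The moment map is inverse to the gradient of half the negative entropy. -/
theorem hasFDerivAt_negEntropy {u : Fin n → ℝ} (hu : u ∈ openSimplex n) :
    HasFDerivAt negEntropy
      (∑ i, (2 * logit u i) • (ContinuousLinearMap.proj i : (Fin n → ℝ) →L[ℝ] ℝ)) u := by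
  have h1 : 1 - ∑ j, u j ≠ 0 := by linarith [hu.2]
  have hsum : HasFDerivAt (fun u : Fin n → ℝ => 1 - ∑ i, u i)
      (-∑ i, (ContinuousLinearMap.proj i : (Fin n → ℝ) →L[ℝ] ℝ)) u :=
    (HasFDerivAt.fun_sum fun i _ =>
      (ContinuousLinearMap.proj i : (Fin n → ℝ) →L[ℝ] ℝ).hasFDerivAt).const_sub 1
  have h2 := (Real.hasDerivAt_mul_log h1).comp_hasFDerivAt u hsum
  have h3 : ∀ i, HasFDerivAt (fun u : Fin n → ℝ => u i * Real.log (u i))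
      ((Real.log (u i) + 1) • (ContinuousLinearMap.proj i : (Fin n → ℝ) →L[ℝ] ℝ)) u := fun i =>
    (Real.hasDerivAt_mul_log (hu.1 i).ne').comp_hasFDerivAt (h₂ := fun x => x * Real.log x) u
      (ContinuousLinearMap.proj i : (Fin n → ℝ) →L[ℝ] ℝ).hasFDerivAt
  refine ((HasFDerivAt.fun_sum fun i (_ : i ∈ Finset.univ) => h3 i).add h2).congr_fderiv ?_
  rw [smul_neg, Finset.smul_sum, ← sub_eq_add_neg, ← Finset.sum_sub_distrib]
  refine Finset.sum_congr rfl fun i _ => ?_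
  rw [← sub_smul, logit, Real.log_div (hu.1 i).ne' h1]
  congr 1
  ring

theorem hasFDerivAt_rescale (g : Fin n → ℝ) :
    HasFDerivAt (fun (g : Fin n → ℝ) i => (g i - a i) / (k : ℝ))
      ((k : ℝ)⁻¹ • ContinuousLinearMap.id ℝ (Fin n → ℝ)) g := by
  have := ((hasFDerivAt_id (𝕜 := ℝ) g).sub_const (fun i => (a i : ℝ))).const_smul (k : ℝ)⁻¹
  refine this.congr_of_eventuallyEq (Eventually.of_forall fun g => ?_)
  ext i
  simp [div_eq_inv_mul]

theorem hasFDerivAt_primitive (hk : k ≠ 0) {g : Fin n → ℝ} (hg : g ∈ cell k a) :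
    HasFDerivAt (primitive k a)
      (∑ i, cellGrad k a g i • (ContinuousLinearMap.proj i : (Fin n → ℝ) →L[ℝ] ℝ)) g := by
  have hk' : (k : ℝ) ≠ 0 := by exact_mod_cast hk
  have h := ((hasFDerivAt_negEntropy (mem_cell_iff.1 hg)).comp g
    (hasFDerivAt_rescale (k := k) (a := a) g)).const_mul ((k : ℝ) / 2)
  have he : primitive k a = fun g => k / 2 * (negEntropy ∘ fun (g : Fin n → ℝ) i =>
      (g i - a i) / (k : ℝ)) g := funext primitive_eq_negEntropy
  rw [he]
  refine h.congr_fderiv ?_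
  ext v
  simp [cellGrad, Finset.mul_sum]
  field_simp

theorem contDiffAt_primitive {g : Fin n → ℝ} (hg : g ∈ cell k a) :
    ContDiffAt ℝ ∞ (primitive k a) g := by
  have he : primitive k a = fun g => k / 2 * negEntropy fun i => (g i - a i) / (k : ℝ) :=
    funext primitive_eq_negEntropy
  have h1 : (1 : ℝ) - ∑ j, (g j - a j) / (k : ℝ) ≠ 0 := by linarith [hg.2]
  have h2 : ContDiffAt ℝ ∞ (fun g : Fin n → ℝ => 1 - ∑ j, (g j - a j) / (k : ℝ)) g := by fun_prop
  rw [he]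
  unfold negEntropy
  refine contDiffAt_const.mul (ContDiffAt.add (ContDiffAt.sum fun i _ => ?_) (h2.mul (h2.log h1)))
  have h3 : ContDiffAt ℝ ∞ (fun g : Fin n → ℝ => (g i - a i) / (k : ℝ)) g := by fun_prop
  exact h3.mul (h3.log (hg.1 i).ne')

/-- The graph of `df_k^a` is parametrised by the fibre coordinate, through the moment map. -/
theorem mem_cellGraph_iff (hk : k ≠ 0) {p : CotTorus N n} :
    p ∈ cellGraph N k a ↔ ∃ y, p = q N (y, cellPoint k a y) := by
  constructor
  · rintro ⟨x, ⟨hx, hd⟩, rfl⟩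
    have h := hd.unique (hasFDerivAt_primitive hk hx)
    have hy : x.1 = cellGrad k a x.2 := by
      ext i
      have := congrArg (fun f : (Fin n → ℝ) →L[ℝ] ℝ => f (Pi.single i 1)) h
      simpa [Pi.single_apply] using this
    refine ⟨x.1, ?_⟩
    rw [hy, cellPoint_cellGrad hk hx, ← hy]
  · rintro ⟨y, rfl⟩
    refine ⟨_, ⟨cellPoint_mem hk y, ?_⟩, rfl⟩
    have := hasFDerivAt_primitive hk (cellPoint_mem (a := a) hk y)
    rwa [cellGrad_cellPoint hk] at this

/-- The multiple of the graph over the cell by the constant `c`. -/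
def scaledGraph (N : ℕ) (k : ℤ) (a : Fin n → ℤ) (c : ℝ) : Set (CotTorus N n) :=
  (fun p : CotTorus N n => (c • p.1, p.2)) '' cellGraph N k a

theorem mem_scaledGraph_iff (hk : k ≠ 0) {c : ℝ} {p : CotTorus N n} :
    p ∈ scaledGraph N k a c ↔ ∃ y, p = q N (c • y, cellPoint k a y) := by
  constructor
  · rintro ⟨p, hp, rfl⟩
    obtain ⟨y, rfl⟩ := (mem_cellGraph_iff hk).1 hp
    exact ⟨y, rfl⟩
  · rintro ⟨y, rfl⟩
    exact ⟨_, (mem_cellGraph_iff hk).2 ⟨y, rfl⟩, rfl⟩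

/-- For `c = 0` the fibre coordinate is no longer a coordinate on the scaled graph; as a graph over
the cell it is cut out by the equation `z.1 = c df(z.2)` for every `c`. -/
theorem tangentSpace_scaledGraph (hk : k ≠ 0) (hN : |k| ≤ N) {c : ℝ} {y : Fin n → ℝ} {x : E n}
    (hx : q N x = q N (c • y, cellPoint k a y)) :
    tangentSpace (scaledGraph N k a c) x = (planeMap c k y).range := by
  have hk' : (k : ℝ) ≠ 0 := by exact_mod_cast hk
  have hx1 : x.1 = c • y := congrArg Prod.fst hx
  obtain ⟨m, hm⟩ := toTorus_eq_iff.1 (congrArg Prod.snd hx)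
  let l : Fin n → ℝ := fun i => m i * N
  have hx2 : x.2 = cellPoint k a y + l := funext hm
  obtain ⟨D, hD, -, hJD⟩ := exists_hasFDerivAt_logit y
  have hY : HasFDerivAt (cellGrad k a) (D.comp ((k : ℝ)⁻¹ • ContinuousLinearMap.id ℝ (Fin n → ℝ)))
      (cellPoint k a y) := by
    refine HasFDerivAt.comp (g := logit) _ ?_ (hasFDerivAt_rescale (cellPoint k a y))
    rw [cellPoint_rescale hk]
    exact hD
  have hsub : HasFDerivAt (fun z : E n => z.2 - l) (ContinuousLinearMap.snd ℝ _ _) x :=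
    hasFDerivAt_snd.sub_const l
  refine tangentSpace_eq_range (ψ := fun y => (c • y, cellPoint k a y + l))
    (G := fun z => z.1 - c • cellGrad k a (z.2 - l)) (y := y)
    (((hasFDerivAt_id y).const_smul c).prodMk ((hasFDerivAt_cellPoint y).add_const l)) ?_ ?_
    (hasFDerivAt_fst.sub (HasFDerivAt.const_smul (HasFDerivAt.comp x (g := cellGrad k a)
      (by rw [hx2, add_sub_cancel_right]; exact hY) hsub) c)) ?_ ?_
  · exact Prod.ext hx1.symm hx2.symm
  · intro z
    refine (mem_scaledGraph_iff hk).2 ⟨z, Prod.ext rfl (toTorus_eq_iff.2 ⟨m, fun i => rfl⟩)⟩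
  · have hcont : Continuous fun z : E n => z.2 - l := by fun_prop
    have hmem : ∀ᶠ z : E n in 𝓝 x, z.2 - l ∈ cell k a :=
      hcont.continuousAt.eventually_mem (isOpen_cell.mem_nhds (by
        rw [hx2, add_sub_cancel_right]; exact cellPoint_mem hk y))
    filter_upwards [hmem] with z hz hzS
    obtain ⟨y', hy'⟩ := (mem_scaledGraph_iff hk).1 hzS
    have h1 : z.1 = c • y' := congrArg Prod.fst hy'
    obtain ⟨m', hm'⟩ := toTorus_eq_iff.1 (congrArg Prod.snd hy')
    -- the cell and its translates are disjoint, so `z` lies on the sheet of `x`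
    have h2 : m' - m = 0 := eq_zero_of_mem_cell hk hN hz (cellPoint_mem hk y') fun i => by
      have := hm' i
      simp only [Pi.sub_apply, l] at this ⊢
      push_cast
      rw [this]
      ring
    have h3 : z.2 - l = cellPoint k a y' := by
      ext i
      have := hm' i
      rw [sub_eq_zero.1 h2] at this
      simp only [Pi.sub_apply, l] at this ⊢
      rw [this]
      ring
    rw [h3, cellGrad_cellPoint hk, h1, sub_self]
  · intro v hv
    refine ⟨(k : ℝ)⁻¹ • D v.2, ?_⟩
    have hv' : v.1 = c • D ((k : ℝ)⁻¹ • v.2) := sub_eq_zero.1 hv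
    rw [planeMap_apply, map_smul, hJD, smul_inv_smul₀ hk']
    exact Prod.ext (by rw [hv', map_smul]) rfl

theorem scaledGraph_one : scaledGraph N k a 1 = cellGraph N k a := by
  simp [scaledGraph]

theorem scaledGraph_zero (hk : k ≠ 0) : scaledGraph N k a 0 = zeroSection N k a := by
  ext p
  rw [mem_scaledGraph_iff hk]
  constructor
  · rintro ⟨y, rfl⟩
    exact ⟨_, ⟨cellPoint_mem hk y, zero_smul _ _⟩, rfl⟩
  · rintro ⟨x, ⟨hx, hx1⟩, rfl⟩
    refine ⟨cellGrad k a x.2, ?_⟩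
    rw [cellPoint_cellGrad hk hx, zero_smul, ← hx1]

/-! ### Hamiltonian flows -/

theorem omega_apply (v w : E n) :
    omega v w = (2 * Real.pi) ^ n * ∑ i, (v.1 i * w.2 i - v.2 i * w.1 i) := by
  simp [omega]

theorem omega_injective : Function.Injective (omega (n := n)) := by
  intro v w h
  have hpi : ((2 * Real.pi) ^ n : ℝ) ≠ 0 := by positivity
  have key : ∀ z : E n, ∑ i, (v.1 i * z.2 i - v.2 i * z.1 i) =
      ∑ i, (w.1 i * z.2 i - w.2 i * z.1 i) := fun z => by
    have := congrArg (fun f : E n →L[ℝ] ℝ => f z) h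
    simp only [omega_apply] at this
    exact mul_left_cancel₀ hpi this
  refine Prod.ext (funext fun i => ?_) (funext fun i => ?_)
  · simpa [Pi.single_apply] using key (0, Pi.single i 1)
  · simpa [Pi.single_apply] using key (Pi.single i 1, 0)

/-- If the vector field `X` of a Hamiltonian flow is known, the flow lines satisfy its equation. -/
theorem IsHamiltonianFlowOn.hasDerivAt {W : Set (CotTorus N n)} {H : CotTorus N n → ℝ}
    {φ : ℝ → CotTorus N n → CotTorus N n} (h : IsHamiltonianFlowOn W H φ) {X : E n → E n}
    (hX : ∀ x, q N x ∈ W → HasFDerivAt (H ∘ q N) (-omega (X x)) x) {x : E n} (hx : q N x ∈ W) :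
    ∃ c : ℝ → E n, c 0 = x ∧ ∀ t, q N (c t) = φ t (q N x) ∧ q N (c t) ∈ W ∧
      HasDerivAt c (X (c t)) t := by
  obtain ⟨-, -, Φ, hΦ⟩ := h
  refine ⟨fun t => Φ t x, (hΦ x hx).1, fun t => ?_⟩
  obtain ⟨h1, h2, Y, hY1, hY2⟩ := (hΦ x hx).2 t
  have h3 : q N (Φ t x) ∈ W := by rw [h1]; exact h2
  have h4 : Y = X (Φ t x) := omega_injective (neg_injective (hY2.unique (hX _ h3)))
  exact ⟨h1, h3, h4 ▸ hY1⟩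

theorem eq_of_hasDerivAt_zero {F : Type*} [NormedAddCommGroup F] [NormedSpace ℝ F] {f : ℝ → F}
    (h : ∀ t, HasDerivAt f 0 t) (t : ℝ) : f t = f 0 :=
  is_const_of_deriv_eq_zero (fun s => (h s).differentiableAt) (fun s => (h s).deriv) t 0

theorem eq_of_hasDerivAt_const {F : Type*} [NormedAddCommGroup F] [NormedSpace ℝ F] {f : ℝ → F}
    {v : F} (h : ∀ t, HasDerivAt f v t) (t : ℝ) : f t = f 0 + t • v := by
  have h1 : ∀ t, HasDerivAt (fun s : ℝ => f s - s • v) 0 t := fun t => by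
    have := (h t).fun_sub ((hasDerivAt_id t).smul_const v)
    simpa using this
  have h2 := eq_of_hasDerivAt_zero h1 t
  simp only [zero_smul, sub_zero] at h2
  rw [← h2, sub_add_cancel]

theorem q_mem_overCell_iff {x : E n} :
    q N x ∈ overCell N k a ↔ ∃ m : Fin n → ℤ, (fun i => x.2 i - m i * N) ∈ cell k a := by
  constructor
  · rintro ⟨x', hx', h⟩
    obtain ⟨m, hm⟩ := toTorus_eq_iff.1 (congrArg Prod.snd h.symm)
    refine ⟨m, ?_⟩
    have h2 : (fun i => x.2 i - m i * (N : ℝ)) = x'.2 := funext fun i => by rw [hm]; ring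
    rw [h2]
    exact hx'
  · rintro ⟨m, hm⟩
    exact ⟨(x.1, fun i => x.2 i - m i * N), hm,
      Prod.ext rfl (toTorus_eq_iff.2 ⟨-m, fun i => by simp [sub_eq_add_neg]⟩)⟩

theorem isOpen_overCell : IsOpen (overCell N k a) := by
  have h1 : IsOpenMap (toTorus N (n := n)) :=
    IsOpenMap.piMap (f := fun _ : Fin n => ((↑) : ℝ → AddCircle (N : ℝ)))
      (fun _ => QuotientAddGroup.isOpenMap_coe)
      (Eventually.of_forall fun _ => QuotientAddGroup.mk_surjective)
  have h2 : overCell N k a = Prod.snd ⁻¹' (toTorus N '' cell k a) := by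
    ext p
    constructor
    · rintro ⟨x, hx, rfl⟩
      exact ⟨x.2, hx, rfl⟩
    · rintro ⟨g, hg, h⟩
      exact ⟨(p.1, g), hg, Prod.ext rfl h⟩
  rw [h2]
  exact (h1 _ isOpen_cell).preimage continuous_snd

/-- The Hamiltonian is prescribed over the cell only; near a point over a translate of the cell it
is the translate of the primitive. -/
theorem hamiltonian_eventuallyEq {H : CotTorus N n → ℝ}
    (hH : ∀ x : E n, x.2 ∈ cell k a → H (q N x) = (2 * Real.pi) ^ n * primitive k a x.2)
    {x : E n} {m : Fin n → ℤ} (hm : (fun i => x.2 i - m i * N) ∈ cell k a) :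
    H ∘ q N =ᶠ[𝓝 x] fun z => (2 * Real.pi) ^ n * primitive k a fun i => z.2 i - m i * N := by
  have hcont : Continuous fun (z : E n) i => z.2 i - m i * (N : ℝ) := by fun_prop
  filter_upwards [hcont.continuousAt.eventually_mem (isOpen_cell.mem_nhds hm)] with z hz
  have h := hH (z.1, fun i => z.2 i - m i * N) hz
  rw [← h]
  exact congrArg H (Prod.ext rfl (toTorus_eq_iff.2 ⟨m, fun i => by simp⟩))

theorem hasFDerivAt_hamiltonian (hk : k ≠ 0) {H : CotTorus N n → ℝ}
    (hH : ∀ x : E n, x.2 ∈ cell k a → H (q N x) = (2 * Real.pi) ^ n * primitive k a x.2)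
    {x : E n} {m : Fin n → ℤ} (hm : (fun i => x.2 i - m i * N) ∈ cell k a) :
    HasFDerivAt (H ∘ q N) (-omega (-cellGrad k a fun i => x.2 i - m i * N, 0)) x := by
  have h1 : HasFDerivAt (fun (z : E n) i => z.2 i - m i * (N : ℝ))
      (ContinuousLinearMap.snd ℝ (Fin n → ℝ) (Fin n → ℝ)) x :=
    hasFDerivAt_snd.sub_const (fun i => m i * (N : ℝ))
  have h2 := ((hasFDerivAt_primitive hk hm).comp x h1).const_mul ((2 * Real.pi) ^ n)
  refine (h2.congr_of_eventuallyEq (hamiltonian_eventuallyEq hH hm)).congr_fderiv ?_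
  ext v <;> simp [omega_apply]

/-- The flow of the primitive translates the fibre over `γ` with constant velocity `-df(γ)`. -/
theorem cellFlow_apply (hk : k ≠ 0) (hN : |k| ≤ N) {H : CotTorus N n → ℝ}
    (hH : ∀ x : E n, x.2 ∈ cell k a → H (q N x) = (2 * Real.pi) ^ n * primitive k a x.2)
    {φ : ℝ → CotTorus N n → CotTorus N n} (hφ : IsHamiltonianFlowOn (overCell N k a) H φ)
    {x : E n} (hx : x.2 ∈ cell k a) (t : ℝ) :
    φ t (q N x) = q N (x.1 - t • cellGrad k a x.2, x.2) := by
  classical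
  -- the Hamiltonian vector field, on all translates of the cell
  let X : E n → E n := fun z =>
    if h : ∃ m : Fin n → ℤ, (fun i => z.2 i - m i * N) ∈ cell k a then
      (-cellGrad k a fun i => z.2 i - h.choose i * N, 0) else 0
  have hX : ∀ z, q N z ∈ overCell N k a → HasFDerivAt (H ∘ q N) (-omega (X z)) z := by
    intro z hz
    have h := q_mem_overCell_iff.1 hz
    simp only [X, dif_pos h]
    exact hasFDerivAt_hamiltonian hk hH h.choose_spec
  obtain ⟨c, hc0, hc⟩ := hφ.hasDerivAt hX (x := x) ⟨x, hx, rfl⟩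
  have h2 : ∀ t, (c t).2 = x.2 := fun t => by
    rw [← hc0]
    refine eq_of_hasDerivAt_zero (f := fun t => (c t).2) (fun s => ?_) t
    have h := (hc s).2.2.snd
    have h3 := q_mem_overCell_iff.1 (hc s).2.1
    simp only [X, dif_pos h3] at h
    exact h
  have hXc : ∀ t, X (c t) = (-cellGrad k a x.2, 0) := fun t => by
    have h3 := q_mem_overCell_iff.1 (hc t).2.1
    simp only [X, dif_pos h3]
    have h4 := h3.choose_spec
    generalize h3.choose = m at h4 ⊢
    have h5 : m = 0 := by
      rw [← neg_eq_zero]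
      refine eq_zero_of_mem_cell hk hN h4 hx fun i => ?_
      rw [h2]
      simp [sub_eq_add_neg]
    rw [h5, h2]
    simp
  have h1 : (c t).1 = x.1 + t • -cellGrad k a x.2 := by
    rw [← hc0]
    refine eq_of_hasDerivAt_const (f := fun t => (c t).1) (fun s => ?_) t
    have h := (hc s).2.2.fst
    rw [hXc] at h
    rw [hc0]
    exact h
  rw [← (hc t).1]
  refine Prod.ext ?_ (by simp only [q, h2])
  simp only [q, h1, smul_neg, sub_eq_add_neg]

/-- The Hamiltonian flow of the primitive exists for all times. -/
theorem exists_cellFlow (hk : k ≠ 0) (hN : |k| ≤ N) :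
    ∃ (H : CotTorus N n → ℝ) (φ : ℝ → CotTorus N n → CotTorus N n),
      (∀ x : E n, x.2 ∈ cell k a → H (q N x) = (2 * Real.pi) ^ n * primitive k a x.2) ∧
      IsHamiltonianFlowOn (overCell N k a) H φ := by
  classical
  -- the inverse of the projection of the cell to the torus
  let r : (Fin n → AddCircle (N : ℝ)) → (Fin n → ℝ) :=
    Function.invFunOn (toTorus N) (cell k a)
  have hr : ∀ g ∈ cell k a, r (toTorus N g) = g := fun g hg =>
    (injOn_toTorus_cell hk hN).leftInvOn_invFunOn hg
  let H : CotTorus N n → ℝ := fun p => (2 * Real.pi) ^ n * primitive k a (r p.2)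
  have hH : ∀ x : E n, x.2 ∈ cell k a → H (q N x) = (2 * Real.pi) ^ n * primitive k a x.2 :=
    fun x hx => by simp only [H, q, hr _ hx]
  have hrm : ∀ (x : E n) (m : Fin n → ℤ), (fun i => x.2 i - m i * (N : ℝ)) ∈ cell k a →
      r (toTorus N x.2) = fun i => x.2 i - m i * N := fun x m hm => by
    rw [← hr _ hm]
    exact congrArg r (toTorus_eq_iff.2 ⟨m, fun i => by simp⟩)
  refine ⟨H, fun t p => (p.1 - t • cellGrad k a (r p.2), p.2), hH, isOpen_overCell, ?_,
    fun t x => (x.1 - t • cellGrad k a (r (toTorus N x.2)), x.2), fun x hx => ?_⟩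
  · intro x hx
    obtain ⟨m, hm⟩ := q_mem_overCell_iff.1 hx
    have h1 : ContDiffAt ℝ ∞ (fun (z : E n) i => z.2 i - m i * (N : ℝ)) x := by fun_prop
    have h2 : ContDiffAt ℝ ∞ (fun z : E n => primitive k a fun i => z.2 i - m i * (N : ℝ)) x :=
      ContDiffAt.comp x (g := primitive k a) (contDiffAt_primitive hm) h1
    exact ((contDiffAt_const.mul h2).congr_of_eventuallyEq
      (hamiltonian_eventuallyEq hH hm)).contDiffWithinAt
  · obtain ⟨m, hm⟩ := q_mem_overCell_iff.1 hx
    refine ⟨by simp, fun t => ⟨rfl, ?_, (-cellGrad k a fun i => x.2 i - m i * N, 0), ?_, ?_⟩⟩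
    · exact (q_mem_overCell_iff (x := (x.1 - t • cellGrad k a (r (toTorus N x.2)), x.2))).2 ⟨m, hm⟩
    · change HasDerivAt (fun s : ℝ => (x.1 - s • cellGrad k a (r (toTorus N x.2)), x.2)) _ t
      rw [hrm x m hm]
      refine HasDerivAt.prodMk ?_ (hasDerivAt_const _ _)
      have := ((hasDerivAt_id t).smul_const
        (cellGrad k a fun i => x.2 i - m i * (N : ℝ))).const_sub x.1
      simpa using this
    · exact hasFDerivAt_hamiltonian hk hH hm
        (x := (x.1 - t • cellGrad k a (r (toTorus N x.2)), x.2))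

end Cell

/-! ### Gradings of the graphs over the cells -/

section Grading

variable {N n : ℕ} {k : ℤ} {a : Fin n → ℤ}

/-- The point over `y` of the graph over the cell. -/
def cellGraphPoint (N : ℕ) (hk : k ≠ 0) (a : Fin n → ℤ) (y : Fin n → ℝ) : cellGraph N k a :=
  ⟨q N (y, cellPoint k a y), (mem_cellGraph_iff hk).2 ⟨y, rfl⟩⟩

theorem cellFlow_cellPoint (hk : k ≠ 0) (hN : |k| ≤ N) {H : CotTorus N n → ℝ}
    (hH : ∀ x : E n, x.2 ∈ cell k a → H (q N x) = (2 * Real.pi) ^ n * primitive k a x.2)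
    {φ : ℝ → CotTorus N n → CotTorus N n} (hφ : IsHamiltonianFlowOn (overCell N k a) H φ)
    (y : Fin n → ℝ) (t : ℝ) :
    φ t (q N (y, cellPoint k a y)) = q N ((1 - t) • y, cellPoint k a y) := by
  rw [cellFlow_apply hk hN hH hφ (cellPoint_mem hk y)]
  simp only [cellGrad_cellPoint hk, sub_smul, one_smul]

theorem cellFlow_image (hk : k ≠ 0) (hN : |k| ≤ N) {H : CotTorus N n → ℝ}
    (hH : ∀ x : E n, x.2 ∈ cell k a → H (q N x) = (2 * Real.pi) ^ n * primitive k a x.2)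
    {φ : ℝ → CotTorus N n → CotTorus N n} (hφ : IsHamiltonianFlowOn (overCell N k a) H φ) (t : ℝ) :
    φ t '' cellGraph N k a = scaledGraph N k a (1 - t) := by
  ext p
  rw [mem_scaledGraph_iff hk]
  constructor
  · rintro ⟨p, hp, rfl⟩
    obtain ⟨y, rfl⟩ := (mem_cellGraph_iff hk).1 hp
    exact ⟨y, cellFlow_cellPoint hk hN hH hφ y t⟩
  · rintro ⟨y, rfl⟩
    exact ⟨_, (mem_cellGraph_iff hk).2 ⟨y, rfl⟩, cellFlow_cellPoint hk hN hH hφ y t⟩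

/-- The phases of the family `(1 - t) · graph` have a continuous lift that vanishes on the zero
section; its restriction to `t = 0`, as a function of the fibre coordinate alone, is the one and
only grading that comes from the cell, for all covers and all cells. -/
theorem exists_cellGrading (n : ℕ) (hk : k ≠ 0) : ∃ θ : (Fin n → ℝ) → ℝ, Continuous θ ∧
    (∀ y, SqPhaseEq (complexDet (planeMap 1 k y)) (θ y)) ∧
    ∀ (N : ℕ), |k| ≤ N → ∀ (a : Fin n → ℤ) (β : cellGraph N k a → ℝ),
      IsCellGrading N k a β ↔ ∀ x, β x = θ x.1.1 := by
  have hk' : (k : ℝ) ≠ 0 := by exact_mod_cast hk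
  obtain ⟨θ, hθ, hph, hθ1⟩ := exists_phase_to_zeroSection n hk'
  have hph0 : ∀ y, SqPhaseEq (complexDet (planeMap 1 k y)) (θ (0, y)) := fun y => by
    simpa using hph 0 y
  refine ⟨fun y => θ (0, y), by fun_prop, hph0, fun N hN a β => ⟨?_, fun hβ => ?_⟩⟩
  · rintro ⟨-, H, φ, hH, hφ, -, -, α, hα, hαph, hα0, hα1⟩ x
    obtain ⟨y, hy⟩ := (mem_cellGraph_iff hk).1 x.2
    have hy1 : x.1.1 = y := by rw [hy]; rfl
    -- on `[0, 1]` the difference of the two lifts is an integer, and it vanishes at `t = 1`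
    have hint : ∀ t ∈ Set.Icc (0 : ℝ) 1, ∃ m : ℤ, α (t, x) - θ (t, y) = m := by
      intro t ht
      have hflow : q N ((1 - t) • y, cellPoint k a y) = φ t x := by
        rw [hy, cellFlow_cellPoint hk hN hH hφ]
      have h := hαph t ht x _ hflow
      rw [cellFlow_image hk hN hH hφ, tangentSpace_scaledGraph hk hN rfl] at h
      exact ((hasPhase_planeMap_iff (Or.inr hk') y _).1 h).exists_int (hph t y)
    have hcont : ContinuousOn (fun t => α (t, x) - θ (t, y)) (Set.Icc 0 1) := by
      refine ContinuousOn.sub (hα.comp (by fun_prop) fun t ht => ⟨ht, trivial⟩) ?_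
      fun_prop
    have h := eq_of_continuousOn_int isPreconnected_Icc hcont hint
      (Set.left_mem_Icc.2 zero_le_one) (Set.right_mem_Icc.2 zero_le_one)
    simp only [hα0, hα1, hθ1, Pi.zero_apply, sub_zero] at h
    rw [hy1]
    linarith
  · have hβ' : β = fun x => θ (0, x.1.1) := funext hβ
    have hcont : Continuous fun x : cellGraph N k a => x.1.1 :=
      continuous_fst.comp continuous_subtype_val
    obtain ⟨H, φ, hH, hφ⟩ := exists_cellFlow (n := n) (a := a) hk hN
    refine ⟨⟨by rw [hβ']; fun_prop, fun x hx => ?_⟩, H, φ, hH, hφ,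
      fun t _ => cellFlow_image hk hN hH hφ t, ?_, fun p => θ (p.1, p.2.1.1), ?_, ?_, ?_, ?_⟩
    · obtain ⟨y, hy⟩ := (mem_cellGraph_iff hk).1 hx
      have hy1 : x.1 = y := congrArg Prod.fst hy
      have htan : tangentSpace (cellGraph N k a) x = (planeMap 1 k y).range := by
        rw [← scaledGraph_one, tangentSpace_scaledGraph hk hN (y := y) (by rw [hy, one_smul])]
      rw [htan, hasPhase_planeMap_iff (Or.inr hk'), hβ]
      simp only [q, hy1]
      exact hph0 y
    · rw [cellFlow_image hk hN hH hφ, sub_self, scaledGraph_zero hk]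
    · fun_prop
    · intro t _ x z hz
      obtain ⟨y, hy⟩ := (mem_cellGraph_iff hk).1 x.2
      have hy1 : x.1.1 = y := by rw [hy]; rfl
      rw [hy, cellFlow_cellPoint hk hN hH hφ] at hz
      rw [cellFlow_image hk hN hH hφ, tangentSpace_scaledGraph hk hN hz,
        hasPhase_planeMap_iff (Or.inr hk')]
      simp only [hy1]
      exact hph t y
    · intro x
      rw [hβ]
    · intro x
      exact hθ1 _

/-! ### Lifts -/

theorem coverMap_q (x : E n) : coverMap N (q N x) = q 1 x := rfl

theorem mem_lagr_iff {p : CotTorus 1 n} : p ∈ lagr n k ↔ ∃ y, p = q 1 (y, (k : ℝ) • moment y) := by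
  rw [lagr_eq_torusGraph, mem_torusGraph]
  constructor
  · intro h
    exact ⟨p.1, Prod.ext rfl h⟩
  · rintro ⟨y, rfl⟩
    rfl

theorem toTorus_one_cellPoint (y : Fin n → ℝ) :
    toTorus 1 (cellPoint k a y) = toTorus 1 ((k : ℝ) • moment y) :=
  toTorus_eq_iff.2 ⟨a, fun i => by simp [cellPoint]⟩

/-- The point over `y` of the Lagrangian. -/
def lagrPoint (k : ℤ) (y : Fin n → ℝ) : lagr n k :=
  ⟨q 1 (y, (k : ℝ) • moment y), mem_lagr_iff.2 ⟨y, rfl⟩⟩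

theorem lagrPoint_fst (p : lagr n k) : lagrPoint k p.1.1 = p := by
  obtain ⟨y, hy⟩ := mem_lagr_iff.1 p.2
  refine Subtype.ext ?_
  rw [hy]
  rfl

theorem continuous_lagrPoint : Continuous (lagrPoint (n := n) k) :=
  Continuous.subtype_mk (continuous_q.comp
    (continuous_id.prodMk (contDiff_smul_moment _).continuous)) _

/-- The Lagrangian is homeomorphic to the fibre `ℝ^n`. -/
def lagrHomeo (n : ℕ) (k : ℤ) : lagr n k ≃ₜ (Fin n → ℝ) where
  toFun p := p.1.1
  invFun := lagrPoint k
  left_inv := lagrPoint_fst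
  right_inv _ := rfl
  continuous_toFun := continuous_fst.comp continuous_subtype_val
  continuous_invFun := continuous_lagrPoint

/-- The integers form a finite, hence discrete, subset of `ℝ/Nℤ`. -/
theorem finite_integers_addCircle (hN : 1 ≤ N) :
    (Set.range fun m : ℤ => ((m : ℝ) : AddCircle (N : ℝ))).Finite := by
  refine ((Set.finite_Ico (0 : ℤ) N).image fun m : ℤ => ((m : ℝ) : AddCircle (N : ℝ))).subset ?_
  rintro _ ⟨m, rfl⟩
  have hN' : (0 : ℤ) < N := by omega
  refine ⟨m % N, ⟨Int.emod_nonneg _ hN'.ne', Int.emod_lt_of_pos _ hN'⟩, ?_⟩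
  have h := toTorus_eq_iff (N := N) (n := 1) (g := fun _ => ((m % N : ℤ) : ℝ))
    (g' := fun _ => (m : ℝ))
  refine congrFun (h.2 ⟨fun _ => -(m / N), fun _ => ?_⟩) 0
  rw [← Int.cast_natCast (R := ℝ) N, ← Int.cast_mul, ← Int.cast_add, Int.cast_inj]
  have := Int.emod_add_mul_ediv m N
  linarith

/-- As the Lagrangian is connected, a lift differs from `y ↦ k s(y)` by a constant integral vector;
`s` is the moment map. -/
theorem isLift_iff (hk : k ≠ 0) (hN : |k| ≤ N) (L' : Set (CotTorus N n)) :
    IsLift N L' (lagr n k) ↔ ∃ a : Fin n → ℤ, L' = cellGraph N k a := by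
  have hN1 := one_le_of_abs_le hk hN
  have : Fact ((0 : ℝ) < N) := ⟨by exact_mod_cast hN1⟩
  constructor
  · rintro ⟨σ, hσ, hσc, rfl⟩
    have h1 : ∀ y, (σ (lagrPoint k y)).1 = y := fun y => congrArg Prod.fst (hσc (lagrPoint k y))
    let D : (Fin n → ℝ) → Fin n → AddCircle (N : ℝ) := fun y i =>
      (σ (lagrPoint k y)).2 i - ((k * moment y i : ℝ) : AddCircle (N : ℝ))
    have hD : ∀ i, Continuous fun y => D y i := fun i => by
      have h2 : Continuous fun y => (σ (lagrPoint k y)).2 i :=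
        (continuous_apply i).comp (continuous_snd.comp (hσ.comp continuous_lagrPoint))
      have h3 : Continuous fun y : Fin n → ℝ => ((k * moment y i : ℝ) : AddCircle (N : ℝ)) :=
        (AddCircle.continuous_mk' _).comp
          (continuous_const.mul ((continuous_apply i).comp continuous_moment))
      exact h2.sub h3
    have hint : ∀ y i, D y i ∈ Set.range fun m : ℤ => ((m : ℝ) : AddCircle (N : ℝ)) := by
      intro y i
      obtain ⟨r, hr⟩ := QuotientAddGroup.mk_surjective ((σ (lagrPoint k y)).2 i)
      have h2 : (r : AddCircle ((1 : ℕ) : ℝ)) =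
          ((k * moment y i : ℝ) : AddCircle ((1 : ℕ) : ℝ)) := by
        have := congrFun (congrArg Prod.snd (hσc (lagrPoint k y))) i
        simp only [coverMap, ← hr] at this
        exact this
      rw [← sub_eq_zero, ← AddCircle.coe_sub, AddCircle.coe_eq_zero_iff] at h2
      obtain ⟨m, hm⟩ := h2
      refine ⟨m, ?_⟩
      simp only [D, ← hr]
      change ((m : ℝ) : AddCircle (N : ℝ)) = (r : AddCircle (N : ℝ)) - _
      rw [← AddCircle.coe_sub, ← hm]
      simp
    have hconst : ∀ y i, D y i = D 0 i := fun y i =>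
      isPreconnected_univ.constant_of_mapsTo (finite_integers_addCircle hN1).isDiscrete
        (hD i).continuousOn (fun z _ => hint z i) trivial trivial
    choose a ha using hint 0
    have hpt : ∀ y, σ (lagrPoint k y) = q N (y, cellPoint k a y) := fun y => by
      refine Prod.ext (h1 y) (funext fun i => ?_)
      have h2 : (σ (lagrPoint k y)).2 i = D y i + ((k * moment y i : ℝ) : AddCircle (N : ℝ)) := by
        simp [D]
      rw [h2, hconst, ← ha]
      simp [q, toTorus, cellPoint, add_comm]
    refine ⟨a, ?_⟩
    ext p
    rw [mem_cellGraph_iff hk]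
    constructor
    · rintro ⟨x, rfl⟩
      exact ⟨x.1.1, by rw [← hpt, lagrPoint_fst]⟩
    · rintro ⟨y, rfl⟩
      exact ⟨_, hpt y⟩
  · rintro ⟨a, rfl⟩
    refine ⟨fun x => q N (x.1.1, cellPoint k a x.1.1), ?_, fun x => ?_, ?_⟩
    · exact continuous_q.comp ((continuous_fst.comp continuous_subtype_val).prodMk
        (contDiff_cellPoint.continuous.comp (continuous_fst.comp continuous_subtype_val)))
    · rw [coverMap_q]
      conv_rhs => rw [← lagrPoint_fst x]
      exact Prod.ext rfl (toTorus_one_cellPoint _)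
    · ext p
      rw [mem_cellGraph_iff hk]
      constructor
      · rintro ⟨x, rfl⟩
        exact ⟨_, rfl⟩
      · rintro ⟨y, rfl⟩
        exact ⟨lagrPoint k y, rfl⟩

/-! ### The canonical grading -/

theorem tangentSpace_torusGraph_moment (hN : 1 ≤ N) (c : ℝ) {x : E n}
    (hx : q N x ∈ torusGraph N fun y => c • moment y) :
    tangentSpace (torusGraph N fun y => c • moment y) x = (planeMap 1 c x.1).range := by
  rw [tangentSpace_torusGraph hN (contDiff_smul_moment c).continuous hx
    ((hasFDerivAt_moment x.1).const_smul c), planeMap, one_smul]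

theorem tangentSpace_lagr {x : E n} (hx : q 1 x ∈ lagr n k) :
    tangentSpace (lagr n k) x = (planeMap 1 k x.1).range := by
  rw [lagr_eq_torusGraph] at hx ⊢
  exact tangentSpace_torusGraph_moment le_rfl _ hx

theorem isGrading_lagr {θ : (Fin n → ℝ) → ℝ} (hθ : Continuous θ)
    (hph : ∀ y, SqPhaseEq (complexDet (planeMap 1 k y)) (θ y)) :
    IsGrading (lagr n k) fun p => θ p.1.1 := by
  refine ⟨hθ.comp (continuous_fst.comp continuous_subtype_val), fun x hx => ?_⟩
  rw [tangentSpace_lagr hx, hasPhase_planeMap_iff (Or.inl one_ne_zero)]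
  exact hph x.1

/-- The grading of the cell does not depend on the cell or on the cover as a function of the fibre
coordinate, so it descends. -/
theorem exists_inducedGrading (n : ℕ) (hk : k ≠ 0) : ∃ θ : (Fin n → ℝ) → ℝ, Continuous θ ∧
    (∀ y, SqPhaseEq (complexDet (planeMap 1 k y)) (θ y)) ∧
    ∀ β : lagr n k → ℝ, IsInducedByCells k β ↔ ∀ p, β p = θ p.1.1 := by
  obtain ⟨θ, hθ, hph, h⟩ := exists_cellGrading n hk
  refine ⟨θ, hθ, hph, fun β => ⟨?_, fun hβ => ?_⟩⟩
  · rintro ⟨-, hβ⟩ p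
    obtain ⟨β', hβ', hpull⟩ := hβ k.natAbs (by simp) 0
    rw [hpull (cellGraphPoint _ hk 0 p.1.1) p, (h _ (by simp) 0 β').1 hβ']
    · rfl
    · conv_rhs => rw [← lagrPoint_fst p]
      exact Prod.ext rfl (toTorus_one_cellPoint _)
  · rw [show β = fun p => θ p.1.1 from funext hβ]
    refine ⟨isGrading_lagr hθ hph, fun N hN a => ⟨fun x => θ x.1.1, (h N hN a _).2 fun _ => rfl,
      fun x z hxz => ?_⟩⟩
    change θ z.1.1 = θ x.1.1
    rw [← hxz]
    rfl

/-- The Hamiltonian vector field of the isotopy from the cotangent fibre to `𝓛(𝒪(-1), h_{-1})` is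
minus the moment map, in the direction of the base. -/
theorem hasFDerivAt_fibreHamiltonian (x : E n) :
    HasFDerivAt ((fun p : CotTorus 1 n => -((2 * Real.pi) ^ n * (1 / 2) *
      Real.log (1 + ∑ i, Real.exp (2 * p.1 i)))) ∘ q 1) (-omega (0, -moment x.1)) x := by
  have h := ((((hasFDerivAt_momentDenom x.1).comp x
    (hasFDerivAt_fst (𝕜 := ℝ) (p := x))).log (momentDenom_pos x.1).ne').const_mul
      ((2 * Real.pi) ^ n * (1 / 2))).fun_neg
  refine h.congr_fderiv ?_
  ext v
  · simp [omega_apply, moment, Finset.mul_sum]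
    refine Finset.sum_congr rfl fun i _ => ?_
    ring
  · simp [omega_apply]

theorem fibreFlow_apply {φ : ℝ → CotTorus 1 n → CotTorus 1 n}
    (hφ : IsHamiltonianFlowOn Set.univ (fun p : CotTorus 1 n =>
      -((2 * Real.pi) ^ n * (1 / 2) * Real.log (1 + ∑ i, Real.exp (2 * p.1 i)))) φ)
    (x : E n) (t : ℝ) : φ t (q 1 x) = q 1 (x.1, x.2 + t • -moment x.1) := by
  obtain ⟨c, hc0, hc⟩ := hφ.hasDerivAt (X := fun x => (0, -moment x.1))
    (fun x _ => hasFDerivAt_fibreHamiltonian x) (x := x) trivial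
  have h1 : ∀ t, (c t).1 = x.1 := fun t => by
    rw [← hc0]
    exact eq_of_hasDerivAt_zero (f := fun t => (c t).1) (fun s => (hc s).2.2.fst) t
  have h2 : (c t).2 = x.2 + t • -moment x.1 := by
    have h3 := eq_of_hasDerivAt_const (f := fun t => (c t).2) (v := -moment x.1) (fun s => by
      have h4 := (hc s).2.2.snd
      simp only [h1] at h4
      exact h4) t
    simpa only [hc0] using h3
  rw [← (hc t).1]
  exact congrArg (q 1) (Prod.ext (h1 t) h2)

theorem exists_fibreFlow (n : ℕ) : ∃ φ : ℝ → CotTorus 1 n → CotTorus 1 n,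
    IsHamiltonianFlowOn Set.univ (fun p : CotTorus 1 n =>
      -((2 * Real.pi) ^ n * (1 / 2) * Real.log (1 + ∑ i, Real.exp (2 * p.1 i)))) φ := by
  refine ⟨fun t p => (p.1, p.2 + toTorus 1 (t • -moment p.1)), isOpen_univ, ?_,
    fun t x => (x.1, x.2 + t • -moment x.1), fun x _ => ⟨by simp, fun t => ⟨rfl, trivial,
      (0, -moment x.1), ?_, hasFDerivAt_fibreHamiltonian (n := n) (x.1, x.2 + t • -moment x.1)⟩⟩⟩
  · have h : ContDiff ℝ ∞ fun x : E n => -((2 * Real.pi) ^ n * (1 / 2) *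
        Real.log (momentDenom x.1)) :=
      (contDiff_const.mul ((contDiff_momentDenom.comp contDiff_fst).log
        fun x => (momentDenom_pos x.1).ne')).neg
    exact h.contDiffOn
  · refine HasDerivAt.prodMk (hasDerivAt_const _ _) ?_
    have := ((hasDerivAt_id t).smul_const (-moment x.1)).const_add x.2
    simpa using this

/-- At time `t` the cotangent fibre has become the graph of `-t` times the moment map. -/
theorem fibreFlow_image {φ : ℝ → CotTorus 1 n → CotTorus 1 n}
    (hφ : IsHamiltonianFlowOn Set.univ (fun p : CotTorus 1 n =>
      -((2 * Real.pi) ^ n * (1 / 2) * Real.log (1 + ∑ i, Real.exp (2 * p.1 i)))) φ) (t : ℝ) :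
    φ t '' lagr n 0 = torusGraph 1 fun y => (-t) • moment y := by
  have hpt : ∀ y : Fin n → ℝ, φ t (q 1 (y, ((0 : ℤ) : ℝ) • moment y)) = q 1 (y, (-t) • moment y) :=
    fun y => by rw [fibreFlow_apply hφ]; simp
  ext p
  rw [mem_torusGraph]
  constructor
  · rintro ⟨p, hp, rfl⟩
    obtain ⟨y, rfl⟩ := mem_lagr_iff.1 hp
    rw [hpt]
    rfl
  · intro h
    refine ⟨q 1 (p.1, ((0 : ℤ) : ℝ) • moment p.1), mem_lagr_iff.2 ⟨_, rfl⟩, ?_⟩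
    rw [hpt]
    exact Prod.ext rfl h.symm

/-- The canonical grading exists and is unique, as a function of the fibre coordinate. For `k = 0`
the grading is carried back along the isotopy from the one for `k = -1`. -/
theorem exists_canonicalGrading (n : ℕ) (k : ℤ) : ∃ θ : (Fin n → ℝ) → ℝ,
    ∀ β : lagr n k → ℝ, IsCanonicalGrading k β ↔ ∀ p, β p = θ p.1.1 := by
  by_cases hk : k = 0
  · subst hk
    obtain ⟨θ₁, hθ₁, hph₁, h₁⟩ := exists_inducedGrading (k := -1) n (by norm_num)
    obtain ⟨θ, hθ, hph, hend⟩ := exists_phase_from_fibre hθ₁ (fun y => by simpa using hph₁ y)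
    have htan : ∀ {φ : ℝ → CotTorus 1 n → CotTorus 1 n},
        IsHamiltonianFlowOn Set.univ (fun p : CotTorus 1 n =>
          -((2 * Real.pi) ^ n * (1 / 2) * Real.log (1 + ∑ i, Real.exp (2 * p.1 i)))) φ →
        ∀ (t : ℝ) (x : lagr n 0) (z : E n), q 1 z = φ t x → ∀ b,
          HasPhase (tangentSpace (φ t '' lagr n 0) z) b ↔
            SqPhaseEq (complexDet (planeMap 1 (-t) x.1.1)) b := by
      intro φ hφ t x z hz b
      obtain ⟨y, hy⟩ := mem_lagr_iff.1 x.2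
      have hmem : q 1 z ∈ torusGraph 1 fun y => (-t) • moment y := by
        rw [hz, ← fibreFlow_image hφ]
        exact ⟨x, x.2, rfl⟩
      have hz1 : z.1 = x.1.1 := by
        rw [hy, fibreFlow_apply hφ] at hz
        rw [hy]
        exact congrArg Prod.fst hz
      rw [fibreFlow_image hφ, tangentSpace_torusGraph_moment le_rfl _ hmem,
        hasPhase_planeMap_iff (Or.inl one_ne_zero), hz1]
    refine ⟨fun y => θ (0, y), fun β => ⟨?_, fun hβ => ?_⟩⟩
    · rintro ⟨-, -, hβ⟩ p
      obtain ⟨γ, φ, β₁, hγ, hφ, himg, ⟨α, hα, hαph, hα0, hα1⟩, hβ₁⟩ := hβ rfl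
      -- on `[0, 1]` the difference of the two lifts is an integer, and it vanishes at `t = 1`
      have hint : ∀ t ∈ Set.Icc (0 : ℝ) 1, ∃ m : ℤ, α (t, p) - θ (t, p.1.1) = m := by
        intro t ht
        obtain ⟨z, hz⟩ := q_surjective (φ t p)
        exact ((htan hφ t p z hz _).1 (hαph t ht p z hz)).exists_int (hph t _)
      have hcont : ContinuousOn (fun t => α (t, p) - θ (t, p.1.1)) (Set.Icc 0 1) := by
        refine ContinuousOn.sub (hα.comp (by fun_prop) fun t ht => ⟨ht, trivial⟩) ?_
        fun_prop
      have h := eq_of_continuousOn_int isPreconnected_Icc hcont hint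
        (Set.left_mem_Icc.2 zero_le_one) (Set.right_mem_Icc.2 zero_le_one)
      have hmem : φ 1 p.1 ∈ lagr n (-1) := himg ▸ ⟨p, p.2, rfl⟩
      have hfst : (φ 1 p.1).1 = p.1.1 := by
        obtain ⟨y, hy⟩ := mem_lagr_iff.1 p.2
        rw [hy, fibreFlow_apply hφ]
        rfl
      have hγp : γ ⟨φ 1 p.1, hmem⟩ = θ₁ p.1.1 := by
        rw [(h₁ γ).1 hγ, ← hfst]
      simp only [hα0, hα1, hend, hβ₁ p ⟨_, hmem⟩ rfl, hγp] at h
      linarith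
    · obtain ⟨φ, hφ⟩ := exists_fibreFlow n
      have hcont : Continuous fun x : lagr n 0 => x.1.1 :=
        continuous_fst.comp continuous_subtype_val
      refine ⟨?_, fun h => absurd rfl h, fun _ => ⟨fun p => θ₁ p.1.1, φ, fun p => θ₁ p.1.1,
        (h₁ _).2 fun _ => rfl, hφ, ?_, ⟨fun x => θ (x.1, x.2.1.1), ?_, ?_, ?_, ?_⟩, ?_⟩⟩
      · rw [show β = fun p => θ (0, p.1.1) from funext hβ]
        refine isGrading_lagr (θ := fun y => θ (0, y)) (by fun_prop) fun y => ?_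
        simpa using hph 0 y
      · rw [fibreFlow_image hφ, lagr_eq_torusGraph]
        simp
      · fun_prop
      · intro t _ x z hz
        exact (htan hφ t x z hz _).2 (hph t _)
      · intro x
        rw [hβ]
      · intro x
        exact hend _
      · intro x z hz
        obtain ⟨y, hy⟩ := mem_lagr_iff.1 x.2
        change θ₁ x.1.1 = θ₁ z.1.1
        rw [← hz, hy, fibreFlow_apply hφ]
        rfl
  · obtain ⟨θ, hθ, hph, h⟩ := exists_inducedGrading n hk
    refine ⟨θ, fun β => ⟨fun hβ => (h β).1 (hβ.2.1 hk), fun hβ => ?_⟩⟩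
    have := (h β).2 hβ
    exact ⟨this.1, fun _ => this, fun h => absurd h hk⟩

end Grading

open InnerProductSpace

section PinStructures

variable {n : ℕ} {k : ℤ}

/-! ### Orthonormal framings -/

section GramSchmidt

variable {F : Type*} [NormedAddCommGroup F] [InnerProductSpace ℝ F] {Y : Type*}
  [TopologicalSpace Y]

theorem continuous_gramSchmidt {f : Y → Fin n → F} (hf : ∀ i, Continuous fun y => f y i)
    (hli : ∀ y, LinearIndependent ℝ (f y)) (i : Fin n) :
    Continuous fun y => gramSchmidt ℝ (f y) i := by
  induction i using WellFoundedLT.induction with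
  | _ i ih =>
    have h : (fun y => gramSchmidt ℝ (f y) i) = fun y => f y i - ∑ j ∈ Finset.Iio i,
        (inner ℝ (gramSchmidt ℝ (f y) j) (f y i) / ‖gramSchmidt ℝ (f y) j‖ ^ 2) •
          gramSchmidt ℝ (f y) j :=
      funext fun y => eq_sub_of_add_eq (gramSchmidt_def'' ℝ (f y) i).symm
    rw [h]
    refine (hf i).sub (continuous_finsetSum _ fun j hj => ?_)
    have hj' := ih j (Finset.mem_Iio.1 hj)
    exact ((hj'.inner (hf i)).div (hj'.norm.pow 2) fun y =>
      pow_ne_zero 2 (norm_ne_zero_iff.2 (gramSchmidt_ne_zero j (hli y)))).smul hj'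

theorem continuous_gramSchmidtNormed {f : Y → Fin n → F} (hf : ∀ i, Continuous fun y => f y i)
    (hli : ∀ y, LinearIndependent ℝ (f y)) (i : Fin n) :
    Continuous fun y => gramSchmidtNormed ℝ (f y) i := by
  have h := continuous_gramSchmidt hf hli i
  exact (h.norm.inv₀ fun y => norm_ne_zero_iff.2 (gramSchmidt_ne_zero i (hli y))).smul h

end GramSchmidt

/-- The metric `∑ dy_i² + dγ_i²`. -/
def flatMetric (n : ℕ) : LinearMap.BilinForm ℝ (E n) :=
  LinearMap.mk₂ ℝ (fun u v => u.1 ⬝ᵥ v.1 + u.2 ⬝ᵥ v.2)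
    (fun u u' v => by simp only [Prod.fst_add, Prod.snd_add, add_dotProduct]; ring)
    (fun c u v => by
      simp only [Prod.smul_fst, Prod.smul_snd, smul_dotProduct, smul_eq_mul]; ring)
    (fun u v v' => by simp only [Prod.fst_add, Prod.snd_add, dotProduct_add]; ring)
    (fun c u v => by
      simp only [Prod.smul_fst, Prod.smul_snd, dotProduct_smul, smul_eq_mul]; ring)

theorem flatMetric_apply (u v : E n) : flatMetric n u v = u.1 ⬝ᵥ v.1 + u.2 ⬝ᵥ v.2 := rfl

/-- `E n` as a Euclidean space. -/
def toEuclidean (n : ℕ) : E n ≃ₗ[ℝ] EuclideanSpace ℝ (Fin n ⊕ Fin n) :=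
  (LinearEquiv.sumArrowLequivProdArrow (Fin n) (Fin n) ℝ ℝ).symm ≪≫ₗ
    (WithLp.linearEquiv 2 ℝ (Fin n ⊕ Fin n → ℝ)).symm

theorem inner_toEuclidean (u v : E n) :
    inner ℝ (toEuclidean n u) (toEuclidean n v) = flatMetric n u v := by
  simp only [PiLp.inner_apply, Fintype.sum_sum_type, flatMetric_apply, dotProduct]
  exact congrArg₂ (· + ·) (Finset.sum_congr rfl fun i _ => mul_comm _ _)
    (Finset.sum_congr rfl fun i _ => mul_comm _ _)

/-- Gram–Schmidt orthonormalisation of the images of the standard basis under the parametrisation of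
the tangent planes. -/
theorem exists_orthonormalFraming (n : ℕ) (k : ℤ) : ∃ e : (Fin n → ℝ) → Fin n → E n,
    Continuous e ∧ (∀ y i, e y i ∈ (planeMap 1 k y).range) ∧
    ∀ y i j, flatMetric n (e y i) (e y j) = if i = j then 1 else 0 := by
  let f : (Fin n → ℝ) → Fin n → EuclideanSpace ℝ (Fin n ⊕ Fin n) := fun y i =>
    toEuclidean n (planeMap 1 k y (Pi.single i 1))
  have hf : ∀ i, Continuous fun y => f y i := fun i => by
    refine (LinearMap.continuous_of_finiteDimensional (toEuclidean n).toLinearMap).comp ?_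
    simp only [planeMap_apply, momentDeriv, LinearMap.coe_toContinuousLinearMap',
      Matrix.mulVecLin_apply]
    have h : Continuous fun y : Fin n → ℝ => (momentMatrix y).mulVec (Pi.single i 1) :=
      continuous_momentMatrix.matrix_mulVec continuous_const
    fun_prop
  have hli : ∀ y, LinearIndependent ℝ (f y) := fun y => by
    have h := (Pi.basisFun ℝ (Fin n)).linearIndependent.map'
      ((toEuclidean n).toLinearMap ∘ₗ (planeMap 1 k y).toLinearMap)
      (LinearMap.ker_eq_bot.2
        ((toEuclidean n).injective.comp (planeMap_injective (Or.inl one_ne_zero) y)))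
    have hf' : f y = ((toEuclidean n).toLinearMap ∘ₗ (planeMap 1 k y).toLinearMap) ∘
        Pi.basisFun ℝ (Fin n) := funext fun i => by simp [f]
    rwa [hf']
  refine ⟨fun y i => (toEuclidean n).symm (gramSchmidtNormed ℝ (f y) i), ?_, fun y i => ?_,
    fun y i j => ?_⟩
  · exact continuous_pi fun i =>
      (LinearMap.continuous_of_finiteDimensional (toEuclidean n).symm.toLinearMap).comp
        (continuous_gramSchmidtNormed hf hli i)
  · have h : Submodule.span ℝ (Set.range (gramSchmidtNormed ℝ (f y))) ≤
        (planeMap 1 k y).range.comap (toEuclidean n).symm.toLinearMap := by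
      rw [span_gramSchmidtNormed_range, span_gramSchmidt, Submodule.span_le]
      rintro - ⟨i, rfl⟩
      simp [f]
    exact h (Submodule.subset_span ⟨i, rfl⟩)
  · rw [← inner_toEuclidean, LinearEquiv.apply_symm_apply, LinearEquiv.apply_symm_apply]
    exact orthonormal_iff_ite.1 (gramSchmidtNormed_orthonormal (hli y)) i j

/-- A continuous orthonormal framing of the tangent planes of `𝓛(𝒪(k), h_k)`, parametrised by the
fibre coordinate. -/
def framing (n : ℕ) (k : ℤ) : (Fin n → ℝ) → Fin n → E n := (exists_orthonormalFraming n k).choose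

theorem continuous_framing : Continuous (framing n k) :=
  (exists_orthonormalFraming n k).choose_spec.1

theorem framing_mem (y : Fin n → ℝ) (i : Fin n) : framing n k y i ∈ (planeMap 1 k y).range :=
  (exists_orthonormalFraming n k).choose_spec.2.1 y i

theorem flatMetric_framing (y : Fin n → ℝ) (i j : Fin n) :
    flatMetric n (framing n k y i) (framing n k y j) = if i = j then 1 else 0 :=
  (exists_orthonormalFraming n k).choose_spec.2.2 y i j

theorem flatMetric_framing_sum (y : Fin n → ℝ) (i : Fin n) (c : Fin n → ℝ) :
    flatMetric n (framing n k y i) (∑ j, c j • framing n k y j) = c i := by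
  simp [flatMetric_framing]

theorem flatMetric_sum_framing (y : Fin n → ℝ) (c d : Fin n → ℝ) :
    flatMetric n (∑ i, c i • framing n k y i) (∑ j, d j • framing n k y j) = c ⬝ᵥ d := by
  rw [LinearMap.map_sum₂]
  simp only [map_smul, LinearMap.smul_apply, flatMetric_framing_sum, smul_eq_mul, dotProduct]

/-- The framing spans the tangent planes. -/
theorem eq_sum_framing {y : Fin n → ℝ} {u : E n} (hu : u ∈ (planeMap 1 k y).range) :
    u = ∑ i, flatMetric n (framing n k y i) u • framing n k y i := by
  choose w hw' using framing_mem (n := n) (k := k) y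
  have hw : ∀ i, planeMap 1 k y (w i) = framing n k y i := hw'
  have hli : LinearIndependent ℝ w := by
    refine Fintype.linearIndependent_iff.2 fun c hc i => ?_
    have h := congrArg (fun v => flatMetric n (framing n k y i) (planeMap 1 k y v)) hc
    simp only [map_sum, map_smul, hw, map_zero] at h
    rw [← flatMetric_framing_sum (k := k) y i c]
    simpa using h
  have hspan := hli.span_eq_top_of_card_eq_finrank' (by simp)
  obtain ⟨v, rfl⟩ := hu
  obtain ⟨c, rfl⟩ := (Submodule.mem_span_range_iff_exists_fun ℝ).1
    (hspan ▸ Submodule.mem_top : v ∈ Submodule.span ℝ (Set.range w))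
  have h : planeMap 1 k y (∑ i, c i • w i) = ∑ i, c i • framing n k y i := by
    simp only [map_sum, map_smul, hw]
  change planeMap 1 k y _ = ∑ i, flatMetric n _ (planeMap 1 k y _) • _
  simp only [h, flatMetric_framing_sum]

/-! ### The frame bundle -/

/-- The framing identifies the frame bundle of `𝓛(𝒪(k), h_k)` with the trivial bundle with fibre
`O(n)` over `ℝ^n`; the matrix `A` stands for the frame `f_j = ∑ A_{ij} e_i`. -/
def frameHomeo (n : ℕ) (k : ℤ) :
    (Fin n → ℝ) × Matrix.orthogonalGroup (Fin n) ℝ ≃ₜ FrameBundle (lagr n k) where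
  toFun x := ⟨(lagrPoint k x.1, fun j => ∑ i, x.2.1 i j • framing n k x.1 i), by
    intro z hz j
    have hz1 : z.1 = x.1 := congrArg Prod.fst hz
    rw [tangentSpace_lagr (hz ▸ (lagrPoint k x.1).2), hz1]
    change ∑ i, x.2.1 i j • framing n k x.1 i ∈ _
    exact Submodule.sum_mem _ fun i _ => Submodule.smul_mem _ (x.2.1 i j) (framing_mem x.1 i), by
    intro i j
    rw [← flatMetric_apply, flatMetric_sum_framing]
    have h := congrFun₂ ((Matrix.mem_orthogonalGroup_iff' _ _).1 x.2.2) i j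
    rwa [Matrix.one_apply] at h⟩
  invFun f := (f.1.1.1.1, ⟨Matrix.of fun i j => flatMetric n (framing n k f.1.1.1.1 i) (f.1.2 j), by
    rw [Matrix.mem_orthogonalGroup_iff']
    ext i j
    have hmem : ∀ j, f.1.2 j ∈ (planeMap 1 k f.1.1.1.1).range := fun j => by
      obtain ⟨z, hz⟩ := q_surjective (f.1.1.1)
      have h := f.2.1 z hz j
      rw [tangentSpace_lagr (hz ▸ f.1.1.2)] at h
      rwa [← hz]
    have h := f.2.2 i j
    rw [← flatMetric_apply, eq_sum_framing (hmem i), eq_sum_framing (hmem j),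
      flatMetric_sum_framing] at h
    rw [Matrix.one_apply, ← h]
    rfl⟩)
  left_inv x := by
    refine Prod.ext rfl (Subtype.ext ?_)
    ext i j
    exact flatMetric_framing_sum _ _ _
  right_inv f := by
    refine Subtype.ext (Prod.ext (lagrPoint_fst _) (funext fun j => ?_))
    obtain ⟨z, hz⟩ := q_surjective (f.1.1.1)
    have h := f.2.1 z hz j
    rw [tangentSpace_lagr (hz ▸ f.1.1.2)] at h
    refine (eq_sum_framing ?_).symm
    rwa [← hz]
  continuous_toFun := by
    have h1 (i j : Fin n) : Continuous
        fun x : (Fin n → ℝ) × Matrix.orthogonalGroup (Fin n) ℝ => x.2.1 i j :=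
      (continuous_subtype_val.comp continuous_snd).matrix_elem i j
    have h2 (i : Fin n) : Continuous
        fun x : (Fin n → ℝ) × Matrix.orthogonalGroup (Fin n) ℝ => framing n k x.1 i :=
      (continuous_apply i).comp (continuous_framing.comp continuous_fst)
    have h3 : Continuous fun x : (Fin n → ℝ) × Matrix.orthogonalGroup (Fin n) ℝ =>
        fun j => ∑ i, x.2.1 i j • framing n k x.1 i :=
      continuous_pi fun j => continuous_finsetSum _ fun i _ => (h1 i j).smul (h2 i)
    exact ((continuous_lagrPoint.comp continuous_fst).prodMk h3).subtype_mk _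
  continuous_invFun := by
    have h1 : Continuous fun f : FrameBundle (lagr n k) => f.1 := continuous_subtype_val
    have h2 : Continuous fun f : FrameBundle (lagr n k) => f.1.1.1.1 :=
      (lagrHomeo n k).continuous.comp (continuous_fst.comp h1)
    refine h2.prodMk (Continuous.subtype_mk (continuous_matrix fun i j => ?_) _)
    have h3 : Continuous fun f : FrameBundle (lagr n k) => framing n k f.1.1.1.1 i :=
      (continuous_apply i).comp (continuous_framing.comp h2)
    have h4 : Continuous fun f : FrameBundle (lagr n k) => f.1.2 j :=
      (continuous_apply j).comp (continuous_snd.comp h1)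
    simp only [Matrix.of_apply, flatMetric_apply, dotProduct]
    fun_prop

/-! ### Pin structures -/

instance : T2Space (Cl n) :=
  T2Space.of_injective_continuous (Module.finBasis ℝ (Cl n)).equivFun.injective
    (IsModuleTopology.continuous_of_linearMap (Module.finBasis ℝ (Cl n)).equivFun.toLinearMap)

instance : T2Space (PinPlus n) := T2Space.of_injective_continuous pinCoe_injective continuous_pinCoe

/-- The double covering `Pin⁺(n) → O(n)`. -/
def pinHom (n : ℕ) : PinPlus n →* Matrix.orthogonalGroup (Fin n) ℝ where
  toFun g := ⟨pinMatrix g, pinMatrix_mem g⟩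
  map_one' := Subtype.ext pinMatrix_one
  map_mul' g h := Subtype.ext (pinMatrix_mul g h)

theorem isOpenQuotientMap_pinHom : IsOpenQuotientMap (pinHom n) where
  surjective A := by
    obtain ⟨g, hg⟩ := exists_pinMatrix_eq A.2
    exact ⟨g, Subtype.ext hg⟩
  continuous := continuous_pinMatrix.subtype_mk _
  isOpenMap := IsOpenMap.of_sections fun g => by
    obtain ⟨σ, h1, h2, h3⟩ := exists_section g
    exact ⟨σ, h1, h2, fun A => Subtype.ext (h3 A)⟩

/-- The product of `ℝ^n` with the double covering is a covering: with `ℝ^n` regarded as a group it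
is an open surjective homomorphism with the finite kernel `{(0, 1), (0, -1)}`. -/
theorem isCoveringMap_prodMap_pinHom :
    IsCoveringMap (Prod.map id (pinHom n) :
      (Fin n → ℝ) × PinPlus n → (Fin n → ℝ) × Matrix.orthogonalGroup (Fin n) ℝ) := by
  let f : Multiplicative (Fin n → ℝ) × PinPlus n →*
    Multiplicative (Fin n → ℝ) × Matrix.orthogonalGroup (Fin n) ℝ :=
    (MonoidHom.id _).prodMap (pinHom n)
  have hf : IsOpenQuotientMap f := IsOpenQuotientMap.id.prodMap isOpenQuotientMap_pinHom
  refine (hf.isQuotientMap.isQuotientCoveringMap_of_isDiscrete_ker_monoidHom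
    (f := f) (Set.Finite.isDiscrete ?_)).isCoveringMap
  refine ((Set.finite_singleton (1, pinNegOne n)).insert 1).subset fun x hx => ?_
  have hx' : (x.1, pinHom n x.2) = 1 := hx
  obtain ⟨h1, h2⟩ := Prod.ext_iff.1 hx'
  rcases eq_or_eq_of_pinMatrix_eq_one (congrArg Subtype.val h2) with h | h
  · exact Or.inl (Prod.ext h1 h)
  · exact Or.inr (Prod.ext h1 h)

/-- The covering of the frame bundle by the trivial principal bundle. -/
def pinFrame (n : ℕ) (k : ℤ) (x : (Fin n → ℝ) × PinPlus n) : FrameBundle (lagr n k) :=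
  frameHomeo n k (x.1, pinHom n x.2)

theorem isCoveringMap_pinFrame : IsCoveringMap (pinFrame n k) :=
  isCoveringMap_prodMap_pinHom.homeomorph_comp (frameHomeo n k)

/-- The covering is equivariant for the right actions. -/
theorem pinFrame_mul (y : Fin n → ℝ) (g h : PinPlus n) (j : Fin n) :
    (pinFrame n k (y, g * h)).1.2 j =
      ∑ i, pinMatrix h i j • (pinFrame n k (y, g)).1.2 i := by
  change ∑ i, pinMatrix (g * h) i j • framing n k y i =
    ∑ i, pinMatrix h i j • ∑ l, pinMatrix g l i • framing n k y l
  simp only [pinMatrix_mul, Matrix.mul_apply, Finset.sum_smul, Finset.smul_sum, smul_smul]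
  rw [Finset.sum_comm]
  simp only [mul_comm]

/-- The pin structure defined by the framing. -/
def trivialPinStructure (n : ℕ) (k : ℤ) : PinStructure (lagr n k) where
  P := (Fin n → ℝ) × PinPlus n
  top := inferInstance
  proj := pinFrame n k
  isCoveringMap := isCoveringMap_pinFrame
  surjective := (frameHomeo n k).surjective.comp
    (Function.surjective_id.prodMap isOpenQuotientMap_pinHom.surjective)
  act x g := (x.1, x.2 * g)
  act_one x := by rw [mul_one]
  act_mul x g h := by rw [mul_assoc]
  continuous_act := by fun_prop
  equivariant x g A hA := by
    refine ⟨rfl, fun j => ?_⟩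
    rw [hA.unique (covers_pinMatrix g)]
    exact pinFrame_mul x.1 x.2 g j
  torsor x x' h := by
    have h' : x.1 = x'.1 := congrArg (fun p : lagr n k => p.1.1) h
    refine ⟨x.2⁻¹ * x'.2, Prod.ext h' (mul_inv_cancel_left _ _), fun g hg => ?_⟩
    rw [← hg, inv_mul_cancel_left]

/-- As `ℝ^n` is simply connected, the framing lifts to every pin structure. The lift is a section
of the principal bundle and so trivialises it. -/
theorem PinStructure.iso_of_trivial (P : PinStructure (lagr n k)) :
    (trivialPinStructure n k).Iso P := by
  let := P.top
  let s : C(Fin n → ℝ, FrameBundle (lagr n k)) :=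
    ⟨fun y => frameHomeo n k (y, 1), by fun_prop⟩
  obtain ⟨p₀, hp₀⟩ := P.surjective (s 0)
  obtain ⟨σ, ⟨-, hσ⟩, -⟩ := P.isCoveringMap.existsUnique_continuousMap_lifts s 0 p₀ hp₀
  have hσ' : ∀ y, P.proj (σ y) = frameHomeo n k (y, 1) := fun y => congrFun hσ y
  have hbase : ∀ y, (P.proj (σ y)).1.1 = lagrPoint k y := fun y => by rw [hσ']; rfl
  let Ψ : (Fin n → ℝ) × PinPlus n → P.P := fun x => P.act (σ x.1) x.2
  have hcont : Continuous Ψ :=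
    P.continuous_act.comp ((σ.continuous.comp continuous_fst).prodMk continuous_snd)
  have hbase' : ∀ x, (P.proj (Ψ x)).1.1 = lagrPoint k x.1 := fun x => by
    rw [(P.equivariant _ _ _ (covers_pinMatrix x.2)).1, hbase]
  have hproj : ∀ x, P.proj (Ψ x) = pinFrame n k x := fun x => by
    refine Subtype.ext (Prod.ext (hbase' x) (funext fun j => ?_))
    have h1 : ∀ y, P.proj (σ y) = pinFrame n k (y, 1) := fun y => by
      rw [hσ', pinFrame, map_one]
    have h := pinFrame_mul (k := k) x.1 1 x.2 j
    rw [one_mul] at h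
    rw [(P.equivariant _ _ _ (covers_pinMatrix x.2)).2, h1, h]
  have hbij : Function.Bijective Ψ := by
    refine ⟨fun x x' h => ?_, fun p => ?_⟩
    · have h1 : x.1 = x'.1 := by
        have := hbase' x
        rw [h, hbase'] at this
        exact (congrArg (fun p : lagr n k => p.1.1) this).symm
      obtain ⟨y, g⟩ := x
      obtain ⟨y', g'⟩ := x'
      obtain rfl : y = y' := h1
      exact congrArg (Prod.mk y)
        ((P.torsor (σ y) _ ((hbase y).trans (hbase' (y, g')).symm)).unique h rfl)
    · obtain ⟨g, hg, -⟩ := P.torsor (σ (P.proj p).1.1.1.1) p (by rw [hbase, lagrPoint_fst])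
      exact ⟨((P.proj p).1.1.1.1, g), hg⟩
  -- both bundles cover the frame bundle, so the trivialisation is a local homeomorphism
  have hloc : IsLocalHomeomorph Ψ := by
    refine IsLocalHomeomorph.of_comp (g := P.proj) ?_ P.isCoveringMap.isLocalHomeomorph hcont
    rw [show P.proj ∘ Ψ = pinFrame n k from funext hproj]
    exact isCoveringMap_pinFrame.isLocalHomeomorph
  exact ⟨hloc.toHomeomorphOfBijective hbij, hproj, fun x g => P.act_mul _ _ _⟩

theorem PinStructure.iso (P P' : PinStructure (lagr n k)) : P.Iso P' := by
  obtain ⟨f, hf, hf'⟩ := P.iso_of_trivial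
  obtain ⟨g, hg, hg'⟩ := P'.iso_of_trivial
  let := P.top
  let := P'.top
  let := (trivialPinStructure n k).top
  refine ⟨f.symm.trans g, fun p => ?_, fun p h => ?_⟩
  · rw [Homeomorph.trans_apply, hg, ← hf, Homeomorph.apply_symm_apply]
  · have : f.symm (P.act p h) = (trivialPinStructure n k).act (f.symm p) h := by
      rw [Homeomorph.symm_apply_eq, hf', Homeomorph.apply_symm_apply]
    rw [Homeomorph.trans_apply, this, hg', Homeomorph.trans_apply]

end PinStructures

end TDual

end

theorem mainTheorem4 (n : ℕ) (k : ℤ) :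
    TDual.IsFukayaLagrangian (TDual.lagr n k) ∧
    (∃ b : TDual.BraneStructure (TDual.lagr n k), TDual.IsCanonicalGrading k b.grading) ∧
    (∀ β β' : TDual.lagr n k → ℝ,
      TDual.IsCanonicalGrading k β → TDual.IsCanonicalGrading k β' → β = β') ∧
    (∀ P P' : TDual.PinStructure (TDual.lagr n k), P.Iso P') ∧
    (k ≠ 0 → ∀ N : ℕ, |k| ≤ N →
      (∀ L' : Set (TDual.CotTorus N n),
        TDual.IsLift N L' (TDual.lagr n k) ↔ ∃ a : Fin n → ℤ, L' = TDual.cellGraph N k a) ∧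
      ∀ a : Fin n → ℤ, Set.InjOn (TDual.toTorus N) (TDual.cell k a) ∧
        ∃! β : TDual.cellGraph N k a → ℝ, TDual.IsCellGrading N k a β) := by
  obtain ⟨θ, hθ⟩ := TDual.exists_canonicalGrading n k
  have hcan : TDual.IsCanonicalGrading k fun p : TDual.lagr n k => θ p.1.1 :=
    (hθ _).2 fun _ => rfl
  refine ⟨TDual.isFukayaLagrangian_lagr n k,
    ⟨⟨_, hcan.1, TDual.trivialPinStructure n k⟩, hcan⟩, fun β β' h h' => funext fun p => ?_,
    TDual.PinStructure.iso, fun hk N hN => ⟨TDual.isLift_iff hk hN, fun a =>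
      ⟨TDual.injOn_toTorus_cell hk hN, ?_⟩⟩⟩
  · rw [(hθ β).1 h, (hθ β').1 h']
  · obtain ⟨ϑ, -, -, hϑ⟩ := TDual.exists_cellGrading n hk
    exact ⟨fun x => ϑ x.1.1, (hϑ N hN a _).2 fun _ => rfl,
      fun β hβ => funext ((hϑ N hN a β).1 hβ)⟩
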